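/- Let $p>3$ be a prime, let $E$ and $E'$ be supersingular elliptic curves over $\mathbb F_p$ (that is, $E(\overline{\mathbb F}_p)$ and $E'(\overline{\mathbb F}_p)$ contain no point of order $p$), and let $\phi\colon E\to E'$ be an isogeny defined over $\mathbb F_p$. Let $\operatorname{End}_{\mathbb F_p}(E)$ and $\operatorname{End}_{\mathbb F_p}(E')$ denote the rings of endomorphisms defined over $\mathbb F_p$. If $\phi$ is non-horizontal, i.e. if the rings $\operatorname{End}_{\mathbb F_p}(E)$ and $\operatorname{End}_{\mathbb F_p}(E')$ are not isomorphic, then the degree $\deg\phi=[\mathbb F_p(E):\phi^*\mathbb F_p(E')]$ is divisible by $2$. -/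

import Mathlib

namespace IsogenyGraph

noncomputable section

open Polynomial Filter
open scoped Polynomial.Bivariate

universe u

variable {F : Type u} [Field F]

instance : DecidableEq (AlgebraicClosure F) := Classical.decEq _

/-- The base change of `E` to the algebraic closure of `F`. -/
abbrev geom (E : WeierstrassCurve.Affine F) : WeierstrassCurve.Affine (AlgebraicClosure F) :=
  E.map (algebraMap F (AlgebraicClosure F))

/-- The group `E(F̄)` of geometric points of a Weierstrass curve `E` over `F`. -/
abbrev GeomPoint (E : WeierstrassCurve.Affine F) : Type u :=
  (geom E).Point

/-- Selects the additive structure that comes from the group law. -/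
instance (priority := high) (E : WeierstrassCurve.Affine F) : AddZeroClass (GeomPoint E) :=
  AddMonoid.toAddZeroClass

/-- Evaluation of regular functions at an affine point over the base field. -/
def evalPt {K : Type*} [Field K] (V : WeierstrassCurve.Affine K) {x y : K}
    (h : V.Nonsingular x y) : V.CoordinateRing →+* K :=
  AdjoinRoot.evalEval h.1

/-- Evaluation of elements of the affine coordinate ring `F[E]` at an affine geometric point. -/
def evalGeom (E : WeierstrassCurve.Affine F) {x y : AlgebraicClosure F}
    (h : (geom E).Nonsingular x y) :
    E.CoordinateRing →+* AlgebraicClosure F :=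
  (evalPt (geom E) h).comp
    (WeierstrassCurve.Affine.CoordinateRing.map E (algebraMap F (AlgebraicClosure F)))

/-- `HasValueAt E u P c`: the geometric point `P` of `E` is affine, the rational function
`u ∈ F(E)` is regular at `P`, and its value there is `c`; that is, `u = a / d` with
`a, d ∈ F[E]`, `d(P) ≠ 0` and `c = a(P) / d(P)`. -/
def HasValueAt (E : WeierstrassCurve.Affine F) (u : E.FunctionField) :
    GeomPoint E → AlgebraicClosure F → Prop
  | .zero, _ => False
  | .some _ _ h, c => ∃ a d : E.CoordinateRing, evalGeom E h d ≠ 0 ∧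
      u * algebraMap _ E.FunctionField d = algebraMap _ E.FunctionField a ∧
      c * evalGeom E h d = evalGeom E h a

/-- Outside finitely many points, the map `f : E(F̄) → E'(F̄)` is given by `P ↦ (x(P), y(P))`. -/
def IsGivenBy (E E' : WeierstrassCurve.Affine F) (f : GeomPoint E → GeomPoint E')
    (x y : E.FunctionField) : Prop :=
  ∀ᶠ P in cofinite, ∃ a b, ∃ h, f P = .some a b h ∧ HasValueAt E x P a ∧ HasValueAt E y P b

/-- An isogeny `E → E'` defined over `F`: a homomorphism `E(F̄) → E'(F̄)` which, outside finitely
many points, is `P ↦ (x(P), y(P))` for two rational functions `x, y ∈ F(E)`, the pullbacks of the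
coordinate functions of `E'`. It is automatically not the zero map, which has no affine values. -/
def Isogeny (E E' : WeierstrassCurve.Affine F) : Type u :=
  {φ : (GeomPoint E →+ GeomPoint E') × E.FunctionField × E.FunctionField //
    IsGivenBy E E' φ.1 φ.2.1 φ.2.2}

/-- The map on geometric points. -/
def Isogeny.toHom {E E' : WeierstrassCurve.Affine F} (φ : Isogeny E E') :
    GeomPoint E →+ GeomPoint E' :=
  φ.1.1

/-- The pullback of the coordinate function `X` of `E'`. -/
def Isogeny.x {E E' : WeierstrassCurve.Affine F} (φ : Isogeny E E') : E.FunctionField :=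
  φ.1.2.1

/-- The pullback of the coordinate function `Y` of `E'`. -/
def Isogeny.y {E E' : WeierstrassCurve.Affine F} (φ : Isogeny E E') : E.FunctionField :=
  φ.1.2.2

lemma Isogeny.eventually_eq {E E' : WeierstrassCurve.Affine F} (φ : Isogeny E E') :
    ∀ᶠ P in cofinite, ∃ a b, ∃ h, φ.toHom P = .some a b h ∧
      HasValueAt E φ.x P a ∧ HasValueAt E φ.y P b :=
  φ.2

/-- The degree `[F(E) : φ^* F(E')]`; the image `φ^* F(E')` is the subfield `F(x, y)` generated by
the pullbacks of the two coordinate functions. -/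
def Isogeny.degree {E E' : WeierstrassCurve.Affine F} (φ : Isogeny E E') : ℕ :=
  Module.finrank (IntermediateField.adjoin F {φ.x, φ.y}) E.FunctionField

/-- Homomorphisms `E → E'` defined over `F`, as maps on geometric points: zero and the isogenies. -/
def IsHomOver (E E' : WeierstrassCurve.Affine F) (f : GeomPoint E →+ GeomPoint E') : Prop :=
  f = 0 ∨ ∃ φ : Isogeny E E', φ.toHom = f

/-! ### Homomorphisms over `F` are closed under the ring operations -/

section values

variable {E : WeierstrassCurve.Affine F} {u v : E.FunctionField} {P : GeomPoint E}
  {c d : AlgebraicClosure F}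

lemma HasValueAt.add (hu : HasValueAt E u P c) (hv : HasValueAt E v P d) :
    HasValueAt E (u + v) P (c + d) := by
  rcases P with _ | ⟨x, y, h⟩
  · exact hu
  obtain ⟨a, s, hs, h1, h2⟩ := hu
  obtain ⟨b, t, ht, h3, h4⟩ := hv
  refine ⟨a * t + b * s, s * t, by simp [hs, ht], ?_, ?_⟩
  · simp only [map_add, map_mul, ← h1, ← h3]; ring
  · simp only [map_add, map_mul, ← h2, ← h4]; ring

lemma HasValueAt.mul (hu : HasValueAt E u P c) (hv : HasValueAt E v P d) :
    HasValueAt E (u * v) P (c * d) := by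
  rcases P with _ | ⟨x, y, h⟩
  · exact hu
  obtain ⟨a, s, hs, h1, h2⟩ := hu
  obtain ⟨b, t, ht, h3, h4⟩ := hv
  refine ⟨a * b, s * t, by simp [hs, ht], ?_, ?_⟩
  · simp only [map_mul, ← h1, ← h3]; ring
  · simp only [map_mul, ← h2, ← h4]; ring

lemma HasValueAt.neg (hu : HasValueAt E u P c) : HasValueAt E (-u) P (-c) := by
  rcases P with _ | ⟨x, y, h⟩
  · exact hu
  obtain ⟨a, s, hs, h1, h2⟩ := hu
  exact ⟨-a, s, hs, by simp [← h1], by simp [← h2]⟩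

lemma HasValueAt.sub (hu : HasValueAt E u P c) (hv : HasValueAt E v P d) :
    HasValueAt E (u - v) P (c - d) := by
  simpa only [sub_eq_add_neg] using hu.add hv.neg

lemma HasValueAt.inv (hu : HasValueAt E u P c) (hc : c ≠ 0) : HasValueAt E u⁻¹ P c⁻¹ := by
  rcases P with _ | ⟨x, y, h⟩
  · exact hu
  obtain ⟨a, s, hs, h1, h2⟩ := hu
  have ha : evalGeom E h a ≠ 0 := by rw [← h2]; exact mul_ne_zero hc hs
  have hu0 : u ≠ 0 := by
    rintro rfl
    rw [zero_mul, eq_comm, IsFractionRing.to_map_eq_zero_iff] at h1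
    exact ha (by rw [h1, map_zero])
  exact ⟨s, a, ha, by rw [← h1, inv_mul_cancel_left₀ hu0], by rw [← h2, inv_mul_cancel_left₀ hc]⟩

lemma HasValueAt.div (hu : HasValueAt E u P c) (hv : HasValueAt E v P d) (hd : d ≠ 0) :
    HasValueAt E (u / v) P (c / d) := by
  simpa only [div_eq_mul_inv] using hu.mul (hv.inv hd)

lemma HasValueAt.unique (hu : HasValueAt E u P c) (hv : HasValueAt E u P d) : c = d := by
  rcases P with _ | ⟨x, y, h⟩
  · exact hu.elim
  obtain ⟨a, s, hs, h1, h2⟩ := hu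
  obtain ⟨b, t, ht, h3, h4⟩ := hv
  have : a * t = b * s := by
    apply IsFractionRing.injective _ E.FunctionField
    simp only [map_mul, ← h1, ← h3]; ring
  have := congrArg (evalGeom E h) this
  simp only [map_mul, ← h2, ← h4] at this
  have h0 : (c - d) * (evalGeom E h s * evalGeom E h t) = 0 := by linear_combination this
  exact sub_eq_zero.mp ((mul_eq_zero.mp h0).resolve_right (mul_ne_zero hs ht))

lemma evalGeom_mk {x y : AlgebraicClosure F}
    (h : (geom E).Nonsingular x y) (A : F[X][Y]) :
    evalGeom E h (WeierstrassCurve.Affine.CoordinateRing.mk E A) =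
      (A.map (mapRingHom (algebraMap F (AlgebraicClosure F)))).evalEval x y := by
  rw [evalGeom, RingHom.comp_apply, WeierstrassCurve.Affine.CoordinateRing.map_mk, evalPt]
  exact AdjoinRoot.evalEval_mk _ _

lemma hasValueAt_coe {x y : AlgebraicClosure F}
    (h : (geom E).Nonsingular x y)
    (a : E.CoordinateRing) :
    HasValueAt E (algebraMap _ E.FunctionField a) (.some x y h) (evalGeom E h a) :=
  ⟨a, 1, by simp, by simp, by simp⟩

lemma hasValueAt_const (hu : HasValueAt E u P c) (r : F) :
    HasValueAt E (algebraMap F E.FunctionField r) P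
      (algebraMap F (AlgebraicClosure F) r) := by
  rcases P with _ | ⟨x, y, h⟩
  · exact hu
  · have := hasValueAt_coe h (WeierstrassCurve.Affine.CoordinateRing.mk E (C (C r)))
    rw [evalGeom_mk] at this
    have e : algebraMap F E.FunctionField r = algebraMap E.CoordinateRing E.FunctionField
        (WeierstrassCurve.Affine.CoordinateRing.mk E (C (C r))) := by
      rw [IsScalarTower.algebraMap_apply F E.CoordinateRing E.FunctionField]; rfl
    rw [e]
    simpa only [Polynomial.map_C, coe_mapRingHom, evalEval_C, eval_C] using this

/-- Substitution of two rational functions into a bivariate polynomial. -/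
lemma HasValueAt.poly (hu : HasValueAt E u P c) (hv : HasValueAt E v P d) (A : F[X][Y]) :
    HasValueAt E (aevalAeval u v A) P
      ((A.map (mapRingHom (algebraMap F (AlgebraicClosure F)))).evalEval c d) := by
  have key : ∀ q : F[X], HasValueAt E (aeval u q) P
      ((q.map (algebraMap F (AlgebraicClosure F))).eval c) := by
    intro q
    induction q using Polynomial.induction_on' with
    | add p q hp hq => simpa using hp.add hq
    | monomial n r =>
      have : ∀ n : ℕ, HasValueAt E (u ^ n) P (c ^ n) := by
        intro n
        induction n with
        | zero => simpa using hasValueAt_const hu 1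
        | succ n ih => simpa only [pow_succ] using ih.mul hu
      simpa using (hasValueAt_const hu r).mul (this n)
  induction A using Polynomial.induction_on' with
  | add p q hp hq => simpa using hp.add hq
  | monomial n r =>
    have : ∀ n : ℕ, HasValueAt E (v ^ n) P (d ^ n) := by
      intro n
      induction n with
      | zero => simpa using hasValueAt_const hu 1
      | succ n ih => simpa only [pow_succ] using ih.mul hv
    have h2 := (key r).mul (this n)
    rw [← C_mul_X_pow_eq_monomial]
    simpa [evalEval] using h2

end values

section finiteness

lemma finite_zeros {K : Type*} [Field K] (V : WeierstrassCurve.Affine K) {a : V.CoordinateRing}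
    (ha : a ≠ 0) :
    {P : V.Point | ∀ x y, ∀ h, P = .some x y h → evalPt V h a = 0}.Finite := by
  classical
  obtain ⟨p, q, rfl⟩ := WeierstrassCurve.Affine.CoordinateRing.exists_smul_basis_eq a
  set N : K[X] := Algebra.norm K[X] (p • (1 : V.CoordinateRing) +
    q • WeierstrassCurve.Affine.CoordinateRing.mk V Y) with hN
  have : Module.Finite K[X] V.CoordinateRing :=
    .of_basis (WeierstrassCurve.Affine.CoordinateRing.basis V)
  have hN0 : N ≠ 0 := by rwa [hN, Ne, Algebra.norm_eq_zero_iff]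
  have hroot : ∀ x y, ∀ h : V.Nonsingular x y, evalPt V h
      (p • (1 : V.CoordinateRing) +
        q • WeierstrassCurve.Affine.CoordinateRing.mk V Y) = 0 → N.eval x = 0 := by
    intro x y h h0
    have e1 : evalPt V h (algebraMap K[X] _ N) = N.eval x := by
      refine (AdjoinRoot.evalEval_mk (p := V.polynomial) h.1 (C N)).trans ?_
      rw [evalEval_C]
    have e2 := WeierstrassCurve.Affine.CoordinateRing.coe_norm_smul_basis (W' := V) p q
    have e3 : evalPt V h (WeierstrassCurve.Affine.CoordinateRing.mk V
        (C p + C q * X)) = 0 := by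
      rw [← h0, WeierstrassCurve.Affine.CoordinateRing.smul,
        WeierstrassCurve.Affine.CoordinateRing.smul]
      simp
    rw [← e1]
    refine (congrArg (evalPt V h) e2).trans ?_
    rw [map_mul, map_mul, e3, zero_mul]
  let g : K × K → V.Point := fun z =>
    if h : V.Nonsingular z.1 z.2 then .some _ _ h else 0
  let S : Set (K × K) := {z | z.1 ∈ N.roots.toFinset ∧
    z.2 ∈ (V.polynomial.map (evalRingHom z.1)).roots.toFinset}
  have hS : S.Finite := by
    have : S ⊆ ⋃ x ∈ N.roots.toFinset, (fun y => (x, y)) ''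
        ((V.polynomial.map (evalRingHom x)).roots.toFinset : Set K) := by
      rintro ⟨x, y⟩ ⟨h1, h2⟩
      simp only [Set.mem_iUnion]
      exact ⟨x, h1, y, h2, rfl⟩
    refine Set.Finite.subset ?_ this
    exact Set.Finite.biUnion (Finset.finite_toSet _) fun x _ => (Finset.finite_toSet _).image _
  refine ((hS.image g).union (Set.finite_singleton 0)).subset ?_
  rintro (_ | ⟨x, y, h⟩) hP
  · exact Or.inr rfl
  · left
    refine ⟨(x, y), ⟨?_, ?_⟩, by simp [g, h]⟩
    · rw [Multiset.mem_toFinset, mem_roots hN0]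
      exact hroot x y h (hP x y h rfl)
    · rw [Multiset.mem_toFinset, mem_roots (Monic.map _
        WeierstrassCurve.Affine.monic_polynomial).ne_zero]
      have := h.1
      rw [WeierstrassCurve.Affine.Equation] at this
      rw [IsRoot, ← this, eval_map, eval₂_evalRingHom]

variable {E E' E'' : WeierstrassCurve.Affine F}

lemma eventually_affine_ne_zero {a : E.CoordinateRing} (ha : a ≠ 0) :
    ∀ᶠ P : GeomPoint E in cofinite, ∃ x y, ∃ h, P = .some x y h ∧ evalGeom E h a ≠ 0 := by
  have ha' := (map_ne_zero_iff _ (WeierstrassCurve.Affine.CoordinateRing.map_injective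
    (W' := E) (algebraMap F (AlgebraicClosure F)).injective)).mpr ha
  refine (finite_zeros _ ha').subset ?_
  intro P hP x y h hxy
  by_contra h0
  exact hP ⟨x, y, h, hxy, h0⟩

lemma eventually_hasValueAt (u : E.FunctionField) :
    ∀ᶠ P : GeomPoint E in cofinite, ∃ c, HasValueAt E u P c := by
  obtain ⟨a, d, hd, rfl⟩ := IsFractionRing.div_surjective (A := E.CoordinateRing) u
  have hd0 := nonZeroDivisors.ne_zero hd
  filter_upwards [eventually_affine_ne_zero hd0] with P hP
  obtain ⟨x, y, h, rfl, hx⟩ := hP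
  exact ⟨_, (hasValueAt_coe h a).div (hasValueAt_coe h d) hx⟩

lemma eventually_ne_zero {u : E.FunctionField} (hu : u ≠ 0) :
    ∀ᶠ P : GeomPoint E in cofinite, ∀ c, HasValueAt E u P c → c ≠ 0 := by
  filter_upwards [eventually_hasValueAt u⁻¹] with P hP c hc h0
  obtain ⟨d, hd⟩ := hP
  have h1 := hc.mul hd
  rw [mul_inv_cancel₀ hu] at h1
  have h2 := hasValueAt_const hc 1
  simp only [map_one] at h2
  have := h1.unique h2
  rw [h0, zero_mul] at this
  exact zero_ne_one this

/-- A rational function that takes a value infinitely often is constant. -/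
lemma eventually_eq_or_ne (u : E.FunctionField) (c : AlgebraicClosure F) :
    (∀ᶠ P : GeomPoint E in cofinite, HasValueAt E u P c) ∨
      ∀ᶠ P : GeomPoint E in cofinite, ¬ HasValueAt E u P c := by
  obtain ⟨a, d, hd, rfl⟩ := IsFractionRing.div_surjective (A := E.CoordinateRing) u
  have hd0 := nonZeroDivisors.ne_zero hd
  let m := WeierstrassCurve.Affine.CoordinateRing.map E
    (algebraMap F (AlgebraicClosure F))
  let k : (geom E).CoordinateRing :=
    WeierstrassCurve.Affine.CoordinateRing.mk _ (C (C c))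
  have hk : ∀ x y, ∀ h : (geom E).Nonsingular x y,
      evalPt (geom E) h (m a - k * m d) =
        evalGeom E h a - c * evalGeom E h d := by
    intro x y h
    have : evalPt (geom E) h k = c := by
      refine (AdjoinRoot.evalEval_mk _ _).trans ?_
      simp
    rw [map_sub, map_mul, this]; rfl
  by_cases h0 : m a - k * m d = 0
  · left
    filter_upwards [eventually_affine_ne_zero hd0] with P hP
    obtain ⟨x, y, h, rfl, hx⟩ := hP
    have h1 := hk x y h
    rw [h0, map_zero, eq_comm, sub_eq_zero] at h1
    convert (hasValueAt_coe h a).div (hasValueAt_coe h d) hx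
    rw [h1, mul_div_cancel_right₀ _ hx]
  · right
    have h2 : ∀ᶠ P : GeomPoint E in cofinite, ¬ ∀ x y, ∀ h, P = .some x y h →
        evalPt (geom E) h (m a - k * m d) = 0 := by
      have := finite_zeros _ h0
      simpa only [Filter.eventually_cofinite, not_not] using this
    filter_upwards [h2, eventually_affine_ne_zero hd0] with P hP hd hc
    apply hP
    intro x y h hxy
    obtain ⟨x', y', h', e, hx⟩ := hd
    subst hxy
    obtain ⟨rfl, rfl⟩ := WeierstrassCurve.Affine.Point.some.inj e
    have h1 := hc.unique ((hasValueAt_coe h a).div (hasValueAt_coe h d) hx)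
    rw [hk, h1, div_mul_cancel₀ _ hx, sub_self]

instance [E.IsElliptic] : Infinite (GeomPoint E) := by
  let V := geom E
  have : ∀ x : AlgebraicClosure F, ∃ P : V.Point, ∃ y h, P = .some x y h := by
    intro x
    obtain ⟨y, hy⟩ := IsAlgClosed.exists_root (V.polynomial.map (evalRingHom x)) (by
      rw [Monic.degree_map WeierstrassCurve.Affine.monic_polynomial,
        WeierstrassCurve.Affine.degree_polynomial]
      decide)
    have h : V.Equation x y := by
      rw [WeierstrassCurve.Affine.Equation, ← hy, eval_map, eval₂_evalRingHom]
    exact ⟨_, y, WeierstrassCurve.Affine.equation_iff_nonsingular.mp h, rfl⟩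
  choose f y h hf using this
  refine Infinite.of_injective f fun a b hab => ?_
  rw [hf a, hf b] at hab
  exact (WeierstrassCurve.Affine.Point.some.inj hab).1

/-- A homomorphism that is constant outside finitely many points is zero. -/
lemma eq_zero_of_eventually_const [E.IsElliptic] {f : GeomPoint E →+ GeomPoint E'}
    {Q : GeomPoint E'} (h : ∀ᶠ P in cofinite, f P = Q) : f = 0 := by
  ext1 P
  have h' : ∀ᶠ R in cofinite, f (P + R) = Q := (add_right_injective P).tendsto_cofinite.eventually h
  obtain ⟨R, h1, h2⟩ := (h'.and h).exists
  rw [map_add, h2] at h1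
  simpa using h1

/-- An isogeny has finite fibres. -/
lemma Isogeny.tendsto_cofinite [E.IsElliptic] (φ : Isogeny E E') :
    Tendsto φ.toHom cofinite cofinite := by
  have hne : φ.toHom ≠ 0 := by
    intro h0
    obtain ⟨P, a, b, h, hP, -⟩ := φ.eventually_eq.exists
    rw [h0] at hP
    exact WeierstrassCurve.Affine.Point.some_ne_zero h hP.symm
  refine Tendsto.cofinite_of_finite_preimage_singleton fun Q => ?_
  suffices h : ∀ᶠ P in cofinite, φ.toHom P ≠ Q by
    simp only [Filter.eventually_cofinite, not_not] at h
    exact h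
  rcases Q with _ | ⟨a, b, hab⟩
  · filter_upwards [φ.eventually_eq] with P hP h0
    obtain ⟨a, b, h, hP, -⟩ := hP
    rw [hP] at h0
    exact WeierstrassCurve.Affine.Point.some_ne_zero h h0
  · rcases eventually_eq_or_ne φ.x a with hx | hx
    · rcases eventually_eq_or_ne φ.y b with hy | hy
      · refine (hne (eq_zero_of_eventually_const (Q := .some a b hab) ?_)).elim
        filter_upwards [φ.eventually_eq, hx, hy] with P hP hx hy
        obtain ⟨a', b', h, hP, h1, h2⟩ := hP
        obtain rfl := hx.unique h1
        obtain rfl := hy.unique h2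
        exact hP
      · filter_upwards [φ.eventually_eq, hy] with P hP hy h0
        obtain ⟨a', b', h, hP, h1, h2⟩ := hP
        rw [hP] at h0
        obtain ⟨rfl, rfl⟩ := WeierstrassCurve.Affine.Point.some.inj h0
        exact hy h2
    · filter_upwards [φ.eventually_eq, hx] with P hP hx h0
      obtain ⟨a', b', h, hP, h1, h2⟩ := hP
      rw [hP] at h0
      obtain ⟨rfl, rfl⟩ := WeierstrassCurve.Affine.Point.some.inj h0
      exact hx h1

lemma isHomOver_id (E : WeierstrassCurve.Affine F) : IsHomOver E E (AddMonoidHom.id (GeomPoint E)) := by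
  let m := WeierstrassCurve.Affine.CoordinateRing.mk E
  refine Or.inr ⟨⟨⟨_, algebraMap _ _ (m (C X)), algebraMap _ _ (m Y)⟩, ?_⟩, rfl⟩
  filter_upwards [eventually_affine_ne_zero (E := E) one_ne_zero] with P hP
  obtain ⟨x, y, h, rfl, -⟩ := hP
  refine ⟨x, y, h, rfl, ?_, ?_⟩
  · have := hasValueAt_coe h (m (C X))
    rw [evalGeom_mk] at this
    simpa only [map_C, coe_mapRingHom, map_X, evalEval_C, eval_X] using this
  · have := hasValueAt_coe h (m Y)
    rw [evalGeom_mk] at this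
    simpa only [map_X, evalEval_X] using this

lemma IsHomOver.neg {f : GeomPoint E →+ GeomPoint E'} (hf : IsHomOver E E' f) :
    IsHomOver E E' (-f) := by
  rcases hf with rfl | ⟨φ, rfl⟩
  · exact Or.inl neg_zero
  refine Or.inr ⟨⟨⟨_, φ.x, -φ.y - algebraMap F _ E'.a₁ * φ.x - algebraMap F _ E'.a₃⟩, ?_⟩, rfl⟩
  filter_upwards [φ.eventually_eq] with P hP
  obtain ⟨a, b, h, hP, h1, h2⟩ := hP
  refine ⟨a, _, _, by
    rw [AddMonoidHom.neg_apply, hP, WeierstrassCurve.Affine.Point.neg_some], h1, ?_⟩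
  exact (h2.neg.sub ((hasValueAt_const h1 _).mul h1)).sub (hasValueAt_const h1 _)

lemma IsHomOver.comp [E.IsElliptic] {g : GeomPoint E' →+ GeomPoint E''}
    {f : GeomPoint E →+ GeomPoint E'} (hg : IsHomOver E' E'' g) (hf : IsHomOver E E' f) :
    IsHomOver E E'' (g.comp f) := by
  rcases hf with rfl | ⟨φ, rfl⟩
  · exact Or.inl (AddMonoidHom.comp_zero g)
  rcases hg with rfl | ⟨ψ, rfl⟩
  · exact Or.inl (AddMonoidHom.zero_comp _)
  have key : ∀ w : E'.FunctionField, ∃ w' : E.FunctionField,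
      ∀ᶠ P in cofinite, ∀ c, HasValueAt E' w (φ.toHom P) c → HasValueAt E w' P c := by
    intro w
    obtain ⟨a, d, hd, rfl⟩ := IsFractionRing.div_surjective (A := E'.CoordinateRing) w
    have hd0 := nonZeroDivisors.ne_zero hd
    obtain ⟨A, rfl⟩ := AdjoinRoot.mk_surjective a
    obtain ⟨D, rfl⟩ := AdjoinRoot.mk_surjective d
    refine ⟨aevalAeval φ.x φ.y A / aevalAeval φ.x φ.y D, ?_⟩
    filter_upwards [φ.eventually_eq,
      φ.tendsto_cofinite.eventually (eventually_affine_ne_zero hd0)] with P hP hD c hc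
    obtain ⟨a, b, h, hP, h1, h2⟩ := hP
    obtain ⟨a', b', h', hP', hne⟩ := hD
    rw [hP] at hP' hc
    obtain ⟨rfl, rfl⟩ := WeierstrassCurve.Affine.Point.some.inj hP'
    have h3 := hc.unique ((hasValueAt_coe h _).div (hasValueAt_coe h _) hne)
    rw [evalGeom_mk] at hne
    rw [h3, evalGeom_mk, evalGeom_mk]
    exact (h1.poly h2 A).div (h1.poly h2 D) hne
  obtain ⟨x', hx'⟩ := key ψ.x
  obtain ⟨y', hy'⟩ := key ψ.y
  refine Or.inr ⟨⟨⟨_, x', y'⟩, ?_⟩, rfl⟩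
  filter_upwards [hx', hy', φ.tendsto_cofinite.eventually ψ.eventually_eq] with P hx hy hP
  obtain ⟨a, b, h, hP, h1, h2⟩ := hP
  exact ⟨a, b, h, hP, hx _ h1, hy _ h2⟩

lemma IsHomOver.add [E.IsElliptic] {f g : GeomPoint E →+ GeomPoint E'}
    (hf : IsHomOver E E' f) (hg : IsHomOver E E' g) : IsHomOver E E' (f + g) := by
  classical
  rcases hf with rfl | ⟨φ, rfl⟩
  · rwa [zero_add]
  rcases hg with rfl | ⟨ψ, rfl⟩
  · rw [add_zero]; exact Or.inr ⟨φ, rfl⟩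
  let V : WeierstrassCurve.Affine (AlgebraicClosure F) := geom E'
  let k : F → E.FunctionField := algebraMap F _
  -- a rational function that eventually gives the slope gives the sum
  have key : ∀ s : E.FunctionField, (∀ᶠ P in cofinite, ∀ a b a' b',
      ∀ h : V.Nonsingular a b, ∀ h' : V.Nonsingular a' b',
      φ.toHom P = .some a b h → ψ.toHom P = .some a' b' h' →
      HasValueAt E φ.x P a → HasValueAt E φ.y P b →
      HasValueAt E ψ.x P a' → HasValueAt E ψ.y P b' →
      ¬ (a = a' ∧ b = V.negY a' b') ∧
        HasValueAt E s P (V.slope a a' b b')) →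
      IsHomOver E E' (φ.toHom + ψ.toHom) := by
    intro s hs
    let X₃ := s ^ 2 + k E'.a₁ * s - k E'.a₂ - φ.x - ψ.x
    refine Or.inr ⟨⟨⟨_, X₃, -(s * (X₃ - φ.x) + φ.y) - k E'.a₁ * X₃ - k E'.a₃⟩, ?_⟩, rfl⟩
    filter_upwards [hs, φ.eventually_eq, ψ.eventually_eq] with P hs h1 h2
    obtain ⟨a, b, h, hP, hx, hy⟩ := h1
    obtain ⟨a', b', h', hP', hx', hy'⟩ := h2
    obtain ⟨hne, hs⟩ := hs a b a' b' h h' hP hP' hx hy hx' hy'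
    have hk := hasValueAt_const hx
    have hX : HasValueAt E X₃ P (V.addX a a' (V.slope a a' b b')) := by
      have hs2 := hs.mul hs
      rw [← pow_two, ← pow_two] at hs2
      exact (((hs2.add ((hk _).mul hs)).sub (hk _)).sub hx).sub hx'
    refine ⟨_, _, _, by
      rw [AddMonoidHom.add_apply, hP, hP', WeierstrassCurve.Affine.Point.add_some hne], hX, ?_⟩
    exact ((((hs.mul (hX.sub hx)).add hy).neg).sub ((hk _).mul hX)).sub (hk _)
  by_cases hxx : φ.x = ψ.x
  · let w := φ.y - (-ψ.y - k E'.a₁ * ψ.x - k E'.a₃)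
    by_cases hw : w = 0
    · left
      refine eq_zero_of_eventually_const (Q := 0) ?_
      filter_upwards [φ.eventually_eq, ψ.eventually_eq] with P h1 h2
      obtain ⟨a, b, h, hP, hx, hy⟩ := h1
      obtain ⟨a', b', h', hP', hx', hy'⟩ := h2
      have hk := hasValueAt_const hx
      rw [AddMonoidHom.add_apply, hP, hP']
      refine WeierstrassCurve.Affine.Point.add_of_Y_eq ((hxx ▸ hx).unique hx') ?_
      rw [sub_eq_zero] at hw
      rw [hw] at hy
      exact hy.unique ((hy'.neg.sub ((hk _).mul hx')).sub (hk _))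
    · refine key ((3 * φ.x ^ 2 + 2 * k E'.a₂ * φ.x + k E'.a₄ - k E'.a₁ * φ.y) /
        (φ.y - (-φ.y - k E'.a₁ * φ.x - k E'.a₃))) ?_
      filter_upwards [eventually_ne_zero hw] with P hw a b a' b' h h' hP hP' hx hy hx' hy'
      have hk := hasValueAt_const hx
      have ha : a = a' := (hxx ▸ hx).unique hx'
      have hb : b ≠ V.negY a' b' := by
        have := hw _ (hy.sub ((hy'.neg.sub ((hk E'.a₁).mul hx')).sub (hk E'.a₃)))
        exact sub_ne_zero.mp this
      have hb' : b = b' := WeierstrassCurve.Affine.Y_eq_of_Y_ne h.1 h'.1 ha hb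
      refine ⟨fun H => hb H.2, ?_⟩
      rw [WeierstrassCurve.Affine.slope_of_Y_ne ha hb]
      have h3 : HasValueAt E (3 : E.FunctionField) P 3 := by
        simpa only [map_ofNat] using hk 3
      have h2 : HasValueAt E (2 : E.FunctionField) P 2 := by
        simpa only [map_ofNat] using hk 2
      have hx2 := hx.mul hx
      rw [← pow_two, ← pow_two] at hx2
      refine HasValueAt.div
        ((((h3.mul hx2).add ((h2.mul (hk _)).mul hx)).add (hk _)).sub ((hk _).mul hy))
        (hy.sub ((hy.neg.sub ((hk _).mul hx)).sub (hk _))) ?_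
      rw [← ha, ← hb'] at hb
      exact sub_ne_zero.mpr hb
  · refine key ((φ.y - ψ.y) / (φ.x - ψ.x)) ?_
    filter_upwards [eventually_ne_zero (sub_ne_zero.mpr hxx)] with
      P hne a b a' b' h h' hP hP' hx hy hx' hy'
    have ha := hne _ (hx.sub hx')
    refine ⟨fun H => ha (sub_eq_zero.mpr H.1), ?_⟩
    rw [WeierstrassCurve.Affine.slope_of_X_ne (sub_ne_zero.mp ha)]
    exact (hy.sub hy').div (hx.sub hx') ha

end finiteness

/-- The ring `End_F(E)` of endomorphisms of `E` defined over `F`, with pointwise addition and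
composition, as a subring of the endomorphism ring of the group `E(F̄)`. -/
def EndOver (E : WeierstrassCurve.Affine F) [E.IsElliptic] : Subring (AddMonoid.End (GeomPoint E)) where
  carrier := {f | IsHomOver E E f}
  zero_mem' := Or.inl rfl
  one_mem' := isHomOver_id E
  add_mem' := IsHomOver.add
  mul_mem' := IsHomOver.comp
  neg_mem' := IsHomOver.neg

/-- An isogeny over `F` is horizontal if `End_F(E)` and `End_F(E')` are isomorphic rings. -/
def Isogeny.IsHorizontal {E E' : WeierstrassCurve.Affine F} [E.IsElliptic] [E'.IsElliptic]
    (_φ : Isogeny E E') : Prop :=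
  Nonempty (EndOver E ≃+* EndOver E')

/-- A curve over a field of characteristic `p > 0` is supersingular if it has no geometric point
of order `p`. -/
def IsSupersingular (p : ℕ) [CharP F p] (E : WeierstrassCurve.Affine F) : Prop :=
  ∀ P : GeomPoint E, p • P = 0 → P = 0

end

end IsogenyGraph

/-!
The degree of an isogeny can be read off the height of the rational function describing its action
on `x`-coordinates. The addition formulas make this height satisfy the parallelogram law, so that
it is a multiplicative positive definite quadratic form on the endomorphism ring. For a
supersingular curve over `𝔽_p` both the Frobenius `π` and its dual are inseparable, so `p` divides
the trace of `π`; for `p > 3` the bound `t ^ 2 ≤ 4 * p` forces the trace to vanish. Hence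
`π ^ 2 = -p`, and the endomorphism ring is `ℤ[π]` or `ℤ[(1 + π) / 2]`.

The second case occurs exactly when `1 + π` kills the `2`-torsion, that is, when all points of
order two are rational. To halve `1 + π` in that case one uses that `x(P + π P) - e` is an explicit
square for every rational point `(e, t)` of order two. An isogeny whose kernel contains no point of
order two restricts to a Galois equivariant bijection of the `2`-torsion, so it preserves the case
and is horizontal.

If the kernel contains a point `T` of order two, then the `x`-coordinate of the isogeny is
invariant under translation by `T`, which acts on `x`-coordinates by an involution
`e + r / (x - e)`. Comparing numerators and denominators at the two fixed points shows that the
degree is even.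
-/

namespace IsogenyGraph

noncomputable section

open Polynomial Filter
open scoped Polynomial.Bivariate

universe u

/-! ### Heights of tuples of polynomials -/

/-- Two tuples are proportional if all their `2 × 2` minors vanish: if neither of them is zero,
they are homogeneous coordinates of the same point of projective space. -/
def Proportional {ι R : Type*} [Mul R] (v w : ι → R) : Prop :=
  ∀ i j, v i * w j = v j * w i

lemma Proportional.symm {ι R : Type*} [CommMagma R] {v w : ι → R} (h : Proportional v w) :
    Proportional w v := fun i j => by
  rw [mul_comm, h j i, mul_comm]

/-- The coefficients of the product of the linear forms with coefficients `v` and `w`; up to scalars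
this is the point of `ℙ² = Sym² ℙ¹` given by two points of `ℙ¹`. -/
def sym2 {R : Type*} [CommSemiring R] (v w : Fin 2 → R) : Fin 3 → R :=
  ![v 0 * w 0, v 0 * w 1 + v 1 * w 0, v 1 * w 1]

lemma map_sym2 {R S : Type*} [CommSemiring R] [CommSemiring S] (f : R →+* S) (v w : Fin 2 → R)
    (i : Fin 3) : f (sym2 v w i) = sym2 (fun j => f (v j)) (fun j => f (w j)) i := by
  fin_cases i <;> simp [sym2]

lemma exists_sym2_ne_zero {R : Type*} [CommSemiring R] [NoZeroDivisors R] {v w : Fin 2 → R}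
    (hv : ∃ i, v i ≠ 0) (hw : ∃ i, w i ≠ 0) : ∃ i, sym2 v w i ≠ 0 := by
  by_contra! h
  have h0 : v 0 * w 0 = 0 := h 0
  have h1 : v 0 * w 1 + v 1 * w 0 = 0 := h 1
  have h2 : v 1 * w 1 = 0 := h 2
  obtain ⟨i, hi⟩ := hv
  obtain ⟨j, hj⟩ := hw
  rw [mul_eq_zero] at h0 h2
  rcases h0 with h0 | h0 <;> rcases h2 with h2 | h2 <;> rw [h0, h2] at h1 <;>
    fin_cases i <;> fin_cases j <;> simp_all

lemma sym2_const_mul {R : Type*} [CommSemiring R] (a b : R) (v w : Fin 2 → R) (i : Fin 3) :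
    sym2 (fun j => a * v j) (fun j => b * w j) i = a * b * sym2 v w i := by
  fin_cases i <;> simp only [sym2, Fin.zero_eta, Fin.mk_one, Fin.reduceFinMk, Matrix.cons_val] <;>
    ring

section Degree

variable {R ι : Type*} [CommSemiring R] {v : ι → R[X]} {m : ℕ}

lemma natDegree_prod_pow_le (hv : ∀ i, (v i).natDegree ≤ m) (s : Finset ι) (e : ι → ℕ) :
    (∏ i ∈ s, v i ^ e i).natDegree ≤ (∑ i ∈ s, e i) * m := by
  refine (natDegree_prod_le _ _).trans ?_
  rw [Finset.sum_mul]
  exact Finset.sum_le_sum fun i _ => natDegree_pow_le_of_le _ (hv i)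

lemma coeff_prod_pow (hv : ∀ i, (v i).natDegree ≤ m) (s : Finset ι) (e : ι → ℕ) :
    (∏ i ∈ s, v i ^ e i).coeff ((∑ i ∈ s, e i) * m) = ∏ i ∈ s, (v i).coeff m ^ e i := by
  classical
  induction s using Finset.induction_on with
  | empty => simp
  | insert a s ha ih =>
    rw [Finset.prod_insert ha, Finset.sum_insert ha, Finset.prod_insert ha, add_mul,
      coeff_mul_add_eq_of_natDegree_le (natDegree_pow_le_of_le _ (hv a))
        (natDegree_prod_pow_le hv s e), coeff_pow_of_natDegree_le (hv a), ih]

lemma sum_exponents_eq_of_isHomogeneous {q : MvPolynomial ι R} {N : ℕ} (hq : q.IsHomogeneous N)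
    {s : ι →₀ ℕ} (hs : s ∈ q.support) : ∑ i ∈ s.support, s i = N := by
  simpa [Finsupp.weight_apply, Finsupp.sum] using hq (MvPolynomial.mem_support_iff.mp hs)

lemma eval_const_mul_of_isHomogeneous {q : MvPolynomial ι R} {N : ℕ} (hq : q.IsHomogeneous N)
    (c : R) (x : ι → R) :
    MvPolynomial.eval (fun i => c * x i) q = c ^ N * MvPolynomial.eval x q := by
  rw [MvPolynomial.eval_eq, MvPolynomial.eval_eq, Finset.mul_sum]
  refine Finset.sum_congr rfl fun s hs => ?_
  rw [← sum_exponents_eq_of_isHomogeneous hq hs, ← Finset.prod_pow_eq_pow_sum, mul_left_comm,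
    ← Finset.prod_mul_distrib]
  simp only [mul_pow]

lemma natDegree_aeval_le_of_isHomogeneous (hv : ∀ i, (v i).natDegree ≤ m) {q : MvPolynomial ι R}
    {N : ℕ} (hq : q.IsHomogeneous N) : (MvPolynomial.aeval v q).natDegree ≤ N * m := by
  rw [MvPolynomial.aeval_def, MvPolynomial.eval₂_eq]
  refine natDegree_sum_le_of_forall_le _ _ fun s hs => (natDegree_C_mul_le _ _).trans ?_
  rw [← sum_exponents_eq_of_isHomogeneous hq hs]
  exact natDegree_prod_pow_le hv _ _

lemma coeff_aeval_of_isHomogeneous (hv : ∀ i, (v i).natDegree ≤ m) {q : MvPolynomial ι R}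
    {N : ℕ} (hq : q.IsHomogeneous N) : (MvPolynomial.aeval v q).coeff (N * m) =
      MvPolynomial.eval (fun i => (v i).coeff m) q := by
  rw [MvPolynomial.aeval_def, MvPolynomial.eval₂_eq, MvPolynomial.eval_eq, finsetSum_coeff]
  refine Finset.sum_congr rfl fun s hs => ?_
  rw [algebraMap_eq, coeff_C_mul, ← coeff_prod_pow hv, sum_exponents_eq_of_isHomogeneous hq hs]

lemma eval_mvPolynomial_aeval (v : ι → R[X]) (q : MvPolynomial ι R) (z : R) :
    (MvPolynomial.aeval v q).eval z = MvPolynomial.eval (fun i => (v i).eval z) q := by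
  rw [MvPolynomial.aeval_def, MvPolynomial.eval₂_eq, MvPolynomial.eval_eq, eval_finsetSum]
  simp [eval_prod]

lemma eval_homogenize_eq_sum (p : R[X]) (n : ℕ) (x : Fin 2 → R) :
    MvPolynomial.eval x (p.homogenize n) =
      ∑ ij ∈ Finset.HasAntidiagonal.antidiagonal n, p.coeff ij.1 * (x 0 ^ ij.1 * x 1 ^ ij.2) := by
  rw [homogenize, map_sum]
  refine Finset.sum_congr rfl fun ij _ => ?_
  rw [MvPolynomial.eval_monomial, Finsupp.prod_fintype _ _ (by simp)]
  simp [Fin.prod_univ_two]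

lemma eval_homogenize_const_mul {p : R[X]} {n : ℕ} (hp : p.natDegree ≤ n) (c z : R) :
    MvPolynomial.eval (fun i => c * (![z, 1] : Fin 2 → R) i) (p.homogenize n) =
      c ^ n * p.eval z := by
  have hone : MvPolynomial.eval ![z, 1] (p.homogenize n) = p.eval z :=
    aeval_homogenize_of_eq_one hp ![z, 1] rfl
  rw [eval_const_mul_of_isHomogeneous (isHomogeneous_homogenize _), hone]

lemma eval_homogenize_of_eq_zero (p : R[X]) (n : ℕ) {x : Fin 2 → R} (hx : x 1 = 0) :
    MvPolynomial.eval x (p.homogenize n) = p.coeff n * x 0 ^ n := by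
  rw [eval_homogenize_eq_sum, Finset.sum_eq_single (n, 0)]
  · simp
  · rintro ⟨i, j⟩ h hne
    have hj : j ≠ 0 := by rintro rfl; simp_all
    simp [hx, hj]
  · simp

end Degree

section Height

variable {k ι κ : Type*} [Field k]

/-- `HasHeight v m`: the members of `v` have no common zero on `ℙ¹` when they are regarded as forms
of degree `m`. Such a `v` is a point of projective space over `k(X)` in lowest terms, and `m` is
its height; for two polynomials, `m` is the degree of the rational function `v 0 / v 1`. -/
structure HasHeight (v : ι → k[X]) (m : ℕ) : Prop where
  natDegree_le : ∀ i, (v i).natDegree ≤ m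
  coeff_ne : ∃ i, (v i).coeff m ≠ 0
  eval_ne : ∀ z, ∃ i, (v i).eval z ≠ 0

namespace HasHeight

lemma one_zero : HasHeight (k := k) ![1, 0] 0 where
  natDegree_le i := by fin_cases i <;> simp
  coeff_ne := ⟨0, by simp⟩
  eval_ne _ := ⟨0, by simp⟩

lemma X_pow_one (n : ℕ) : HasHeight (k := k) ![X ^ n, 1] n where
  natDegree_le i := by fin_cases i <;> simp
  coeff_ne := ⟨0, by simp⟩
  eval_ne _ := ⟨1, by simp⟩

protected lemma sym2 {v w : Fin 2 → k[X]} {m n : ℕ} (hv : HasHeight v m) (hw : HasHeight w n) :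
    HasHeight (sym2 v w) (m + n) where
  natDegree_le i := by
    have hm : ∀ i j, (v i * w j).natDegree ≤ m + n := fun i j =>
      natDegree_mul_le_of_le (hv.natDegree_le i) (hw.natDegree_le j)
    fin_cases i
    · exact hm 0 0
    · exact natDegree_add_le_of_degree_le (hm 0 1) (hm 1 0)
    · exact hm 1 1
  coeff_ne := by
    obtain ⟨i, hi⟩ := exists_sym2_ne_zero hv.coeff_ne hw.coeff_ne
    have hm : ∀ i j, (v i * w j).coeff (m + n) = (v i).coeff m * (w j).coeff n := fun i j =>
      coeff_mul_add_eq_of_natDegree_le (hv.natDegree_le i) (hw.natDegree_le j)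
    refine ⟨i, ?_⟩
    fin_cases i <;> simpa [IsogenyGraph.sym2, hm] using hi
  eval_ne z := by
    obtain ⟨i, hi⟩ := exists_sym2_ne_zero (hv.eval_ne z) (hw.eval_ne z)
    exact ⟨i, by rwa [← coe_evalRingHom, map_sym2]⟩

lemma aeval_forms {v : ι → k[X]} {m N : ℕ} (hv : HasHeight v m) {q : κ → MvPolynomial ι k}
    (hq : ∀ j, (q j).IsHomogeneous N)
    (hne : ∀ x : ι → k, (∃ i, x i ≠ 0) → ∃ j, MvPolynomial.eval x (q j) ≠ 0) :
    HasHeight (fun j => MvPolynomial.aeval v (q j)) (N * m) where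
  natDegree_le j := natDegree_aeval_le_of_isHomogeneous hv.natDegree_le (hq j)
  coeff_ne := by
    obtain ⟨j, hj⟩ := hne _ hv.coeff_ne
    exact ⟨j, by rwa [coeff_aeval_of_isHomogeneous hv.natDegree_le (hq j)]⟩
  eval_ne z := by
    obtain ⟨j, hj⟩ := hne _ (hv.eval_ne z)
    exact ⟨j, by rwa [eval_mvPolynomial_aeval]⟩

lemma exists_eval_homogenize_ne_zero {v : ι → k[X]} {m : ℕ} (hv : HasHeight v m) {x : Fin 2 → k}
    (hx : ∃ i, x i ≠ 0) : ∃ j, MvPolynomial.eval x ((v j).homogenize m) ≠ 0 := by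
  by_cases h1 : x 1 = 0
  · obtain ⟨j, hj⟩ := hv.coeff_ne
    have h0 : x 0 ≠ 0 := by simpa [Fin.exists_fin_two, h1] using hx
    exact ⟨j, by rw [eval_homogenize_of_eq_zero _ _ h1]; exact mul_ne_zero hj (pow_ne_zero _ h0)⟩
  · obtain ⟨j, hj⟩ := hv.eval_ne (x 0 / x 1)
    exact ⟨j, by
      rw [eval_homogenize (hv.natDegree_le j) _ h1]; exact mul_ne_zero hj (pow_ne_zero _ h1)⟩

lemma comp {u v : Fin 2 → k[X]} {m n : ℕ} (hu : HasHeight u n) (hv : HasHeight v m) :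
    HasHeight (fun j => MvPolynomial.aeval v ((u j).homogenize n)) (n * m) :=
  hv.aeval_forms (fun _ => isHomogeneous_homogenize _) fun _ => hu.exists_eval_homogenize_ne_zero

variable [IsAlgClosed k] {v w : ι → k[X]} {m n : ℕ}

lemma span_range_eq_top (hv : HasHeight v m) : Ideal.span (Set.range v) = ⊤ := by
  obtain ⟨g, hg⟩ := (IsPrincipalIdealRing.principal (Ideal.span (Set.range v))).principal
  have hdvd (i : ι) : g ∣ v i := Ideal.mem_span_singleton.mp
    (hg.le (Ideal.subset_span (Set.mem_range_self i)))
  rw [hg]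
  refine Ideal.span_singleton_eq_top.mpr (isUnit_iff_degree_eq_zero.mpr ?_)
  by_contra hdeg
  obtain ⟨z, hz⟩ := IsAlgClosed.exists_root g hdeg
  obtain ⟨i, hi⟩ := hv.eval_ne z
  exact hi (eval_eq_zero_of_dvd_of_eval_eq_zero (hdvd i) hz)

lemma dvd_of_forall_dvd_mul (hv : HasHeight v m) {a b : k[X]} (h : ∀ i, a ∣ v i * b) : a ∣ b := by
  have hspan : ∀ r ∈ Ideal.span (Set.range v), a ∣ r * b := by
    intro r hr
    induction hr using Submodule.span_induction with
    | mem x hx =>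
      obtain ⟨j, rfl⟩ := hx
      exact h j
    | zero => simp
    | add x y _ _ hx hy => rw [add_mul]; exact dvd_add hx hy
    | smul a x _ hx => rw [smul_eq_mul, mul_assoc]; exact hx.mul_left a
  simpa using hspan 1 (hv.span_range_eq_top ▸ Submodule.mem_top)

lemma dvd_of_proportional (hv : HasHeight v m) (h : Proportional v w) (i : ι) : v i ∣ w i :=
  hv.dvd_of_forall_dvd_mul fun j => ⟨w j, (h i j).symm⟩

lemma le_of_proportional (hv : HasHeight v m) (hw : HasHeight w n) (h : Proportional v w) :
    m ≤ n := by
  obtain ⟨i, hi⟩ := hv.coeff_ne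
  have hv0 : v i ≠ 0 := fun h0 => hi (by simp [h0])
  have hw0 : w i ≠ 0 := fun h0 => hv0 (zero_dvd_iff.mp (h0 ▸ hw.dvd_of_proportional h.symm i))
  calc m ≤ (v i).natDegree := le_natDegree_of_ne_zero hi
    _ ≤ (w i).natDegree := natDegree_le_of_dvd (hv.dvd_of_proportional h i) hw0
    _ ≤ n := hw.natDegree_le i

lemma eq_of_proportional (hv : HasHeight v m) (hw : HasHeight w n) (h : Proportional v w) :
    m = n :=
  le_antisymm (hv.le_of_proportional hw h) (hw.le_of_proportional hv h.symm)

end HasHeight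

end Height

/-! ### The `x`-coordinates of the sum and the difference of two points -/

section AddSub

open WeierstrassCurve WeierstrassCurve.Affine

variable {k : Type*} [Field k]

lemma eval_addSubMap (W : WeierstrassCurve k) (s t u : k) :
    (fun i => MvPolynomial.eval ![s, t, u] (addSubMap W i)) =
      ![s ^ 2 - W.b₄ * s * u - W.b₆ * t * u - W.b₈ * u ^ 2,
        2 * t * s + W.b₂ * s * u + W.b₄ * t * u + W.b₆ * u ^ 2,
        t ^ 2 - 4 * s * u] := by
  ext i
  fin_cases i <;> simp [addSubMap]

variable {W : WeierstrassCurve.Affine k}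

lemma sq_sub_negY {x y : k} (h : W.Equation x y) :
    (y - W.negY x y) ^ 2 = 4 * x ^ 3 + W.b₂ * x ^ 2 + 2 * W.b₄ * x + W.b₆ := by
  rw [equation_iff] at h
  simp only [b₂, b₄, b₆, negY]
  linear_combination 4 * h

lemma eval_addSubMap_sym2x_zero_left (B : W.Point) :
    (fun i => MvPolynomial.eval ((0 : W.Point).sym2x B) (addSubMap W i)) = B.sym2x B := by
  rcases B with _ | ⟨x, y, h⟩
  · rw [← Point.zero_def, Point.sym2x_zero_zero, eval_addSubMap]
    simp
  · rw [Point.sym2x_zero_some, Point.sym2x_some_some, eval_addSubMap]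
    simp [sq, two_mul]

variable [DecidableEq k]

lemma addX_add_addX {x₁ x₂ y₁ y₂ : k} (h₁ : W.Equation x₁ y₁) (h₂ : W.Equation x₂ y₂)
    (hx : x₁ ≠ x₂) :
    (x₁ - x₂) ^ 2 * (W.addX x₁ x₂ (W.slope x₁ x₂ y₁ y₂) +
      W.addX x₁ x₂ (W.slope x₁ x₂ y₁ (W.negY x₂ y₂))) =
      2 * (x₁ + x₂) * (x₁ * x₂) + W.b₂ * (x₁ * x₂) + W.b₄ * (x₁ + x₂) + W.b₆ := by
  rw [equation_iff] at h₁ h₂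
  rw [slope_of_X_ne hx, slope_of_X_ne hx]
  have hx' : x₁ - x₂ ≠ 0 := sub_ne_zero.mpr hx
  simp only [addX, negY, b₂, b₄, b₆]
  field_simp
  linear_combination 2 * h₁ + 2 * h₂

lemma addX_mul_addX {x₁ x₂ y₁ y₂ : k} (h₁ : W.Equation x₁ y₁) (h₂ : W.Equation x₂ y₂)
    (hx : x₁ ≠ x₂) :
    (x₁ - x₂) ^ 2 * (W.addX x₁ x₂ (W.slope x₁ x₂ y₁ y₂) *
      W.addX x₁ x₂ (W.slope x₁ x₂ y₁ (W.negY x₂ y₂))) =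
      (x₁ * x₂) ^ 2 - W.b₄ * (x₁ * x₂) - W.b₆ * (x₁ + x₂) - W.b₈ := by
  rw [equation_iff] at h₁ h₂
  rw [slope_of_X_ne hx, slope_of_X_ne hx]
  have hx' : x₁ - x₂ ≠ 0 := sub_ne_zero.mpr hx
  simp only [addX, negY, b₄, b₆, b₈]
  field_simp
  grind

lemma mul_addX_self {x y : k} (h : W.Equation x y) (hy : y ≠ W.negY x y) :
    (4 * x ^ 3 + W.b₂ * x ^ 2 + 2 * W.b₄ * x + W.b₆) * W.addX x x (W.slope x x y y) =
      x ^ 4 - W.b₄ * x ^ 2 - 2 * W.b₆ * x - W.b₈ := by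
  rw [← sq_sub_negY h, slope_of_Y_ne rfl hy]
  rw [equation_iff] at h
  have hy' : y - W.negY x y ≠ 0 := sub_ne_zero.mpr hy
  simp only [addX, negY, b₄, b₆, b₈] at hy' ⊢
  field_simp
  grind

lemma exists_eval_addSubMap_sym2x_some_self {x y : k} (h : W.Nonsingular x y) :
    ∃ c : k, (fun i => MvPolynomial.eval ((Point.some x y h).sym2x (.some x y h))
      (addSubMap W i)) = c • (Point.some x y h + .some x y h).sym2x 0 := by
  rw [Point.sym2x_some_some, eval_addSubMap]
  have hlast : (x + x) ^ 2 - 4 * (x * x) * 1 = 0 := by ring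
  have hmid : 2 * (x + x) * (x * x) + W.b₂ * (x * x) * 1 + W.b₄ * (x + x) * 1 + W.b₆ * 1 ^ 2 =
      4 * x ^ 3 + W.b₂ * x ^ 2 + 2 * W.b₄ * x + W.b₆ := by ring
  rw [hlast, hmid]
  by_cases hy : y = W.negY x y
  · refine ⟨(x * x) ^ 2 - W.b₄ * (x * x) * 1 - W.b₆ * (x + x) * 1 - W.b₈ * 1 ^ 2, ?_⟩
    rw [← sq_sub_negY h.1, sub_eq_zero.mpr hy, Point.add_self_of_Y_eq hy, Point.sym2x_zero_zero]
    simp [Matrix.smul_cons]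
  · refine ⟨4 * x ^ 3 + W.b₂ * x ^ 2 + 2 * W.b₄ * x + W.b₆, ?_⟩
    rw [Point.add_self_of_Y_ne hy, Point.sym2x_some_zero]
    simp only [Matrix.smul_cons, smul_eq_mul, mul_addX_self h.1 hy, Matrix.smul_empty]
    ring_nf

lemma exists_eval_addSubMap_sym2x_self (A : W.Point) :
    ∃ c : k, (fun i => MvPolynomial.eval (A.sym2x A) (addSubMap W i)) =
      c • (A + A).sym2x (A - A) := by
  rw [sub_self]
  rcases A with _ | ⟨x, y, h⟩
  · refine ⟨1, ?_⟩
    rw [← Point.zero_def, add_zero, Point.sym2x_zero_zero, eval_addSubMap]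
    simp
  · exact exists_eval_addSubMap_sym2x_some_self h

lemma eval_addSubMap_sym2x_some_some {x₁ x₂ y₁ y₂ : k} (h₁ : W.Nonsingular x₁ y₁)
    (h₂ : W.Nonsingular x₂ y₂) (hx : x₁ ≠ x₂) :
    (fun i => MvPolynomial.eval ((Point.some x₁ y₁ h₁).sym2x (.some x₂ y₂ h₂)) (addSubMap W i)) =
      (x₁ - x₂) ^ 2 • (Point.some x₁ y₁ h₁ + .some x₂ y₂ h₂).sym2x
        (.some x₁ y₁ h₁ - .some x₂ y₂ h₂) := by
  rw [sub_eq_add_neg (Point.some x₁ y₁ h₁), Point.neg_some, Point.add_of_X_ne hx,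
    Point.add_of_X_ne hx, Point.sym2x_some_some, Point.sym2x_some_some, eval_addSubMap]
  simp only [Matrix.smul_cons, smul_eq_mul, addX_mul_addX h₁.1 h₂.1 hx,
    addX_add_addX h₁.1 h₂.1 hx, Matrix.smul_empty]
  ring_nf

theorem exists_eval_addSubMap_sym2x (A B : W.Point) :
    ∃ c : k, (fun i => MvPolynomial.eval (A.sym2x B) (addSubMap W i)) =
      c • (A + B).sym2x (A - B) := by
  by_cases hAB : A = B
  · subst hAB
    exact exists_eval_addSubMap_sym2x_self A
  by_cases hAB' : B = -A
  · subst hAB'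
    obtain ⟨c, hc⟩ := exists_eval_addSubMap_sym2x_self A
    refine ⟨c, ?_⟩
    rw [Point.sym2x_neg_right, hc, sub_neg_eq_add, ← sub_eq_add_neg, Point.sym2x_comm]
  rcases A with _ | ⟨x₁, y₁, h₁⟩
  · refine ⟨1, ?_⟩
    rw [← Point.zero_def, zero_add, zero_sub, Point.sym2x_neg_right,
      eval_addSubMap_sym2x_zero_left, one_smul]
  rcases B with _ | ⟨x₂, y₂, h₂⟩
  · refine ⟨1, ?_⟩
    rw [← Point.zero_def, add_zero, sub_zero, Point.sym2x_comm _ 0,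
      eval_addSubMap_sym2x_zero_left, one_smul]
  have hx : x₁ ≠ x₂ := fun hx =>
    (Point.X_eq_iff.mp hx.symm).elim (fun h => hAB h.symm) hAB'
  exact ⟨_, eval_addSubMap_sym2x_some_some h₁ h₂ hx⟩

end AddSub

variable {F : Type u} [Field F]

local notation "F̄" => AlgebraicClosure F

/-! ### The height of the `x`-coordinate of a homomorphism -/

lemma eq_zero_of_eventually_eval_eq_zero {k : Type*} [Field k] [Infinite k] {r : k[X]}
    (h : ∀ᶠ x in cofinite, r.eval x = 0) : r = 0 :=
  eq_zero_of_infinite_isRoot r (frequently_cofinite_iff_infinite.mp h.frequently)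

section XHeight

open WeierstrassCurve.Affine (Point)

variable {E E' E'' : WeierstrassCurve.Affine F}

lemma eventually_affine (E : WeierstrassCurve.Affine F) :
    ∀ᶠ P : GeomPoint E in cofinite, ∃ x y h, P = .some x y h := by
  filter_upwards [eventually_affine_ne_zero (E := E) one_ne_zero] with P ⟨x, y, h, hP, _⟩
  exact ⟨x, y, h, hP⟩

lemma exists_equation {k : Type*} [Field k] [IsAlgClosed k] (W : WeierstrassCurve.Affine k)
    (x : k) : ∃ y, W.Equation x y := by
  obtain ⟨y, hy⟩ := IsAlgClosed.exists_root (W.polynomial.map (evalRingHom x)) (by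
    rw [Monic.degree_map WeierstrassCurve.Affine.monic_polynomial,
      WeierstrassCurve.Affine.degree_polynomial]
    decide)
  exact ⟨y, by rw [WeierstrassCurve.Affine.Equation, ← hy, eval_map, eval₂_evalRingHom]⟩

lemma eventually_x_of_eventually [E.IsElliptic] {Q : F̄ → Prop}
    (hQ : ∀ᶠ P : GeomPoint E in cofinite, ∀ x y h, P = .some x y h → Q x) :
    ∀ᶠ x in cofinite, Q x := by
  choose y hy using exists_equation (geom E)
  let s (x : F̄) : GeomPoint E :=
    .some x (y x) (WeierstrassCurve.Affine.equation_iff_nonsingular.mp (hy x))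
  have hs : Function.Injective s := fun a b hab => (Point.some.inj hab).1
  filter_upwards [hs.tendsto_cofinite.eventually hQ] with x hx
  exact hx _ _ _ rfl

lemma xRep_eq_of_mul_eq_mul {k : Type*} [Field k] {W : WeierstrassCurve.Affine k}
    {P Q : W.Point} {a b : k} (ha : a ≠ 0) (h : ∀ i, a * P.xRep i = b * Q.xRep i) :
    P.xRep = Q.xRep := by
  have h0 := h 0
  have h1 := h 1
  rcases P with _ | ⟨x, y, hP⟩ <;> rcases Q with _ | ⟨x', y', hQ⟩ <;>
    simp only [← Point.zero_def, Point.xRep_zero, Point.xRep_some, Matrix.cons_val_zero,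
      Matrix.cons_val_one, mul_one, mul_zero] at h0 h1 ⊢
  · exact absurd (by rw [h0, ← h1, zero_mul]) ha
  · exact absurd h1 ha
  · rw [mul_left_cancel₀ ha (h0.trans (by rw [h1]))]

/-- `HasXRep f v`: for almost all points `P` the `x`-coordinate of `f P` is `[v₀ : v₁]`, evaluated
at the `x`-coordinate of `P`. -/
def HasXRep (f : GeomPoint E → GeomPoint E') (v : Fin 2 → F̄[X]) : Prop :=
  ∀ᶠ P : GeomPoint E in cofinite, ∀ x y h, P = .some x y h →
    ∃ c : F̄, c ≠ 0 ∧ ∀ i, (v i).eval x = c * (f P).xRep i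

lemma hasXRep_zero : HasXRep (0 : GeomPoint E →+ GeomPoint E') ![1, 0] := by
  refine .of_forall fun P x y h _ => ⟨1, one_ne_zero, fun i => ?_⟩
  fin_cases i <;> simp

lemma hasXRep_id : HasXRep (AddMonoidHom.id (GeomPoint E)) ![X, 1] := by
  filter_upwards with P x y h hP
  exact ⟨1, one_ne_zero, fun i => by subst hP; fin_cases i <;> simp⟩

namespace HasXRep

lemma proportional [E.IsElliptic] {f : GeomPoint E → GeomPoint E'} {v w : Fin 2 → F̄[X]}
    (hv : HasXRep f v) (hw : HasXRep f w) : Proportional v w := fun i j => by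
  rw [← sub_eq_zero]
  refine eq_zero_of_eventually_eval_eq_zero (eventually_x_of_eventually (E := E) ?_)
  filter_upwards [hv, hw] with P hvP hwP x y h hP
  obtain ⟨c, -, hc⟩ := hvP x y h hP
  obtain ⟨d, -, hd⟩ := hwP x y h hP
  rw [eval_sub, eval_mul, eval_mul, hc, hc, hd, hd]
  ring

lemma proportional_addSubMap [E.IsElliptic] {f g : GeomPoint E →+ GeomPoint E'}
    {v₁ v₂ v₃ v₄ : Fin 2 → F̄[X]} (hf : HasXRep f v₁) (hg : HasXRep g v₂)
    (hadd : HasXRep (f + g : GeomPoint E →+ GeomPoint E') v₃)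
    (hsub : HasXRep (f - g : GeomPoint E →+ GeomPoint E') v₄) :
    Proportional (sym2 v₃ v₄)
      (fun j => MvPolynomial.aeval (sym2 v₁ v₂) (WeierstrassCurve.addSubMap (geom E') j)) :=
  fun i j => by
  rw [← sub_eq_zero]
  refine eq_zero_of_eventually_eval_eq_zero (eventually_x_of_eventually (E := E) ?_)
  filter_upwards [hf, hg, hadd, hsub] with P hfP hgP haddP hsubP x y h hP
  obtain ⟨c₁, -, h₁⟩ := hfP x y h hP
  obtain ⟨c₂, -, h₂⟩ := hgP x y h hP
  obtain ⟨c₃, -, h₃⟩ := haddP x y h hP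
  obtain ⟨c₄, -, h₄⟩ := hsubP x y h hP
  obtain ⟨c, hc⟩ := exists_eval_addSubMap_sym2x (f P) (g P)
  have hsym (i) : (sym2 v₃ v₄ i).eval x = c₃ * c₄ * (f P + g P).sym2x (f P - g P) i := by
    rw [← coe_evalRingHom, map_sym2]
    simp only [coe_evalRingHom, h₃, h₄, sym2_const_mul]
    rfl
  have hsym' : (fun i => (sym2 v₁ v₂ i).eval x) = fun i => c₁ * c₂ * (f P).sym2x (g P) i := by
    ext i
    rw [← coe_evalRingHom, map_sym2]
    simp only [coe_evalRingHom, h₁, h₂, sym2_const_mul]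
    rfl
  have hmap (j) : (MvPolynomial.aeval (sym2 v₁ v₂)
      (WeierstrassCurve.addSubMap (geom E') j)).eval x =
      (c₁ * c₂) ^ 2 * (c * (f P + g P).sym2x (f P - g P) j) := by
    rw [eval_mvPolynomial_aeval, hsym',
      eval_const_mul_of_isHomogeneous (WeierstrassCurve.isHomogeneous_addSubMap _ j)]
    exact congrArg _ (congrFun hc j)
  rw [eval_sub, eval_mul, eval_mul, hsym, hsym, hmap, hmap]
  ring

lemma comp {g : GeomPoint E' → GeomPoint E''} {f : GeomPoint E → GeomPoint E'}
    {u v : Fin 2 → F̄[X]} {N : ℕ} (hu : HasHeight u N) (hg : HasXRep g u) (hf : HasXRep f v)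
    (hfin : Tendsto f cofinite cofinite) :
    HasXRep (g ∘ f) (fun j => MvPolynomial.aeval v ((u j).homogenize N)) := by
  filter_upwards [hf, hfin.eventually hg, hfin.eventually (eventually_affine E')]
    with P hfP hgP ⟨x', y', h', hP'⟩ x y h hP
  obtain ⟨c, hc, hv⟩ := hfP x y h hP
  obtain ⟨d, hd, hu'⟩ := hgP x' y' h' hP'
  refine ⟨c ^ N * d, mul_ne_zero (pow_ne_zero _ hc) hd, fun j => ?_⟩
  have hv' : (fun i => (v i).eval x) = fun i => c * (![x', 1] : Fin 2 → F̄) i := by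
    ext i
    rw [hv, hP', Point.xRep_some]
  rw [eval_mvPolynomial_aeval, hv', eval_homogenize_const_mul (hu.natDegree_le j), hu', mul_assoc,
    Function.comp_apply]

end HasXRep

lemma HasHeight.addSubMap {k : Type*} [Field k] (W : WeierstrassCurve k) [W.IsElliptic]
    {v₁ v₂ : Fin 2 → k[X]} {m₁ m₂ : ℕ} (h₁ : HasHeight v₁ m₁) (h₂ : HasHeight v₂ m₂) :
    HasHeight (fun j => MvPolynomial.aeval (IsogenyGraph.sym2 v₁ v₂) (W.addSubMap j))
      (2 * (m₁ + m₂)) := by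
  refine (h₁.sym2 h₂).aeval_forms W.isHomogeneous_addSubMap fun x hx => ?_
  exact Function.ne_iff.mp (W.addSubMap_ne_zero (Function.ne_iff.mpr hx))

/-- The height of the `x`-coordinate of `f P` as a rational function of the `x`-coordinate of `P`.
For a nonzero homomorphism this is its degree; it is a junk value if `f` has no representation in
the sense of `HasXRep`. -/
def xHeight (f : GeomPoint E → GeomPoint E') : ℕ :=
  sInf {m | ∃ v, HasHeight v m ∧ HasXRep f v}

lemma xHeight_eq [E.IsElliptic] {f : GeomPoint E → GeomPoint E'} {v : Fin 2 → F̄[X]} {m : ℕ}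
    (hv : HasHeight v m) (hf : HasXRep f v) : xHeight f = m := by
  have hset : {m | ∃ v, HasHeight v m ∧ HasXRep f v} = {m} :=
    Set.eq_singleton_iff_unique_mem.mpr ⟨⟨v, hv, hf⟩, fun m' ⟨w, hw, hfw⟩ =>
      hw.eq_of_proportional hv (hfw.proportional hf)⟩
  rw [xHeight, hset, csInf_singleton]

lemma xHeight_zero [E.IsElliptic] : xHeight (0 : GeomPoint E →+ GeomPoint E') = 0 :=
  xHeight_eq .one_zero hasXRep_zero

lemma xHeight_id [E.IsElliptic] : xHeight (AddMonoidHom.id (GeomPoint E)) = 1 :=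
  xHeight_eq (by simpa using HasHeight.X_pow_one 1) hasXRep_id

lemma HasHeight.parallelogram [E.IsElliptic] [E'.IsElliptic] {f g : GeomPoint E →+ GeomPoint E'}
    {v₁ v₂ v₃ v₄ : Fin 2 → F̄[X]} {m₁ m₂ m₃ m₄ : ℕ}
    (h₁ : HasHeight v₁ m₁) (h₂ : HasHeight v₂ m₂) (h₃ : HasHeight v₃ m₃) (h₄ : HasHeight v₄ m₄)
    (hf : HasXRep f v₁) (hg : HasXRep g v₂)
    (hadd : HasXRep (f + g : GeomPoint E →+ GeomPoint E') v₃)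
    (hsub : HasXRep (f - g : GeomPoint E →+ GeomPoint E') v₄) :
    m₃ + m₄ = 2 * (m₁ + m₂) :=
  (h₃.sym2 h₄).eq_of_proportional (h₁.addSubMap (geom E') h₂)
    (hf.proportional_addSubMap hg hadd hsub)

end XHeight

section Coordinates

open WeierstrassCurve.Affine (Point CoordinateRing)

variable {E E' : WeierstrassCurve.Affine F}

/-- A polynomial in the coordinate `x`, as a rational function on `E`. -/
def ofX (E : WeierstrassCurve.Affine F) : F[X] →+* E.FunctionField :=
  (algebraMap E.CoordinateRing E.FunctionField).comp ((CoordinateRing.mk E).comp C)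

/-- The coordinate `y`, as a rational function on `E`. -/
def coordY (E : WeierstrassCurve.Affine F) : E.FunctionField :=
  algebraMap E.CoordinateRing E.FunctionField (CoordinateRing.mk E Y)

lemma algebraMap_smul_add_smul_mk_Y (p q : F[X]) :
    algebraMap E.CoordinateRing E.FunctionField (p • 1 + q • CoordinateRing.mk E Y) =
      ofX E p + ofX E q * coordY E := by
  rw [CoordinateRing.smul, CoordinateRing.smul, mul_one, map_add, map_mul]
  rfl

lemma eq_zero_of_ofX_add_ofX_mul_coordY_eq_zero {p q : F[X]}
    (h : ofX E p + ofX E q * coordY E = 0) : p = 0 ∧ q = 0 := by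
  rw [← algebraMap_smul_add_smul_mk_Y, IsFractionRing.to_map_eq_zero_iff] at h
  exact CoordinateRing.smul_basis_eq_zero h

lemma exists_mul_ofX_eq (u : E.FunctionField) :
    ∃ p q N : F[X], N ≠ 0 ∧ u * ofX E N = ofX E p + ofX E q * coordY E := by
  obtain ⟨a, d, hd, rfl⟩ := IsFractionRing.div_surjective (A := E.CoordinateRing) u
  have : Module.Finite F[X] E.CoordinateRing := .of_basis (CoordinateRing.basis E)
  obtain ⟨c, N, hN, hc⟩ :=
    Algebra.IsAlgebraic.exists_smul_eq_mul F[X] a (nonZeroDivisors.ne_zero hd)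
  obtain ⟨p, q, rfl⟩ := CoordinateRing.exists_smul_basis_eq c
  refine ⟨p, q, N, hN, ?_⟩
  have hd0 : algebraMap E.CoordinateRing E.FunctionField d ≠ 0 :=
    IsFractionRing.to_map_ne_zero_of_mem_nonZeroDivisors hd
  have hc' := congrArg (algebraMap E.CoordinateRing E.FunctionField) hc
  rw [CoordinateRing.smul, map_mul, map_mul, algebraMap_smul_add_smul_mk_Y] at hc'
  rw [div_mul_eq_mul_div, div_eq_iff hd0, mul_comm, mul_comm _ (algebraMap _ _ d), ← hc']
  rfl

lemma ofX_injective : Function.Injective (ofX E) :=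
  (injective_iff_map_eq_zero _).mpr fun p hp =>
    (eq_zero_of_ofX_add_ofX_mul_coordY_eq_zero (E := E) (p := p) (q := 0) (by simpa using hp)).1

lemma two_mul_coordY_add_ne_zero (h2 : (2 : F) ≠ 0) :
    2 * coordY E + ofX E (C E.a₁ * X + C E.a₃) ≠ 0 := fun h =>
  h2 <| C_eq_zero.mp (eq_zero_of_ofX_add_ofX_mul_coordY_eq_zero (E := E)
    (p := C E.a₁ * X + C E.a₃) (q := C 2) (by rwa [map_ofNat, map_ofNat, add_comm])).2

lemma hasValueAt_ofX {x y : F̄} (h : (geom E).Nonsingular x y) (p : F[X]) :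
    HasValueAt E (ofX E p) (.some x y h) ((p.map (algebraMap F F̄)).eval x) := by
  have hval := hasValueAt_coe h (CoordinateRing.mk E (C p))
  rwa [evalGeom_mk, map_C, coe_mapRingHom, evalEval_C] at hval

lemma hasValueAt_coordY {x y : F̄} (h : (geom E).Nonsingular x y) :
    HasValueAt E (coordY E) (.some x y h) y := by
  have hval := hasValueAt_coe h (CoordinateRing.mk E Y)
  rwa [evalGeom_mk, map_X, evalEval_X] at hval

/-- A function `p + q y` in `F(x) ⊕ F(x) y` takes values at `P` and `-P` differing by
`q (y + y + a₁ x + a₃)`. -/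
lemma coeff_coordY_eq_zero_of_neg_invariant [E.IsElliptic] (h2 : (2 : F) ≠ 0)
    {u : E.FunctionField} {p q N : F[X]} (hpq : u * ofX E N = ofX E p + ofX E q * coordY E)
    (hu : ∀ᶠ P : GeomPoint E in cofinite, ∃ c, HasValueAt E u P c ∧ HasValueAt E u (-P) c) :
    q = 0 := by
  by_contra hq
  have hdiff : ofX E q * (2 * coordY E + ofX E (C E.a₁ * X + C E.a₃)) ≠ 0 :=
    mul_ne_zero ((map_ne_zero_iff _ ofX_injective).mpr hq) (two_mul_coordY_add_ne_zero h2)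
  obtain ⟨P, ⟨c, hc, hc'⟩, ⟨x, y, h, rfl⟩, hne⟩ :=
    (hu.and ((eventually_affine E).and (eventually_ne_zero hdiff))).exists
  rw [Point.neg_some] at hc'
  have htwo : HasValueAt E 2 (.some x y h) 2 := by
    simpa only [map_ofNat] using hasValueAt_const (hasValueAt_coordY h) 2
  refine hne _ ((hasValueAt_ofX h q).mul ((htwo.mul (hasValueAt_coordY h)).add
    (hasValueAt_ofX h _))) ?_
  have hP := (hpq ▸ hc.mul (hasValueAt_ofX h N)).unique ((hasValueAt_ofX h p).add
    ((hasValueAt_ofX h q).mul (hasValueAt_coordY h)))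
  have hnegP := (hpq ▸ hc'.mul (hasValueAt_ofX _ N)).unique ((hasValueAt_ofX _ p).add
    ((hasValueAt_ofX _ q).mul (hasValueAt_coordY _)))
  simp only [WeierstrassCurve.Affine.negY, WeierstrassCurve.map_a₁,
    WeierstrassCurve.map_a₃] at hnegP
  simp only [Polynomial.map_add, Polynomial.map_mul, map_C, map_X, eval_add, eval_mul, eval_C,
    eval_X]
  linear_combination hnegP - hP

lemma exists_isCoprime_mul_map_eq {K : Type*} [Field K] {f : F[X] →+* K}
    (hf : Function.Injective f) {u : K} {p N : F[X]} (hN : N ≠ 0) (h : u * f N = f p) :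
    ∃ n d : F[X], IsCoprime n d ∧ d ≠ 0 ∧ u * f d = f n := by
  classical
  let _ := EuclideanDomain.gcdMonoid F[X]
  set g := GCDMonoid.gcd p N
  have hg : g ≠ 0 := gcd_ne_zero_of_right hN
  have hp : g * (p / g) = p := EuclideanDomain.mul_div_cancel' hg (GCDMonoid.gcd_dvd_left p N)
  have hN' : g * (N / g) = N := EuclideanDomain.mul_div_cancel' hg (GCDMonoid.gcd_dvd_right p N)
  refine ⟨p / g, N / g, isCoprime_div_gcd_div_gcd hN, ?_, ?_⟩
  · exact right_ne_zero_of_mul (hN'.symm ▸ hN)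
  · refine mul_left_cancel₀ ((map_ne_zero_iff _ hf).mpr hg) ?_
    rw [← map_mul, hp, ← h, mul_left_comm, ← map_mul, hN']

lemma exists_mul_ofX_eq_ofX [E.IsElliptic] (h2 : (2 : F) ≠ 0) {u : E.FunctionField}
    (hu : ∀ᶠ P : GeomPoint E in cofinite, ∃ c, HasValueAt E u P c ∧ HasValueAt E u (-P) c) :
    ∃ n d : F[X], IsCoprime n d ∧ d ≠ 0 ∧ u * ofX E d = ofX E n := by
  obtain ⟨p, q, N, hN, h⟩ := exists_mul_ofX_eq u
  refine exists_isCoprime_mul_map_eq ofX_injective (p := p) hN ?_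
  rw [h, coeff_coordY_eq_zero_of_neg_invariant h2 h hu, map_zero, zero_mul, add_zero]

lemma Isogeny.exists_x_mul_ofX_eq [E.IsElliptic] (h2 : (2 : F) ≠ 0) (φ : Isogeny E E') :
    ∃ n d : F[X], IsCoprime n d ∧ d ≠ 0 ∧ φ.x * ofX E d = ofX E n := by
  refine exists_mul_ofX_eq_ofX h2 ?_
  filter_upwards [φ.eventually_eq,
    neg_injective.tendsto_cofinite.eventually φ.eventually_eq] with P hP hnegP
  obtain ⟨a, b, h, hφP, ha, -⟩ := hP
  obtain ⟨a', b', h', hφnegP, ha', -⟩ := hnegP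
  rw [map_neg, hφP, Point.neg_some] at hφnegP
  obtain ⟨rfl, rfl⟩ := Point.some.inj hφnegP
  exact ⟨a, ha, ha'⟩

lemma HasHeight.of_isCoprime {k : Type*} [Field k] {n d : k[X]} (h : IsCoprime n d) :
    HasHeight ![n, d] (max n.natDegree d.natDegree) where
  natDegree_le i := by fin_cases i <;> simp
  coeff_ne := by
    rcases le_or_gt n.natDegree d.natDegree with hle | hlt
    · rw [max_eq_right hle]
      by_cases hd : d = 0
      · have hn : n ≠ 0 := fun hn => not_isCoprime_zero_zero (hn ▸ hd ▸ h)
        have hdeg : d.natDegree = n.natDegree := le_antisymm (by simp [hd]) hle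
        exact ⟨0, hdeg ▸ leadingCoeff_ne_zero.mpr hn⟩
      · exact ⟨1, leadingCoeff_ne_zero.mpr hd⟩
    · rw [max_eq_left hlt.le]
      exact ⟨0, leadingCoeff_ne_zero.mpr (ne_zero_of_natDegree_gt hlt)⟩
  eval_ne z := by
    obtain ⟨a, b, hab⟩ := h
    by_contra! h0
    have hn : n.eval z = 0 := h0 0
    have hd : d.eval z = 0 := h0 1
    simpa [hn, hd] using congrArg (eval z) hab

lemma HasHeight.map_of_isCoprime {n d : F[X]} (h : IsCoprime n d) :
    HasHeight ![n.map (algebraMap F F̄), d.map (algebraMap F F̄)]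
      (max n.natDegree d.natDegree) := by
  simpa only [coe_mapRingHom, natDegree_map] using
    HasHeight.of_isCoprime (h.map (mapRingHom (algebraMap F F̄)))

lemma Isogeny.hasXRep (φ : Isogeny E E') {n d : F[X]} (hd : d ≠ 0)
    (h : φ.x * ofX E d = ofX E n) :
    HasXRep φ.toHom ![n.map (algebraMap F F̄), d.map (algebraMap F F̄)] := by
  filter_upwards [φ.eventually_eq,
    eventually_ne_zero ((map_ne_zero_iff _ (ofX_injective (E := E))).mpr hd)]
    with P ⟨a, b, hab, hφP, ha, _⟩ hne x y hxy hP
  subst hP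
  refine ⟨_, hne _ (hasValueAt_ofX hxy d), fun i => ?_⟩
  rw [hφP, Point.xRep_some]
  fin_cases i
  · exact ((hasValueAt_ofX hxy n).unique (h ▸ ha.mul (hasValueAt_ofX hxy d))).trans (mul_comm _ _)
  · exact (mul_one _).symm

end Coordinates

section XHeightHom

open WeierstrassCurve.Affine (Point)

variable {E E' E'' : WeierstrassCurve.Affine F} [E.IsElliptic]

lemma IsHomOver.exists_hasXRep (h2 : (2 : F) ≠ 0) {f : GeomPoint E →+ GeomPoint E'}
    (hf : IsHomOver E E' f) : ∃ v m, HasHeight v m ∧ HasXRep f v := by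
  rcases hf with rfl | ⟨φ, rfl⟩
  · exact ⟨_, _, .one_zero, hasXRep_zero⟩
  · obtain ⟨n, d, hnd, hd, h⟩ := φ.exists_x_mul_ofX_eq h2
    exact ⟨_, _, .map_of_isCoprime hnd, φ.hasXRep hd h⟩

lemma xHeight_add_add_xHeight_sub [E'.IsElliptic] (h2 : (2 : F) ≠ 0)
    {f g : GeomPoint E →+ GeomPoint E'} (hf : IsHomOver E E' f) (hg : IsHomOver E E' g) :
    xHeight (f + g : GeomPoint E →+ GeomPoint E') +
      xHeight (f - g : GeomPoint E →+ GeomPoint E') = 2 * (xHeight f + xHeight g) := by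
  have hsub : IsHomOver E E' (f - g) := sub_eq_add_neg f g ▸ hf.add hg.neg
  obtain ⟨v₁, m₁, h₁, hv₁⟩ := hf.exists_hasXRep h2
  obtain ⟨v₂, m₂, h₂, hv₂⟩ := hg.exists_hasXRep h2
  obtain ⟨v₃, m₃, h₃, hv₃⟩ := (hf.add hg).exists_hasXRep h2
  obtain ⟨v₄, m₄, h₄, hv₄⟩ := hsub.exists_hasXRep h2
  rw [xHeight_eq h₁ hv₁, xHeight_eq h₂ hv₂, xHeight_eq h₃ hv₃, xHeight_eq h₄ hv₄]
  exact h₁.parallelogram h₂ h₃ h₄ hv₁ hv₂ hv₃ hv₄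

lemma xHeight_comp [E'.IsElliptic] (h2 : (2 : F) ≠ 0) {g : GeomPoint E' →+ GeomPoint E''}
    {f : GeomPoint E →+ GeomPoint E'} (hg : IsHomOver E' E'' g) (hf : IsHomOver E E' f) :
    xHeight (g.comp f) = xHeight g * xHeight f := by
  obtain ⟨u, n, hu, hgu⟩ := hg.exists_hasXRep h2
  obtain ⟨v, m, hv, hfv⟩ := hf.exists_hasXRep h2
  rcases hf with rfl | ⟨φ, rfl⟩
  · rw [AddMonoidHom.comp_zero, xHeight_zero, xHeight_zero, mul_zero]
  · rw [xHeight_eq hu hgu, xHeight_eq hv hfv]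
    have hcomp : HasXRep (g ∘ φ.toHom) _ := hgu.comp hu hfv φ.tendsto_cofinite
    exact xHeight_eq (hu.comp hv) hcomp

lemma eq_zero_of_xHeight_eq_zero (h2 : (2 : F) ≠ 0) {f : GeomPoint E →+ GeomPoint E'}
    (hf : IsHomOver E E' f) (h0 : xHeight f = 0) : f = 0 := by
  obtain ⟨v, m, hv, hfv⟩ := hf.exists_hasXRep h2
  rcases hf with rfl | ⟨φ, rfl⟩
  · rfl
  exfalso
  obtain rfl : m = 0 := (xHeight_eq hv hfv).symm.trans h0
  have hconst (i z z') : (v i).eval z = (v i).eval z' := by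
    rw [eq_C_of_natDegree_le_zero (hv.natDegree_le i), eval_C, eval_C]
  obtain ⟨P₀, hP₀, x₀, y₀, h₀, rfl⟩ := (hfv.and (eventually_affine E)).exists
  obtain ⟨c₀, -, hc₀⟩ := hP₀ x₀ y₀ h₀ rfl
  have hfiber (Q) : ∀ᶠ P in cofinite, φ.toHom P ≠ Q :=
    φ.tendsto_cofinite.eventually (Set.finite_singleton Q).eventually_cofinite_notMem
  obtain ⟨P, hP, ⟨x, y, h, rfl⟩, hne, hne'⟩ := (hfv.and ((eventually_affine E).and
    ((hfiber (φ.toHom (.some x₀ y₀ h₀))).and (hfiber (-φ.toHom (.some x₀ y₀ h₀)))))).exists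
  obtain ⟨c, hc, hcv⟩ := hP x y h rfl
  have hx := xRep_eq_of_mul_eq_mul (Q := φ.toHom (.some x₀ y₀ h₀)) hc fun i => by
    rw [← hcv, hconst i x x₀, hc₀]
  exact (Point.eq_or_eq_neg_of_xRep_eq_xRep hx).elim hne hne'

end XHeightHom

/-! ### Rings with a positive definite multiplicative quadratic form -/

section NormForm

variable {R : Type*} [Ring R]

/-- A positive definite integral quadratic form on a ring which is multiplicative, such as the
degree on the endomorphism ring of an elliptic curve. Quadraticity is encoded by the
parallelogram law. -/
structure IsNormForm (q : R → ℤ) : Prop where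
  map_mul : ∀ a b, q (a * b) = q a * q b
  parallelogram : ∀ a b, q (a + b) + q (a - b) = 2 * (q a + q b)
  map_one : q 1 = 1
  nonneg : ∀ a, 0 ≤ q a
  eq_zero : ∀ a, q a = 0 → a = 0

namespace IsNormForm

variable {q : R → ℤ}

lemma polar_add (hq : IsNormForm q) (a b c : R) :
    q (a + b + c) - q (a + b) - q c = (q (a + c) - q a - q c) + (q (b + c) - q b - q c) := by
  have h₁ := hq.parallelogram (a + b) c
  have h₂ := hq.parallelogram a (b - c)
  have h₃ := hq.parallelogram (a + c) b
  have h₄ := hq.parallelogram b c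
  rw [show a + (b - c) = a + b - c by abel, show a - (b - c) = a + c - b by abel] at h₂
  rw [show a + c + b = a + b + c by abel] at h₃
  linarith

/-- The bilinear form polar to a norm form; its value at `(a, 1)` plays the role of the trace
of `a`. -/
def polar (hq : IsNormForm q) : R →+ R →+ ℤ :=
  AddMonoidHom.mk' (fun a => AddMonoidHom.mk' (fun b => q (a + b) - q a - q b) fun b c => by
    have h := hq.polar_add b c a
    rw [add_comm (b + c) a, add_comm b a, add_comm c a] at h
    linarith) fun a b => by
      ext c
      exact hq.polar_add a b c

lemma polar_apply (hq : IsNormForm q) (a b : R) : hq.polar a b = q (a + b) - q a - q b := rfl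

lemma map_add (hq : IsNormForm q) (a b : R) : q (a + b) = q a + q b + hq.polar a b := by
  rw [hq.polar_apply]; ring

lemma polar_comm (hq : IsNormForm q) (a b : R) : hq.polar a b = hq.polar b a := by
  rw [hq.polar_apply, hq.polar_apply, add_comm]; ring

lemma map_zero (hq : IsNormForm q) : q 0 = 0 := by
  have h := hq.parallelogram 0 0
  rw [add_zero, sub_zero] at h
  linarith

lemma polar_self (hq : IsNormForm q) (a : R) : hq.polar a a = 2 * q a := by
  have h := hq.parallelogram a a
  rw [sub_self, hq.map_zero] at h
  rw [hq.polar_apply]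
  linarith

lemma map_zsmul (hq : IsNormForm q) (n : ℤ) (a : R) : q (n • a) = n ^ 2 * q a := by
  have h := hq.polar_self (n • a)
  simp only [_root_.map_zsmul, AddMonoidHom.zsmul_apply, hq.polar_self, smul_eq_mul] at h
  linarith

lemma eq_zero_of_zsmul_eq_zero (hq : IsNormForm q) {n : ℤ} (hn : n ≠ 0) {a : R}
    (h : n • a = 0) : a = 0 := by
  refine hq.eq_zero a ((mul_eq_zero.mp ?_).resolve_left (pow_ne_zero 2 hn))
  rw [← hq.map_zsmul, h, hq.map_zero]

lemma polar_mul_mul (hq : IsNormForm q) (c a b : R) :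
    hq.polar (c * a) (c * b) = q c * hq.polar a b := by
  rw [hq.polar_apply, hq.polar_apply, ← mul_add, hq.map_mul, hq.map_mul, hq.map_mul]
  ring

lemma polar_mul_mul_add_polar_mul_mul (hq : IsNormForm q) (a b c d : R) :
    hq.polar (a * b) (c * d) + hq.polar (c * b) (a * d) = hq.polar a c * hq.polar b d := by
  have h := hq.polar_mul_mul (a + c) b d
  simp only [add_mul, _root_.map_add, AddMonoidHom.add_apply, hq.polar_mul_mul, hq.map_add a c] at h
  linarith

/-- The difference of both sides is orthogonal to everything, in particular to itself. -/
lemma mul_self (hq : IsNormForm q) (f : R) : f * f = hq.polar f 1 • f - q f • (1 : R) := by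
  rw [← sub_eq_zero]
  set c := f * f - (hq.polar f 1 • f - q f • (1 : R)) with hc
  have hpolar (h : R) : hq.polar c h = 0 := by
    have h₁ := hq.polar_mul_mul_add_polar_mul_mul f f 1 h
    have h₂ := hq.polar_mul_mul f 1 h
    rw [one_mul, one_mul] at h₁
    rw [mul_one] at h₂
    simp only [hc, map_sub, _root_.map_zsmul, AddMonoidHom.sub_apply, AddMonoidHom.zsmul_apply,
      smul_eq_mul]
    linarith
  have hself := hpolar c
  rw [hq.polar_self] at hself
  exact hq.eq_zero c (by linarith)

lemma map_zsmul_one_add_zsmul (hq : IsNormForm q) (a k : ℤ) (f : R) :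
    q (a • (1 : R) + k • f) = a ^ 2 + a * k * hq.polar f 1 + k ^ 2 * q f := by
  rw [hq.map_add, hq.map_zsmul, hq.map_zsmul, hq.map_one, _root_.map_zsmul, _root_.map_zsmul,
    AddMonoidHom.zsmul_apply, hq.polar_comm 1 f]
  simp only [smul_eq_mul]
  ring

lemma polar_one_sq_le (hq : IsNormForm q) (f : R) : hq.polar f 1 ^ 2 ≤ 4 * q f := by
  have h := hq.nonneg (hq.polar f 1 • (1 : R) + (-2 : ℤ) • f)
  rw [hq.map_zsmul_one_add_zsmul] at h
  linarith

lemma polar_one_eq_zero_of_dvd (hq : IsNormForm q) {π : R} (hπ : 4 < q π)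
    (hdvd : q π ∣ hq.polar π 1) : hq.polar π 1 = 0 := by
  obtain ⟨s, hs⟩ := hdvd
  have hle := hq.polar_one_sq_le π
  rw [hs] at hle
  have hs4 : q π * s ^ 2 ≤ 4 := by nlinarith
  have hs0 : s = 0 := by
    by_contra hs0
    nlinarith [sq_pos_of_ne_zero hs0]
  rw [hs, hs0, mul_zero]

lemma polar_two_zsmul_sub_polar_zsmul_one (hq : IsNormForm q) (f : R) :
    hq.polar ((2 : ℤ) • f - hq.polar f 1 • (1 : R)) 1 = 0 := by
  simp only [map_sub, _root_.map_zsmul, AddMonoidHom.sub_apply, AddMonoidHom.zsmul_apply,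
    hq.polar_self, hq.map_one, smul_eq_mul]
  ring

/-- The conjugate of `f`, so that `f` times its conjugate is the norm and their sum is the trace;
for the degree form on endomorphisms of an elliptic curve this is the dual isogeny. -/
def conj (hq : IsNormForm q) (f : R) : R := hq.polar f 1 • (1 : R) - f

lemma mul_conj (hq : IsNormForm q) (f : R) : f * hq.conj f = q f • (1 : R) := by
  rw [conj, mul_sub, hq.mul_self, mul_smul_comm, mul_one, sub_sub_cancel]

lemma map_conj (hq : IsNormForm q) (f : R) : q (hq.conj f) = q f := by
  rw [conj, sub_eq_add_neg, ← neg_one_zsmul, hq.map_zsmul_one_add_zsmul]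
  ring

lemma map_conj_add_self (hq : IsNormForm q) (f : R) : q (hq.conj f + f) = hq.polar f 1 ^ 2 := by
  rw [conj, sub_add_cancel, hq.map_zsmul, hq.map_one, mul_one]

section TraceZero

variable {π g : R}

lemma mul_self_eq_neg (hq : IsNormForm q) (hπ : hq.polar π 1 = 0) :
    π * π = -(q π • (1 : R)) := by
  rw [hq.mul_self, hπ, zero_smul, zero_sub]

lemma eq_zero_and_eq_zero_of_zsmul_one_add_zsmul_eq_zero (hq : IsNormForm q)
    (hπ : hq.polar π 1 = 0) (hπ0 : 0 < q π) {a k : ℤ} (h : a • (1 : R) + k • π = 0) :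
    a = 0 ∧ k = 0 := by
  have hnorm := hq.map_zsmul_one_add_zsmul a k π
  rw [h, hq.map_zero, hπ] at hnorm
  have ha : a ^ 2 = 0 := by nlinarith [sq_nonneg a, mul_nonneg (sq_nonneg k) hπ0.le]
  have hk : k ^ 2 = 0 := by nlinarith [sq_nonneg a, sq_nonneg k]
  exact ⟨pow_eq_zero_iff two_ne_zero |>.mp ha, pow_eq_zero_iff two_ne_zero |>.mp hk⟩

lemma polar_mul_zsmul_mul_of_commute (hq : IsNormForm q) (hπ : hq.polar π 1 = 0)
    (hg : hq.polar g 1 = 0) (hcomm : Commute π g) :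
    hq.polar (π * g) 1 • (π * g) = (2 * (q π * q g)) • (1 : R) := by
  have hsq : (π * g) * (π * g) = (q π * q g) • (1 : R) := by
    rw [hcomm.symm.mul_mul_mul_comm, hq.mul_self_eq_neg hπ, hq.mul_self_eq_neg hg, neg_mul_neg,
      smul_mul_assoc, one_mul, mul_smul]
  have hchar := hq.mul_self (π * g)
  rw [hsq, hq.map_mul, eq_sub_iff_add_eq] at hchar
  rw [← hchar]
  module

lemma polar_mul_zsmul_of_commute (hq : IsNormForm q) (hπ : hq.polar π 1 = 0) (hπ0 : q π ≠ 0)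
    (hg : hq.polar g 1 = 0) (hcomm : Commute π g) :
    hq.polar (π * g) 1 • g = -(2 * q g) • π := by
  have h := congrArg (π * ·) (hq.polar_mul_zsmul_mul_of_commute hπ hg hcomm)
  simp only [mul_smul_comm, ← mul_assoc, hq.mul_self_eq_neg hπ, mul_one, neg_mul, smul_mul_assoc,
    one_mul] at h
  refine sub_eq_zero.mp (hq.eq_zero_of_zsmul_eq_zero hπ0 ?_)
  calc q π • (hq.polar (π * g) 1 • g - -(2 * q g) • π)
      = -(hq.polar (π * g) 1 • -(q π • g)) + (2 * (q π * q g)) • π := by module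
    _ = 0 := by rw [h]; module

end TraceZero

end IsNormForm

lemma exists_eq_two_mul_of_sq_eq_four_mul {p s d : ℤ} (hp : Prime p) (h : s ^ 2 = 4 * d * p) :
    ∃ m, s = 2 * (p * m) ∧ d = p * m ^ 2 := by
  obtain ⟨t, rfl⟩ : 2 ∣ s := Int.prime_two.dvd_of_dvd_pow ⟨2 * d * p, by rw [h]; ring⟩
  have ht : t ^ 2 = d * p := by linarith [mul_pow 2 t 2]
  obtain ⟨m, rfl⟩ : p ∣ t := hp.dvd_of_dvd_pow ⟨d, by rw [ht, mul_comm]⟩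
  exact ⟨m, rfl, mul_right_cancel₀ hp.ne_zero (by rw [← ht]; ring)⟩

namespace IsNormForm

variable {q : R → ℤ} {π : R}

lemma exists_eq_zsmul_of_commute (hq : IsNormForm q) (hπ : hq.polar π 1 = 0) (hp : Prime (q π))
    {g : R} (hg : hq.polar g 1 = 0) (hcomm : Commute π g) : ∃ k : ℤ, g = k • π := by
  by_cases hg0 : q g = 0
  · exact ⟨0, by rw [hq.eq_zero g hg0, zero_smul]⟩
  have hsmul := hq.polar_mul_zsmul_of_commute hπ hp.ne_zero hg hcomm
  have hsq : hq.polar (π * g) 1 ^ 2 = 4 * q g * q π := by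
    have hnorm := congrArg q hsmul
    rw [hq.map_zsmul, hq.map_zsmul] at hnorm
    exact mul_right_cancel₀ hg0 (by linear_combination hnorm)
  obtain ⟨m, hm, hgm⟩ := exists_eq_two_mul_of_sq_eq_four_mul hp hsq
  have hm0 : m ≠ 0 := by
    rintro rfl
    exact hg0 (by rw [hgm]; ring)
  refine ⟨-m, sub_eq_zero.mp (hq.eq_zero_of_zsmul_eq_zero
    (mul_ne_zero two_ne_zero (mul_ne_zero hp.ne_zero hm0)) ?_)⟩
  rw [smul_sub, ← hm, hsmul, hgm, smul_smul, sub_eq_zero, hm]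
  ring_nf

lemma exists_two_zsmul_eq (hq : IsNormForm q) (hπ : hq.polar π 1 = 0) (hp : Prime (q π))
    {f : R} (hf : Commute π f) : ∃ a k : ℤ, (2 : ℤ) • f = a • (1 : R) + k • π := by
  obtain ⟨k, hk⟩ := hq.exists_eq_zsmul_of_commute hπ hp
    (hq.polar_two_zsmul_sub_polar_zsmul_one f)
    ((hf.smul_right 2).sub_right ((Commute.one_right π).smul_right _))
  exact ⟨hq.polar f 1, k, by rw [← hk, add_sub_cancel]⟩

lemma even_sub_of_two_zsmul_eq (hq : IsNormForm q) (hπ : hq.polar π 1 = 0) (hodd : Odd (q π))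
    {f : R} {a k : ℤ} (h : (2 : ℤ) • f = a • (1 : R) + k • π) : Even (a - k) := by
  have hnorm := hq.map_zsmul_one_add_zsmul a k π
  rw [← h, hq.map_zsmul, hπ] at hnorm
  have heven : Even (a ^ 2 + k ^ 2 * q π) := ⟨2 * q f, by linarith⟩
  have hodd' := Int.not_even_iff_odd.mpr hodd
  rw [Int.even_add, Int.even_mul, Int.even_pow' two_ne_zero, Int.even_pow' two_ne_zero] at heven
  rw [Int.even_sub]
  tauto

end IsNormForm

end NormForm

/-! ### Orders between `ℤ[√d]` and `ℤ[(1 + √d) / 2]` -/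

section QuadOrder

/-- `R` is an order with `ℤ[π] ⊆ R ⊆ ℤ[(1 + π) / 2]`, where `π = √d`. -/
structure IsQuadOrder (d : ℤ) (R : Type*) [Ring R] (π : R) : Prop where
  mul_self : π * π = d • 1
  torsion_free : ∀ {n : ℤ} {f : R}, n ≠ 0 → n • f = 0 → f = 0
  indep : ∀ {a k : ℤ}, a • (1 : R) + k • π = 0 → a = 0 ∧ k = 0
  span : ∀ f : R, ∃ a k : ℤ, (2 : ℤ) • f = a • (1 : R) + k • π
  parity : ∀ {f : R} {a k : ℤ}, (2 : ℤ) • f = a • (1 : R) + k • π → Even (a - k)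

/-- `f = (a + k π) / 2` and `f' = (a + k π') / 2` for the same integers `a` and `k`: the graph of
the isomorphism which carries `π` to `π'`. -/
def SameHalfCoords {R R' : Type*} [Ring R] [Ring R'] (π : R) (π' : R') (f : R) (f' : R') : Prop :=
  ∃ a k : ℤ, (2 : ℤ) • f = a • (1 : R) + k • π ∧ (2 : ℤ) • f' = a • (1 : R') + k • π'

variable {d : ℤ} {R R' : Type*} [Ring R] [Ring R'] {π : R} {π' : R'} {f g : R} {f' g' : R'}

theorem IsNormForm.isQuadOrder {q : R → ℤ} (hq : IsNormForm q) (hπ : hq.polar π 1 = 0)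
    (hp : Prime (q π)) (hodd : Odd (q π)) (hcomm : ∀ f, Commute π f) :
    IsQuadOrder (-q π) R π where
  mul_self := by rw [hq.mul_self_eq_neg hπ, neg_smul]
  torsion_free hn := hq.eq_zero_of_zsmul_eq_zero hn
  indep := hq.eq_zero_and_eq_zero_of_zsmul_one_add_zsmul_eq_zero hπ
    ((hq.nonneg π).lt_of_ne hp.ne_zero.symm)
  span f := hq.exists_two_zsmul_eq hπ hp (hcomm f)
  parity := hq.even_sub_of_two_zsmul_eq hπ hodd

lemma SameHalfCoords.symm (h : SameHalfCoords π π' f f') : SameHalfCoords π' π f' f := by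
  obtain ⟨a, k, hf, hf'⟩ := h
  exact ⟨a, k, hf', hf⟩

lemma SameHalfCoords.add (hf : SameHalfCoords π π' f f') (hg : SameHalfCoords π π' g g') :
    SameHalfCoords π π' (f + g) (f' + g') := by
  obtain ⟨a, k, hf, hf'⟩ := hf
  obtain ⟨b, l, hg, hg'⟩ := hg
  refine ⟨a + b, k + l, ?_, ?_⟩
  · rw [smul_add, hf, hg]; module
  · rw [smul_add, hf', hg']; module

namespace IsQuadOrder

lemma exists_sameHalfCoords (hR : IsQuadOrder d R π)
    (hhalf : (∃ f : R, (2 : ℤ) • f = 1 + π) → ∃ f : R', (2 : ℤ) • f = 1 + π') (f : R) :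
    ∃ f' : R', SameHalfCoords π π' f f' := by
  obtain ⟨a, k, h⟩ := hR.span f
  obtain ⟨m, hm⟩ := hR.parity h
  rcases Int.even_or_odd k with ⟨l, rfl⟩ | ⟨l, rfl⟩
  · obtain rfl : a = 2 * (m + l) := by linarith
    exact ⟨(m + l) • (1 : R') + l • π', _, _, h, by module⟩
  · obtain rfl : a = 2 * (m + l) + 1 := by linarith
    obtain ⟨g, hg⟩ := hhalf ⟨f - ((m + l) • (1 : R) + l • π), by rw [smul_sub, h]; module⟩
    exact ⟨g + ((m + l) • (1 : R') + l • π'), _, _, h, by rw [smul_add, hg]; module⟩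

lemma coeff_unique (hR : IsQuadOrder d R π) {a k b l : ℤ}
    (h : a • (1 : R) + k • π = b • (1 : R) + l • π) : a = b ∧ k = l := by
  obtain ⟨ha, hk⟩ := hR.indep (a := a - b) (k := k - l) (by
    rw [sub_smul, sub_smul, sub_add_sub_comm, h, sub_self])
  exact ⟨sub_eq_zero.mp ha, sub_eq_zero.mp hk⟩

lemma two_zsmul_cancel (hR : IsQuadOrder d R π) {f g : R} (h : (2 : ℤ) • f = (2 : ℤ) • g) :
    f = g :=
  sub_eq_zero.mp (hR.torsion_free two_ne_zero (by rw [smul_sub, h, sub_self]))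

lemma two_zsmul_two_zsmul_mul (hR : IsQuadOrder d R π) {a k b l : ℤ}
    (hf : (2 : ℤ) • f = a • (1 : R) + k • π) (hg : (2 : ℤ) • g = b • (1 : R) + l • π) :
    (2 : ℤ) • (2 : ℤ) • (f * g) = (a * b + d * (k * l)) • (1 : R) + (a * l + b * k) • π :=
  calc (2 : ℤ) • (2 : ℤ) • (f * g) = ((2 : ℤ) • f) * ((2 : ℤ) • g) := by
        rw [smul_mul_assoc, mul_smul_comm]
    _ = _ := by
        rw [hf, hg]
        simp only [add_mul, mul_add, smul_mul_assoc, mul_smul_comm, mul_one, one_mul, hR.mul_self]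
        module

lemma sameHalfCoords_unique (hR : IsQuadOrder d R π) (hR' : IsQuadOrder d R' π')
    (hf : SameHalfCoords π π' f f') (hg : SameHalfCoords π π' f g') : f' = g' := by
  obtain ⟨a, k, hf, hf'⟩ := hf
  obtain ⟨b, l, hg, hg'⟩ := hg
  obtain ⟨rfl, rfl⟩ := hR.coeff_unique (hf.symm.trans hg)
  exact hR'.two_zsmul_cancel (hf'.trans hg'.symm)

lemma sameHalfCoords_mul (hR : IsQuadOrder d R π) (hR' : IsQuadOrder d R' π')
    (hf : SameHalfCoords π π' f f') (hg : SameHalfCoords π π' g g') :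
    SameHalfCoords π π' (f * g) (f' * g') := by
  obtain ⟨a, k, hf, hf'⟩ := hf
  obtain ⟨b, l, hg, hg'⟩ := hg
  obtain ⟨c, m, hfg⟩ := hR.span (f * g)
  have hcoords := hR.two_zsmul_two_zsmul_mul hf hg
  rw [hfg, smul_add, smul_smul, smul_smul] at hcoords
  obtain ⟨hc, hm⟩ := hR.coeff_unique hcoords
  refine ⟨c, m, hfg, hR'.two_zsmul_cancel ?_⟩
  rw [hR'.two_zsmul_two_zsmul_mul hf' hg', ← hc, ← hm, smul_add, smul_smul, smul_smul]

theorem nonempty_ringEquiv (hR : IsQuadOrder d R π) (hR' : IsQuadOrder d R' π')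
    (hhalf : (∃ f : R, (2 : ℤ) • f = 1 + π) ↔ ∃ f : R', (2 : ℤ) • f = 1 + π') :
    Nonempty (R ≃+* R') := by
  choose toFun hto using hR.exists_sameHalfCoords hhalf.mp
  choose invFun hinv using hR'.exists_sameHalfCoords hhalf.mpr
  exact ⟨{
    toFun
    invFun
    left_inv := fun f => hR'.sameHalfCoords_unique hR (hinv (toFun f)) (hto f).symm
    right_inv := fun f => hR.sameHalfCoords_unique hR' (hto (invFun f)) (hinv f).symm
    map_mul' := fun f g =>
      hR.sameHalfCoords_unique hR' (hto (f * g)) (hR.sameHalfCoords_mul hR' (hto f) (hto g))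
    map_add' := fun f g => hR.sameHalfCoords_unique hR' (hto (f + g)) ((hto f).add (hto g)) }⟩

end IsQuadOrder

end QuadOrder

/-! ### Separability -/

section Wronskian

variable {k : Type*} [Field k] {ι : Type*}

lemma proportional_fin_two {R : Type*} [CommMagma R] {v w : Fin 2 → R}
    (h : v 0 * w 1 = v 1 * w 0) : Proportional v w := by
  intro i j
  fin_cases i <;> fin_cases j
  exacts [rfl, h, h.symm, rfl]

namespace HasHeight

variable {m n : ℕ}

lemma exists_eq_mul_C_of_proportional [IsAlgClosed k] {v w : ι → k[X]} (hv : HasHeight v m)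
    (hw : HasHeight w n) (h : Proportional v w) : ∃ c : k, c ≠ 0 ∧ ∀ i, w i = v i * C c := by
  obtain ⟨i, hi⟩ := hv.coeff_ne
  have hvi : v i ≠ 0 := fun h0 => hi (by rw [h0, coeff_zero])
  obtain ⟨u, hu⟩ :=
    associated_of_dvd_dvd (hv.dvd_of_proportional h i) (hw.dvd_of_proportional h.symm i)
  obtain ⟨c, hc, hcu⟩ := Polynomial.isUnit_iff.mp u.isUnit
  refine ⟨c, hc.ne_zero, fun j => mul_left_cancel₀ hvi ?_⟩
  rw [h i j, ← hu, hcu]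
  ring

lemma derivative_eq_zero_of_proportional [IsAlgClosed k] {v w : ι → k[X]} (hv : HasHeight v m)
    (hw : HasHeight w n) (h : Proportional v w) (hder : ∀ i, derivative (v i) = 0) (i : ι) :
    derivative (w i) = 0 := by
  obtain ⟨c, -, hc⟩ := hv.exists_eq_mul_C_of_proportional hw h
  rw [hc, derivative_mul, hder, derivative_C, zero_mul, mul_zero, add_zero]

lemma derivative_eq_zero_of_wronskian_eq_zero [IsAlgClosed k] {v : Fin 2 → k[X]}
    (hv : HasHeight v m) (h : wronskian (v 0) (v 1) = 0) (i : Fin 2) : derivative (v i) = 0 := by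
  have hprop : Proportional v fun i => derivative (v i) :=
    proportional_fin_two (by rw [← sub_eq_zero, mul_comm (v 1)]; exact h)
  by_contra hi
  by_cases hdeg : (v i).natDegree = 0
  · exact hi (by rw [eq_C_of_natDegree_eq_zero hdeg, derivative_C])
  · exact (natDegree_derivative_lt hdeg).not_ge
      (natDegree_le_of_dvd (hv.dvd_of_proportional hprop i) hi)

lemma dvd_of_derivative_eq_zero (p : ℕ) [CharP k p] {v : ι → k[X]} (hv : HasHeight v m)
    (h : ∀ i, derivative (v i) = 0) : p ∣ m := by
  obtain ⟨i, hi⟩ := hv.coeff_ne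
  rcases m with _ | m
  · exact dvd_zero p
  have hcoeff := congrArg (coeff · m) (h i)
  simp only [coeff_derivative, coeff_zero, mul_eq_zero, hi, false_or] at hcoeff
  rw [← CharP.cast_eq_zero_iff k p]
  exact_mod_cast hcoeff

end HasHeight

lemma derivative_aeval_eq_zero {v : ι → k[X]} (hv : ∀ i, derivative (v i) = 0)
    (q : MvPolynomial ι k) : derivative (MvPolynomial.aeval v q) = 0 := by
  induction q using MvPolynomial.induction_on with
  | C a => simp
  | add p q hp hq => simp [hp, hq]
  | mul_X p i hp => simp [derivative_mul, hp, hv i]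

lemma derivative_sym2_eq_zero {v w : Fin 2 → k[X]} (hv : ∀ i, derivative (v i) = 0)
    (hw : ∀ i, derivative (w i) = 0) (i : Fin 3) : derivative (sym2 v w i) = 0 := by
  fin_cases i <;> simp [sym2, derivative_mul, hv, hw]

/-- If `a` and `b` are the two values, then `(a + b)' = (a b)' = 0` gives `(a - b) a' = 0`, so that
`a' = 0` unless `a = b`, where `(a ^ 2)' = 0` takes over. -/
lemma HasHeight.derivative_eq_zero_of_sym2 [IsAlgClosed k] (h2 : (2 : k) ≠ 0) {v w : Fin 2 → k[X]}
    {m n : ℕ} (hv : HasHeight v m) (hw : HasHeight w n)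
    (h : ∀ i, derivative (IsogenyGraph.sym2 v w i) = 0) (i : Fin 2) : derivative (v i) = 0 := by
  have h₀ : derivative (v 0 * w 0) = 0 := h 0
  have h₁ : derivative (v 0 * w 1 + v 1 * w 0) = 0 := h 1
  have h₂ : derivative (v 1 * w 1) = 0 := h 2
  by_cases hprop : v 0 * w 1 = v 1 * w 0
  · obtain ⟨c, hc, hw⟩ := hv.exists_eq_mul_C_of_proportional hw (proportional_fin_two hprop)
    have hmul : derivative (v i * w i) = 0 := by
      fin_cases i
      exacts [h₀, h₂]
    rw [hw, derivative_mul, derivative_mul, derivative_C] at hmul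
    have hprod : C (2 * c) * (v i * derivative (v i)) = 0 := by
      rw [C_mul, map_ofNat]
      linear_combination hmul
    rcases mul_eq_zero.mp ((mul_eq_zero.mp hprod).resolve_left
      (C_ne_zero.mpr (mul_ne_zero h2 hc))) with hvi | hvi
    · rw [hvi, derivative_zero]
    · exact hvi
  · refine hv.derivative_eq_zero_of_wronskian_eq_zero
      ((mul_eq_zero.mp ?_).resolve_right (sub_ne_zero.mpr hprop)) i
    rw [derivative_add, derivative_mul, derivative_mul] at h₁
    rw [derivative_mul] at h₀ h₂
    rw [wronskian]
    linear_combination v 0 ^ 2 * h₂ - v 0 * v 1 * h₁ + v 1 ^ 2 * h₀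

end Wronskian

section Fibre

variable {k : Type*} [Field k]

lemma eventually_ne_mul {a : Fin 2 → k} (ha : ∃ i, a i ≠ 0) :
    ∀ᶠ c in cofinite, a 0 ≠ c * a 1 := by
  by_cases h1 : a 1 = 0
  · obtain ⟨i, hi⟩ := ha
    have h0 : a 0 ≠ 0 := by
      fin_cases i
      exacts [hi, absurd h1 hi]
    exact .of_forall fun c => by rwa [h1, mul_zero]
  · filter_upwards [(Set.finite_singleton (a 0 / a 1)).eventually_cofinite_notMem] with c hc h
    exact hc (eq_div_of_mul_eq h1 h.symm)

variable [IsAlgClosed k]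

lemma exists_ne_eval_eq_zero {r : k[X]} (hdeg : 2 ≤ r.natDegree)
    (hder : ∀ z, r.eval z = 0 → (derivative r).eval z ≠ 0) :
    ∃ z₁ z₂, z₁ ≠ z₂ ∧ r.eval z₁ = 0 ∧ r.eval z₂ = 0 := by
  have hsep : r.Separable := by
    rw [separable_def, isCoprime_iff_aeval_ne_zero_of_isAlgClosed k k]
    exact fun z => or_iff_not_imp_left.mpr fun hz => hder z (not_not.mp hz)
  have hcard : 1 < Fintype.card (r.rootSet k) := by
    rw [card_rootSet_eq_natDegree hsep (IsAlgClosed.splits _)]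
    exact hdeg
  obtain ⟨⟨z₁, h₁⟩, ⟨z₂, h₂⟩, hne⟩ := Fintype.one_lt_card_iff.mp hcard
  exact ⟨z₁, z₂, fun h => hne (Subtype.ext h), by simpa using (mem_rootSet.mp h₁).2,
    by simpa using (mem_rootSet.mp h₂).2⟩

namespace HasHeight

variable {v : Fin 2 → k[X]} {m : ℕ}

/-- All but finitely many fibres of `v₀ / v₁` have `m` elements, none of them exceptional. -/
lemma exists_ne_of_wronskian_ne_zero (hv : HasHeight v m) (hm : 2 ≤ m)
    (hW : wronskian (v 0) (v 1) ≠ 0) {Q : k → Prop} (hQ : ∀ᶠ z in cofinite, Q z) :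
    ∃ z₁ z₂ a b : k, z₁ ≠ z₂ ∧ Q z₁ ∧ Q z₂ ∧ a ≠ 0 ∧
      ∀ i, a * (v i).eval z₁ = b * (v i).eval z₂ := by
  have : Infinite k := IsAlgClosed.instInfinite
  have hbad : ({z | ¬Q z} ∪ {z | (wronskian (v 0) (v 1)).eval z = 0}).Finite :=
    (eventually_cofinite.mp hQ).union
      ((rootSet_finite _ k).subset fun z hz => mem_rootSet.mpr ⟨hW, by simpa using hz⟩)
  obtain ⟨c, hcoeff, hfib⟩ := ((eventually_ne_mul hv.coeff_ne).and
    ((eventually_all_finite hbad).mpr fun z _ => eventually_ne_mul (hv.eval_ne z))).exists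
  have heval (z : k) (hz : (v 0 - C c * v 1).eval z = 0) : (v 0).eval z = c * (v 1).eval z := by
    rwa [eval_sub, eval_mul, eval_C, sub_eq_zero] at hz
  have hgood (z : k) (hz : (v 0 - C c * v 1).eval z = 0) :
      Q z ∧ (wronskian (v 0) (v 1)).eval z ≠ 0 := by
    have hnot := mt (hfib z) (not_not.mpr (heval z hz))
    exact ⟨not_not.mp fun h => hnot (Or.inl h), fun h => hnot (Or.inr h)⟩
  have hdeg : 2 ≤ (v 0 - C c * v 1).natDegree := hm.trans (le_natDegree_of_ne_zero (by
    rwa [coeff_sub, coeff_C_mul, sub_ne_zero]))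
  obtain ⟨z₁, z₂, hne, h₁, h₂⟩ := exists_ne_eval_eq_zero hdeg fun z hz hder =>
    (hgood z hz).2 (by
      rw [derivative_sub, derivative_C_mul, eval_sub, eval_mul, eval_C] at hder
      rw [wronskian, eval_sub, eval_mul, eval_mul, heval z hz]
      linear_combination -(v 1).eval z * hder)
  refine ⟨z₁, z₂, (v 1).eval z₂, (v 1).eval z₁, hne, (hgood z₁ h₁).1, (hgood z₂ h₂).1,
    fun h => ?_, fun i => ?_⟩
  · obtain ⟨i, hi⟩ := hv.eval_ne z₂
    fin_cases i
    exacts [hi (by rw [Fin.zero_eta, heval z₂ h₂, h, mul_zero]), hi h]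
  · fin_cases i
    · simp only [Fin.zero_eta, heval z₁ h₁, heval z₂ h₂]
      ring
    · exact mul_comm _ _

end HasHeight

end Fibre

section Inseparable

variable {E E' : WeierstrassCurve.Affine F}

open WeierstrassCurve.Affine (Point)

lemma two_ne_zero_algebraicClosure (h2 : (2 : F) ≠ 0) : (2 : F̄) ≠ 0 := by
  rw [← map_ofNat (algebraMap F F̄)]
  exact (_root_.map_ne_zero _).mpr h2

lemma derivative_eq_zero_of_injective [E.IsElliptic] {f : GeomPoint E →+ GeomPoint E'}
    (hf : Function.Injective f) {v : Fin 2 → F̄[X]} {m : ℕ} (hv : HasHeight v m) (hm : 2 ≤ m)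
    (hfv : HasXRep f v) (i : Fin 2) : derivative (v i) = 0 := by
  refine hv.derivative_eq_zero_of_wronskian_eq_zero (by_contra fun hW => ?_) i
  have hx : ∀ᶠ x in cofinite, ∃ y, ∃ h : (geom E).Nonsingular x y, ∃ c : F̄, c ≠ 0 ∧
      ∀ i, (v i).eval x = c * (f (.some x y h)).xRep i := by
    refine eventually_x_of_eventually (E := E) ?_
    filter_upwards [hfv] with P hP x y h hxy
    obtain ⟨c, hc⟩ := hP x y h hxy
    exact ⟨y, h, c, hxy ▸ hc⟩
  obtain ⟨z₁, z₂, a, b, hne, ⟨y₁, n₁, c₁, hc₁, hv₁⟩, ⟨y₂, n₂, c₂, -, hv₂⟩, ha, hab⟩ :=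
    hv.exists_ne_of_wronskian_ne_zero hm hW hx
  have hxRep := xRep_eq_of_mul_eq_mul (P := f (.some z₁ y₁ n₁)) (Q := f (.some z₂ y₂ n₂))
    (mul_ne_zero ha hc₁) (b := b * c₂) fun i => by
      rw [mul_assoc, mul_assoc, ← hv₁, ← hv₂, hab]
  rcases Point.eq_or_eq_neg_of_xRep_eq_xRep hxRep with h | h
  · exact hne (Point.some.inj (hf h)).1
  · rw [← map_neg, Point.neg_some] at h
    exact hne (Point.some.inj (hf h)).1

lemma derivative_eq_zero_of_add [E.IsElliptic] [E'.IsElliptic] (h2 : (2 : F) ≠ 0)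
    {f g : GeomPoint E →+ GeomPoint E'} {v₁ v₂ v₃ v₄ : Fin 2 → F̄[X]} {m₁ m₂ m₃ m₄ : ℕ}
    (h₁ : HasHeight v₁ m₁) (h₂ : HasHeight v₂ m₂) (h₃ : HasHeight v₃ m₃) (h₄ : HasHeight v₄ m₄)
    (hf : HasXRep f v₁) (hg : HasXRep g v₂)
    (hadd : HasXRep (f + g : GeomPoint E →+ GeomPoint E') v₃)
    (hsub : HasXRep (f - g : GeomPoint E →+ GeomPoint E') v₄)
    (hder₁ : ∀ i, derivative (v₁ i) = 0) (hder₂ : ∀ i, derivative (v₂ i) = 0) (i : Fin 2) :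
    derivative (v₃ i) = 0 := by
  have hder (j) := derivative_aeval_eq_zero (derivative_sym2_eq_zero hder₁ hder₂)
    (WeierstrassCurve.addSubMap (geom E') j)
  exact h₃.derivative_eq_zero_of_sym2 (two_ne_zero_algebraicClosure h2) h₄
    ((h₁.addSubMap (geom E') h₂).derivative_eq_zero_of_proportional (h₃.sym2 h₄)
      (hf.proportional_addSubMap hg hadd hsub).symm hder) i

lemma dvd_xHeight_add [E.IsElliptic] [E'.IsElliptic] (h2 : (2 : F) ≠ 0) (p : ℕ) [CharP F p]
    {f g : GeomPoint E →+ GeomPoint E'} (hf : IsHomOver E E' f) (hg : IsHomOver E E' g)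
    {v w : Fin 2 → F̄[X]} {m n : ℕ} (hv : HasHeight v m) (hw : HasHeight w n)
    (hfv : HasXRep f v) (hgw : HasXRep g w) (hderv : ∀ i, derivative (v i) = 0)
    (hderw : ∀ i, derivative (w i) = 0) :
    p ∣ xHeight (f + g : GeomPoint E →+ GeomPoint E') := by
  have : CharP F̄ p := charP_of_injective_algebraMap (algebraMap F F̄).injective p
  obtain ⟨u, r, hu, hadd⟩ := (hf.add hg).exists_hasXRep h2
  obtain ⟨u', r', hu', hsub⟩ := (sub_eq_add_neg f g ▸ hf.add hg.neg :
    IsHomOver E E' (f - g)).exists_hasXRep h2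
  rw [xHeight_eq hu hadd]
  exact hu.dvd_of_derivative_eq_zero p
    (derivative_eq_zero_of_add h2 hv hw hu hu' hfv hgw hadd hsub hderv hderw)

end Inseparable

/-! ### The endomorphism ring of a supersingular curve -/

section DegreeForm

/-- The degree as an integral quadratic form on the endomorphism ring, computed on
`x`-coordinates. -/
def endDeg (E : WeierstrassCurve.Affine F) [E.IsElliptic] (f : EndOver E) : ℤ :=
  xHeight (f.1 : GeomPoint E →+ GeomPoint E)

lemma isNormForm_endDeg (h2 : (2 : F) ≠ 0) (E : WeierstrassCurve.Affine F) [E.IsElliptic] :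
    IsNormForm (endDeg E) where
  map_mul a b := by
    have h := congrArg (Nat.cast : ℕ → ℤ) (xHeight_comp h2 (f := b.1) (g := a.1) a.2 b.2)
    push_cast at h
    exact h
  parallelogram a b := by
    have h := congrArg (Nat.cast : ℕ → ℤ)
      (xHeight_add_add_xHeight_sub h2 (f := a.1) (g := b.1) a.2 b.2)
    push_cast at h
    exact h
  map_one := congrArg (Nat.cast : ℕ → ℤ) (xHeight_id (E := E))
  nonneg a := Int.natCast_nonneg _
  eq_zero a h := Subtype.ext (eq_zero_of_xHeight_eq_zero h2 a.2 (Int.natCast_eq_zero.mp h))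

lemma HasValueAt.pow {E : WeierstrassCurve.Affine F} {u : E.FunctionField} {P : GeomPoint E}
    {c : F̄} (h : HasValueAt E u P c) (n : ℕ) : HasValueAt E (u ^ n) P (c ^ n) := by
  induction n with
  | zero => simpa using hasValueAt_const h 1
  | succ n ih => simpa only [pow_succ] using ih.mul h

end DegreeForm

section Frobenius

open WeierstrassCurve.Affine (Point)

variable {p : ℕ} [Fact p.Prime] {E E' : WeierstrassCurve.Affine (ZMod p)}

local notation "𝔽̄" => AlgebraicClosure (ZMod p)

/-- The automorphism `x ↦ x ^ p` of the algebraic closure of `𝔽_p`. -/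
def frobAlg (p : ℕ) [Fact p.Prime] :
    AlgebraicClosure (ZMod p) →ₐ[ZMod p] AlgebraicClosure (ZMod p) :=
  FiniteField.frobeniusAlgHom (ZMod p) (AlgebraicClosure (ZMod p))

lemma frobAlg_apply (x : 𝔽̄) : frobAlg p x = x ^ p := by
  rw [frobAlg, FiniteField.coe_frobeniusAlgHom, ZMod.card]

/-- The `p`-power Frobenius endomorphism, on geometric points. -/
def frob (E : WeierstrassCurve.Affine (ZMod p)) : GeomPoint E →+ GeomPoint E :=
  Point.map (W' := E) (frobAlg p)

lemma frob_some {x y : 𝔽̄} (h : (geom E).Nonsingular x y) :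
    ∃ h', frob E (.some x y h) = .some (x ^ p) (y ^ p) h' := by
  have hmap := Point.map_some (W' := E) (frobAlg p) h
  simp only [frobAlg_apply] at hmap
  exact ⟨_, hmap⟩

lemma frob_injective : Function.Injective (frob E) :=
  Point.map_injective (W' := E) (frobAlg p)

lemma evalGeom_frob {x y : 𝔽̄} (h : (geom E).Nonsingular x y)
    (h' : (geom E).Nonsingular (x ^ p) (y ^ p)) (a : E.CoordinateRing) :
    evalGeom E h' a = evalGeom E h a ^ p := by
  obtain ⟨A, rfl⟩ := AdjoinRoot.mk_surjective a
  refine (evalGeom_mk h' A).trans (Eq.trans ?_ (congrArg (· ^ p) (evalGeom_mk h A).symm))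
  rw [← frobAlg_apply, ← frobAlg_apply, ← frobAlg_apply]
  have hmap := map_mapRingHom_evalEval (frobAlg p : 𝔽̄ →+* 𝔽̄)
    (p := A.map (mapRingHom (algebraMap (ZMod p) 𝔽̄))) x y
  rwa [Polynomial.map_map, mapRingHom_comp, AlgHom.comp_algebraMap] at hmap

lemma HasValueAt.frob {u : E.FunctionField} {P : GeomPoint E} {c : 𝔽̄}
    (h : HasValueAt E u P c) : HasValueAt E u (frob E P) (c ^ p) := by
  rcases P with _ | ⟨x, y, hxy⟩
  · exact h.elim
  obtain ⟨h', hfrob⟩ := frob_some hxy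
  rw [hfrob]
  obtain ⟨a, d, hd, hu, hc⟩ := h
  refine ⟨a, d, ?_, hu, ?_⟩
  · rw [evalGeom_frob hxy]
    exact pow_ne_zero _ hd
  · rw [evalGeom_frob hxy, evalGeom_frob hxy, ← mul_pow, hc]

lemma isHomOver_frob : IsHomOver E E (frob E) := by
  refine Or.inr ⟨⟨⟨_, ofX E X ^ p, coordY E ^ p⟩, ?_⟩, rfl⟩
  filter_upwards [eventually_affine E] with P ⟨x, y, h, hP⟩
  obtain ⟨h', hfrob⟩ := frob_some h
  subst hP
  refine ⟨_, _, h', hfrob, ?_, (hasValueAt_coordY h).pow p⟩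
  simpa using (hasValueAt_ofX h X).pow p

lemma hasXRep_frob : HasXRep (frob E) ![X ^ p, 1] := by
  refine .of_forall ?_
  rintro _ x y h rfl
  obtain ⟨h', hfrob⟩ := frob_some h
  refine ⟨1, one_ne_zero, fun i => ?_⟩
  rw [hfrob]
  fin_cases i <;> simp

lemma IsHomOver.frob_comm [E.IsElliptic] {f : GeomPoint E →+ GeomPoint E'}
    (hf : IsHomOver E E' f) (P : GeomPoint E) : f (frob E P) = frob E' (f P) := by
  rcases hf with rfl | ⟨φ, rfl⟩
  · simp
  suffices hzero : φ.toHom.comp (frob E) - (frob E').comp φ.toHom = 0 from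
    sub_eq_zero.mp (DFunLike.congr_fun hzero P)
  refine eq_zero_of_eventually_const (Q := 0) ?_
  filter_upwards [φ.eventually_eq,
    frob_injective.tendsto_cofinite.eventually φ.eventually_eq] with P h h'
  obtain ⟨a, b, hns, hP, ha, hb⟩ := h
  obtain ⟨a', b', hns', hP', ha', hb'⟩ := h'
  obtain ⟨_, hfrob⟩ := frob_some hns
  obtain rfl := ha'.unique ha.frob
  obtain rfl := hb'.unique hb.frob
  rw [AddMonoidHom.sub_apply, AddMonoidHom.comp_apply, AddMonoidHom.comp_apply, hP, hP', hfrob,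
    sub_self]

variable [E.IsElliptic]

/-- The Frobenius endomorphism as an element of the endomorphism ring. -/
def frobEnd (E : WeierstrassCurve.Affine (ZMod p)) [E.IsElliptic] : EndOver E :=
  ⟨frob E, isHomOver_frob⟩

lemma endDeg_frobEnd : endDeg E (frobEnd E) = p :=
  congrArg (Nat.cast : ℕ → ℤ) (xHeight_eq (.X_pow_one p) hasXRep_frob)

lemma commute_frobEnd (f : EndOver E) : Commute (frobEnd E) f :=
  Subtype.ext (AddMonoidHom.ext fun P => (IsHomOver.frob_comm f.2 P).symm)

lemma conj_frobEnd_injective (h2 : (2 : ZMod p) ≠ 0) (hE : IsSupersingular p E) :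
    Function.Injective (((isNormForm_endDeg h2 E).conj (frobEnd E)).1 :
      GeomPoint E →+ GeomPoint E) := by
  refine (injective_iff_map_eq_zero _).mpr fun P hP => hE P ?_
  have hmul := (isNormForm_endDeg h2 E).mul_conj (frobEnd E)
  rw [endDeg_frobEnd] at hmul
  have happ : frob E (((isNormForm_endDeg h2 E).conj (frobEnd E)).1 P) = (p : ℤ) • P :=
    DFunLike.congr_fun (congrArg Subtype.val hmul) P
  rw [← natCast_zsmul, ← happ, hP, map_zero]

/-- Both Frobenius and its dual are inseparable, hence so is their sum, which is the trace. -/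
lemma dvd_polar_frobEnd_one (h2 : (2 : ZMod p) ≠ 0) (hE : IsSupersingular p E) :
    (p : ℤ) ∣ (isNormForm_endDeg h2 E).polar (frobEnd E) 1 := by
  set hq := isNormForm_endDeg h2 E
  have hprime : p.Prime := Fact.out
  obtain ⟨v, m, hv, hconjv⟩ := IsHomOver.exists_hasXRep h2 (hq.conj (frobEnd E)).2
  have hm : m = p := by
    have hdeg : (xHeight ((hq.conj (frobEnd E)).1 : GeomPoint E →+ GeomPoint E) : ℤ) = p :=
      (hq.map_conj (frobEnd E)).trans endDeg_frobEnd
    rw [← xHeight_eq hv hconjv]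
    exact_mod_cast hdeg
  have hderv :=
    derivative_eq_zero_of_injective (conj_frobEnd_injective h2 hE) hv (hm ▸ hprime.two_le) hconjv
  have hderfrob (i : Fin 2) : derivative ((![X ^ p, 1] : Fin 2 → 𝔽̄[X]) i) = 0 := by
    fin_cases i <;> simp [derivative_X_pow]
  have hdvd := dvd_xHeight_add h2 p (hq.conj (frobEnd E)).2 isHomOver_frob hv (.X_pow_one p)
    hconjv hasXRep_frob hderv hderfrob
  refine (Nat.prime_iff_prime_int.mp hprime).dvd_of_dvd_pow (n := 2) ?_
  rw [← hq.map_conj_add_self]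
  exact Int.natCast_dvd_natCast.mpr hdvd

lemma two_ne_zero_of_lt (hp : 3 < p) : (2 : ZMod p) ≠ 0 := by
  exact Ring.two_ne_zero (by rw [ZMod.ringChar_zmod_n]; omega)

theorem isQuadOrder_frobEnd (hp : 3 < p) (hE : IsSupersingular p E) :
    IsQuadOrder (-p) (EndOver E) (frobEnd E) := by
  have h2 := two_ne_zero_of_lt hp
  have hprime : p.Prime := Fact.out
  have hp4 : p ≠ 4 := by
    rintro rfl
    exact absurd hprime (by norm_num)
  have htrace := (isNormForm_endDeg h2 E).polar_one_eq_zero_of_dvd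
    (by rw [endDeg_frobEnd]; omega) (by rw [endDeg_frobEnd]; exact dvd_polar_frobEnd_one h2 hE)
  rw [← endDeg_frobEnd (E := E)]
  refine (isNormForm_endDeg h2 E).isQuadOrder htrace ?_ ?_ commute_frobEnd <;> rw [endDeg_frobEnd]
  · exact Nat.prime_iff_prime_int.mp hprime
  · exact_mod_cast hprime.odd_of_ne_two (by omega)

end Frobenius

/-! ### Points of order two -/

section TwoTorsion

open WeierstrassCurve WeierstrassCurve.Affine

variable {k : Type*} [Field k]

/-- The `x`-coordinates of the points of order two are `e₁`, `e₂`, `e₃`: the coefficients of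
`4x³ + b₂x² + 2b₄x + b₆` are those of `4(x - e₁)(x - e₂)(x - e₃)`, where the equation for the
linear coefficient has been divided by two. -/
structure IsTwoTorsionRoots (W : WeierstrassCurve.Affine k) (e₁ e₂ e₃ : k) : Prop where
  b₂_eq : W.b₂ = -4 * (e₁ + e₂ + e₃)
  b₄_eq : W.b₄ = 2 * (e₁ * e₂ + e₁ * e₃ + e₂ * e₃)
  b₆_eq : W.b₆ = -4 * (e₁ * e₂ * e₃)

lemma four_ne_zero_of_two_ne_zero (h2 : (2 : k) ≠ 0) : (4 : k) ≠ 0 := by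
  rw [show (4 : k) = 2 * 2 by norm_num]
  exact mul_ne_zero h2 h2

lemma exists_isTwoTorsionRoots [IsAlgClosed k] (h2 : (2 : k) ≠ 0) (W : WeierstrassCurve.Affine k)
    [W.IsElliptic] : ∃ e₁ e₂ e₃, IsTwoTorsionRoots W e₁ e₂ e₃ ∧ e₁ ≠ e₂ ∧ e₁ ≠ e₃ ∧ e₂ ≠ e₃ := by
  have ha : (twoTorsionPolynomial W).a ≠ 0 := four_ne_zero_of_two_ne_zero h2
  obtain ⟨e₁, e₂, e₃, hroots⟩ := (Cubic.splits_iff_roots_eq_three (φ := RingHom.id k) ha).mp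
    (IsAlgClosed.splits _)
  have hb := Cubic.b_eq_three_roots ha hroots
  have hc := Cubic.c_eq_three_roots ha hroots
  have hd := Cubic.d_eq_three_roots ha hroots
  have hdistinct := (Cubic.discr_ne_zero_iff_roots_ne ha hroots).mp
    (twoTorsionPolynomial_discr_ne_zero_of_isElliptic W (isUnit_iff_ne_zero.mpr h2))
  simp only [twoTorsionPolynomial, RingHom.id_apply] at hb hc hd
  refine ⟨e₁, e₂, e₃, ⟨?_, mul_left_cancel₀ h2 ?_, ?_⟩, hdistinct⟩
  · linear_combination hb
  · linear_combination hc
  · linear_combination hd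

variable {W : WeierstrassCurve.Affine k} {e₁ e₂ e₃ : k}

lemma IsTwoTorsionRoots.swap₁₂ (he : IsTwoTorsionRoots W e₁ e₂ e₃) :
    IsTwoTorsionRoots W e₂ e₁ e₃ :=
  ⟨by rw [he.b₂_eq]; ring, by rw [he.b₄_eq]; ring, by rw [he.b₆_eq]; ring⟩

lemma IsTwoTorsionRoots.swap₁₃ (he : IsTwoTorsionRoots W e₁ e₂ e₃) :
    IsTwoTorsionRoots W e₃ e₂ e₁ :=
  ⟨by rw [he.b₂_eq]; ring, by rw [he.b₄_eq]; ring, by rw [he.b₆_eq]; ring⟩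

lemma IsTwoTorsionRoots.sq_sub_negY (he : IsTwoTorsionRoots W e₁ e₂ e₃) {x y : k}
    (h : W.Equation x y) :
    (y - W.negY x y) ^ 2 = 4 * ((x - e₁) * (x - e₂) * (x - e₃)) := by
  rw [IsogenyGraph.sq_sub_negY h, he.b₂_eq, he.b₄_eq, he.b₆_eq]
  ring

lemma IsTwoTorsionRoots.b₈_eq (he : IsTwoTorsionRoots W e₁ e₂ e₃) (h2 : (2 : k) ≠ 0) :
    W.b₈ = 4 * (e₁ + e₂ + e₃) * (e₁ * e₂ * e₃) - (e₁ * e₂ + e₁ * e₃ + e₂ * e₃) ^ 2 := by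
  have h := W.b_relation
  rw [he.b₂_eq, he.b₄_eq, he.b₆_eq] at h
  refine mul_left_cancel₀ (four_ne_zero_of_two_ne_zero h2) ?_
  linear_combination h

lemma IsTwoTorsionRoots.nonsingular [W.IsElliptic] (h2 : (2 : k) ≠ 0)
    (he : IsTwoTorsionRoots W e₁ e₂ e₃) : W.Nonsingular e₁ (-(W.a₁ * e₁ + W.a₃) / 2) := by
  have hb₂ := he.b₂_eq
  have hb₄ := he.b₄_eq
  have hb₆ := he.b₆_eq
  rw [b₂] at hb₂
  rw [b₄] at hb₄
  rw [b₆] at hb₆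
  refine equation_iff_nonsingular.mp ((equation_iff _ _).mpr ?_)
  refine mul_left_cancel₀ (four_ne_zero_of_two_ne_zero h2) ?_
  field_simp
  linear_combination -4 * (e₁ ^ 2 * hb₂ + 2 * e₁ * hb₄ + hb₆)

lemma exists_doubling_eq [IsAlgClosed k] (W : WeierstrassCurve k) (a : k) :
    ∃ z, z ^ 4 - W.b₄ * z ^ 2 - 2 * W.b₆ * z - W.b₈ =
      a * (4 * z ^ 3 + W.b₂ * z ^ 2 + 2 * W.b₄ * z + W.b₆) := by
  set r : k[X] := X ^ 4 - C W.b₄ * X ^ 2 - C (2 * W.b₆) * X - C W.b₈ -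
    C a * (C 4 * X ^ 3 + C W.b₂ * X ^ 2 + C (2 * W.b₄) * X + C W.b₆) with hr
  have hdeg : r.natDegree = 4 := by
    rw [hr]
    compute_degree!
  obtain ⟨z, hz⟩ := IsAlgClosed.exists_root r fun h0 => by
    rw [natDegree_eq_zero_iff_degree_le_zero.mpr h0.le] at hdeg
    omega
  refine ⟨z, ?_⟩
  simp only [IsRoot, hr, eval_sub, eval_add, eval_mul, eval_pow, eval_X, eval_C] at hz
  linear_combination hz

lemma psi_ne_zero_of_doubling_eq [W.IsElliptic] {a z : k}
    (h : z ^ 4 - W.b₄ * z ^ 2 - 2 * W.b₆ * z - W.b₈ =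
      a * (4 * z ^ 3 + W.b₂ * z ^ 2 + 2 * W.b₄ * z + W.b₆)) :
    4 * z ^ 3 + W.b₂ * z ^ 2 + 2 * W.b₄ * z + W.b₆ ≠ 0 := by
  intro h0
  rw [h0, mul_zero] at h
  refine addSubMap_ne_zero W (x := ![z * z, z + z, 1]) (fun h1 => ?_) ?_
  · simpa using congrFun h1 2
  rw [eval_addSubMap]
  ext i
  fin_cases i
  · simp; linear_combination h
  · simp; linear_combination h0
  · simp; ring

variable [DecidableEq k]

lemma some_add_self_eq_zero_iff {x y : k} {h : W.Nonsingular x y} :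
    Point.some x y h + Point.some x y h = 0 ↔ y = W.negY x y := by
  refine ⟨fun h0 => ?_, Point.add_self_of_Y_eq⟩
  by_contra hy
  rw [Point.add_self_of_Y_ne hy] at h0
  exact Point.some_ne_zero _ h0

lemma IsTwoTorsionRoots.addX_eq (he : IsTwoTorsionRoots W e₁ e₂ e₃) (h2 : (2 : k) ≠ 0)
    {x₁ y₁ x₂ y₂ η₁ η₂ : k} (hx : x₁ ≠ x₂) (hη₁ : 2 * η₁ = y₁ - W.negY x₁ y₁)
    (hη₂ : 2 * η₂ = y₂ - W.negY x₂ y₂) :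
    W.addX x₁ x₂ (W.slope x₁ x₂ y₁ y₂) =
      ((η₂ - η₁) / (x₂ - x₁)) ^ 2 + (e₁ + e₂ + e₃) - x₁ - x₂ := by
  have hx₂₁ : x₂ - x₁ ≠ 0 := sub_ne_zero.mpr hx.symm
  have hslope : 2 * W.slope x₁ x₂ y₁ y₂ = 2 * ((η₂ - η₁) / (x₂ - x₁)) - W.a₁ := by
    simp only [negY] at hη₁ hη₂
    rw [slope_of_X_ne hx, ← neg_sub y₂, ← neg_sub x₂, neg_div_neg_eq]
    field_simp
    linear_combination hη₁ - hη₂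
  have hb₂ := he.b₂_eq
  rw [b₂] at hb₂
  refine mul_left_cancel₀ (four_ne_zero_of_two_ne_zero h2) ?_
  rw [addX]
  linear_combination
    (2 * W.slope x₁ x₂ y₁ y₂ + 2 * ((η₂ - η₁) / (x₂ - x₁)) + W.a₁) * hslope - hb₂

/-- In the coordinate `η = (y - negY x y) / 2` the line through the two points is `η = L(x)`, and
the roots of `(x - e₁)(x - e₂)(x - e₃) - L(x)²` are the `x`-coordinates of the three collinear
points; evaluate at `e₁`. -/
lemma IsTwoTorsionRoots.addX_sub (he : IsTwoTorsionRoots W e₁ e₂ e₃) (h2 : (2 : k) ≠ 0)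
    {x₁ y₁ x₂ y₂ η₁ η₂ : k} (h₁ : W.Equation x₁ y₁) (h₂ : W.Equation x₂ y₂) (hx : x₁ ≠ x₂)
    (hη₁ : 2 * η₁ = y₁ - W.negY x₁ y₁) (hη₂ : 2 * η₂ = y₂ - W.negY x₂ y₂) :
    (W.addX x₁ x₂ (W.slope x₁ x₂ y₁ y₂) - e₁) * ((x₁ - e₁) * (x₂ - e₁)) =
      (η₁ + (η₂ - η₁) / (x₂ - x₁) * (e₁ - x₁)) ^ 2 := by
  have hsq₁ := he.sq_sub_negY h₁
  have hsq₂ := he.sq_sub_negY h₂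
  rw [← hη₁] at hsq₁
  rw [← hη₂] at hsq₂
  have hx₂₁ : x₂ - x₁ ≠ 0 := sub_ne_zero.mpr hx.symm
  rw [he.addX_eq h2 hx hη₁ hη₂]
  set l := (η₂ - η₁) / (x₂ - x₁) with hl
  have hη : η₂ = η₁ + l * (x₂ - x₁) := by rw [hl, div_mul_cancel₀ _ hx₂₁, add_sub_cancel]
  rw [hη] at hsq₂
  refine mul_left_cancel₀ (mul_ne_zero (four_ne_zero_of_two_ne_zero h2) hx₂₁) ?_
  linear_combination (e₁ - x₂) * hsq₁ - (e₁ - x₁) * hsq₂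

/-- The point of order two with `x`-coordinate `e₁`. -/
def twoTorsionPoint [W.IsElliptic] (h2 : (2 : k) ≠ 0) (he : IsTwoTorsionRoots W e₁ e₂ e₃) :
    W.Point :=
  .some _ _ (he.nonsingular h2)

lemma twoTorsionPoint_add_self [W.IsElliptic] (h2 : (2 : k) ≠ 0)
    (he : IsTwoTorsionRoots W e₁ e₂ e₃) :
    twoTorsionPoint h2 he + twoTorsionPoint h2 he = 0 := by
  rw [twoTorsionPoint, some_add_self_eq_zero_iff, negY]
  field_simp
  ring

lemma add_self_eq_zero_iff [W.IsElliptic] (h2 : (2 : k) ≠ 0)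
    (he : IsTwoTorsionRoots W e₁ e₂ e₃) (T : W.Point) :
    T + T = 0 ↔ T = 0 ∨ T = twoTorsionPoint h2 he ∨ T = twoTorsionPoint h2 he.swap₁₂ ∨
      T = twoTorsionPoint h2 he.swap₁₃ := by
  refine ⟨fun hT => ?_, ?_⟩
  · rcases T with _ | ⟨x, y, h⟩
    · exact .inl rfl
    rw [some_add_self_eq_zero_iff] at hT
    have hx := he.sq_sub_negY h.1
    rw [← hT, sub_self, zero_pow two_ne_zero, eq_comm, mul_eq_zero, mul_eq_zero,
      mul_eq_zero] at hx
    obtain rfl : y = -(W.a₁ * x + W.a₃) / 2 := by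
      rw [negY] at hT
      rw [eq_div_iff h2]
      linear_combination hT
    rcases hx.resolve_left (four_ne_zero_of_two_ne_zero h2) with (hx | hx) | hx <;>
      obtain rfl := sub_eq_zero.mp hx
    · exact .inr (.inl rfl)
    · exact .inr (.inr (.inl rfl))
    · exact .inr (.inr (.inr rfl))
  · rintro (rfl | rfl | rfl | rfl)
    · exact add_zero _
    all_goals exact twoTorsionPoint_add_self h2 _

lemma ncard_setOf_add_self_eq_zero [IsAlgClosed k] [W.IsElliptic] (h2 : (2 : k) ≠ 0) :
    {T : W.Point | T + T = 0}.ncard = 4 := by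
  obtain ⟨e₁, e₂, e₃, he, h₁₂, h₁₃, h₂₃⟩ := exists_isTwoTorsionRoots h2 W
  have hne {a b c a' b' c' : k} (h : IsTwoTorsionRoots W a b c)
      (h' : IsTwoTorsionRoots W a' b' c') (haa' : a ≠ a') :
      twoTorsionPoint h2 h ≠ twoTorsionPoint h2 h' :=
    fun heq => haa' (Point.some.inj heq).1
  have hne0 {a b c : k} (h : IsTwoTorsionRoots W a b c) : (0 : W.Point) ≠ twoTorsionPoint h2 h :=
    (Point.some_ne_zero _).symm
  have hset : {T : W.Point | T + T = 0} =
      (({0, twoTorsionPoint h2 he, twoTorsionPoint h2 he.swap₁₂,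
        twoTorsionPoint h2 he.swap₁₃} : Finset W.Point) : Set W.Point) := by
    ext T
    simp [add_self_eq_zero_iff h2 he]
  rw [hset, Set.ncard_coe_finset, Finset.card_insert_of_notMem, Finset.card_insert_of_notMem,
    Finset.card_insert_of_notMem, Finset.card_singleton]
  · simpa using hne _ _ h₂₃
  · simpa using ⟨hne _ _ h₁₂, hne _ _ h₁₃⟩
  · simpa using ⟨hne0 _, hne0 _, hne0 _⟩

lemma exists_add_self_eq [IsAlgClosed k] [W.IsElliptic] (P : W.Point) : ∃ Q, Q + Q = P := by
  rcases P with _ | ⟨a, b, hab⟩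
  · exact ⟨0, add_zero _⟩
  obtain ⟨z, hz⟩ := exists_doubling_eq W a
  have hψ := psi_ne_zero_of_doubling_eq hz
  obtain ⟨w, hw⟩ := exists_equation W z
  have hns := equation_iff_nonsingular.mp hw
  have hy : w ≠ W.negY z w := by
    rw [← sub_ne_zero]
    exact fun h0 => hψ (by rw [← sq_sub_negY hw, h0, zero_pow two_ne_zero])
  have hx : W.addX z z (W.slope z z w w) = a := by
    refine mul_left_cancel₀ hψ ?_
    rw [mul_addX_self hw hy, hz, mul_comm]
  have hdouble := Point.add_self_of_Y_ne (h₁ := hns) hy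
  rcases Point.X_eq_iff (h₁ := hab) (h₂ := nonsingular_add hns hns fun h => hy h.2).mp hx.symm
    with hP | hP
  · exact ⟨_, hdouble.trans hP.symm⟩
  · exact ⟨-.some z w hns, by rw [← neg_add, hdouble, hP]⟩

end TwoTorsion

/-! ### Halving a point -/

section SqrtDouble

open WeierstrassCurve WeierstrassCurve.Affine

variable {k : Type*} [Field k]

/-- The square root of `x(2P) - e₁` for a point `P = (x, y)` given by the doubling formula, where
`e₁`, `e₂`, `e₃` are the `x`-coordinates of the points of order two. It is junk if `2P = 0`. -/
def sqrtDouble (W : WeierstrassCurve.Affine k) (e₁ e₂ e₃ x y : k) : k :=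
  ((x - e₁) * (x - e₂) + (x - e₁) * (x - e₃) - (x - e₂) * (x - e₃)) / (y - W.negY x y)

variable {W : WeierstrassCurve.Affine k} {e₁ e₂ e₃ x y : k}

lemma sqrtDouble_add_swap :
    sqrtDouble W e₁ e₂ e₃ x y + sqrtDouble W e₂ e₁ e₃ x y =
      2 * ((x - e₁) * (x - e₂)) / (y - W.negY x y) := by
  rw [sqrtDouble, sqrtDouble, ← add_div]
  ring

lemma sqrtDouble_add_rotate :
    sqrtDouble W e₁ e₂ e₃ x y + sqrtDouble W e₃ e₂ e₁ x y =
      2 * ((x - e₁) * (x - e₃)) / (y - W.negY x y) := by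
  rw [sqrtDouble, sqrtDouble, ← add_div]
  ring

lemma sqrtDouble_swap_add_rotate :
    sqrtDouble W e₂ e₁ e₃ x y + sqrtDouble W e₃ e₂ e₁ x y =
      2 * ((x - e₂) * (x - e₃)) / (y - W.negY x y) := by
  rw [sqrtDouble, sqrtDouble, ← add_div]
  ring

lemma IsTwoTorsionRoots.two_mul_prod_sqrtDouble (he : IsTwoTorsionRoots W e₁ e₂ e₃)
    (h : W.Equation x y) (hy : y ≠ W.negY x y) :
    2 * ((sqrtDouble W e₁ e₂ e₃ x y + sqrtDouble W e₂ e₁ e₃ x y) *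
      (sqrtDouble W e₁ e₂ e₃ x y + sqrtDouble W e₃ e₂ e₁ x y) *
      (sqrtDouble W e₂ e₁ e₃ x y + sqrtDouble W e₃ e₂ e₁ x y)) = y - W.negY x y := by
  have hη := sub_ne_zero.mpr hy
  have hsq := he.sq_sub_negY h
  rw [sqrtDouble_add_swap, sqrtDouble_add_rotate, sqrtDouble_swap_add_rotate]
  generalize y - W.negY x y = η at *
  field_simp
  linear_combination -(η ^ 2 + 4 * ((x - e₁) * (x - e₂) * (x - e₃))) * hsq

variable [DecidableEq k]

lemma IsTwoTorsionRoots.sqrtDouble_sq (he : IsTwoTorsionRoots W e₁ e₂ e₃) (h2 : (2 : k) ≠ 0)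
    (h : W.Equation x y) (hy : y ≠ W.negY x y) :
    sqrtDouble W e₁ e₂ e₃ x y ^ 2 = W.addX x x (W.slope x x y y) - e₁ := by
  have hdouble := mul_addX_self h hy
  rw [he.b₂_eq, he.b₄_eq, he.b₆_eq, he.b₈_eq h2] at hdouble
  rw [sqrtDouble, div_pow, div_eq_iff (pow_ne_zero 2 (sub_ne_zero.mpr hy)), he.sq_sub_negY h]
  linear_combination -hdouble

lemma IsTwoTorsionRoots.addX_self_add_sqrtDouble (he : IsTwoTorsionRoots W e₁ e₂ e₃)
    (h2 : (2 : k) ≠ 0) (h : W.Equation x y) (hy : y ≠ W.negY x y) :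
    W.addX x x (W.slope x x y y) + (sqrtDouble W e₁ e₂ e₃ x y * sqrtDouble W e₂ e₁ e₃ x y +
      sqrtDouble W e₁ e₂ e₃ x y * sqrtDouble W e₃ e₂ e₁ x y +
      sqrtDouble W e₂ e₁ e₃ x y * sqrtDouble W e₃ e₂ e₁ x y) = x := by
  have hη := sub_ne_zero.mpr hy
  have hsq := he.sq_sub_negY h
  have hprod : (sqrtDouble W e₁ e₂ e₃ x y + sqrtDouble W e₂ e₁ e₃ x y) *
      (sqrtDouble W e₁ e₂ e₃ x y + sqrtDouble W e₃ e₂ e₁ x y) = x - e₁ := by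
    rw [sqrtDouble_add_swap, sqrtDouble_add_rotate]
    generalize y - W.negY x y = η at *
    field_simp
    linear_combination -(x - e₁) * hsq
  linear_combination hprod - he.sqrtDouble_sq h2 h hy

end SqrtDouble

section Pullback

open WeierstrassCurve.Affine (Point)

variable {E E' : WeierstrassCurve.Affine F}

lemma eq_of_eventually_hasValueAt [E.IsElliptic] {u v : E.FunctionField}
    (h : ∀ᶠ P : GeomPoint E in cofinite, ∃ c, HasValueAt E u P c ∧ HasValueAt E v P c) :
    u = v := by
  by_contra hne
  obtain ⟨P, ⟨c, hu, hv⟩, hsub⟩ := (h.and (eventually_ne_zero (sub_ne_zero.mpr hne))).exists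
  exact hsub _ (hu.sub hv) (sub_self c)

lemma hasValueAt_two {u : E.FunctionField} {P : GeomPoint E} {c : F̄} (hu : HasValueAt E u P c) :
    HasValueAt E 2 P 2 := by
  simpa only [map_ofNat] using hasValueAt_const hu 2

/-- The rational function `u` is the pullback of `w` along `φ`. -/
def IsPullback (φ : Isogeny E E') (w : E'.FunctionField) (u : E.FunctionField) : Prop :=
  ∀ᶠ P in cofinite, ∃ c, HasValueAt E' w (φ.toHom P) c ∧ HasValueAt E u P c

lemma exists_isPullback [E.IsElliptic] (φ : Isogeny E E') (w : E'.FunctionField) :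
    ∃ u, IsPullback φ w u := by
  obtain ⟨a, d, hd, rfl⟩ := IsFractionRing.div_surjective (A := E'.CoordinateRing) w
  have hd0 := nonZeroDivisors.ne_zero hd
  obtain ⟨A, rfl⟩ := AdjoinRoot.mk_surjective a
  obtain ⟨D, rfl⟩ := AdjoinRoot.mk_surjective d
  refine ⟨aevalAeval φ.x φ.y A / aevalAeval φ.x φ.y D, ?_⟩
  filter_upwards [φ.eventually_eq, φ.tendsto_cofinite.eventually (eventually_affine_ne_zero hd0)]
    with P ⟨x, y, h, hP, hx, hy⟩ ⟨x', y', h', hP', hD⟩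
  rw [hP] at hP' ⊢
  obtain ⟨rfl, rfl⟩ := Point.some.inj hP'
  refine ⟨_, (hasValueAt_coe h _).div (hasValueAt_coe h _) hD, ?_⟩
  rw [evalGeom_mk] at hD
  rw [evalGeom_mk, evalGeom_mk]
  exact (hx.poly hy A).div (hx.poly hy D) hD

lemma IsPullback.neg {φ : Isogeny E E'} {w : E'.FunctionField} {u : E.FunctionField}
    (h : IsPullback φ w u) : IsPullback φ (-w) (-u) := by
  filter_upwards [h] with P ⟨c, hw, hu⟩
  exact ⟨-c, hw.neg, hu.neg⟩

end Pullback

section Halving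

open WeierstrassCurve.Affine (Point)

variable {E E' : WeierstrassCurve.Affine F}

/-- The rational function `y + (a₁ x + a₃) / 2` on `E'`, whose square is a cubic in `x`, evaluated
at elements `x` and `y` of an extension of the base field. -/
def completedY {K : Type*} [Field K] [Algebra F K] (E' : WeierstrassCurve.Affine F) (x y : K) : K :=
  y + (algebraMap F K E'.a₁ * x + algebraMap F K E'.a₃) / 2

lemma hasValueAt_completedY (E' : WeierstrassCurve.Affine F) (h2 : (2 : F) ≠ 0)
    {u v : E.FunctionField} {P : GeomPoint E} {x y : F̄} (hu : HasValueAt E u P x)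
    (hv : HasValueAt E v P y) :
    HasValueAt E (completedY E' u v) P ((y - (geom E').negY x y) / 2) := by
  have h2' := two_ne_zero_algebraicClosure h2
  have hconst := hasValueAt_const hu
  have hvalue : (y - (geom E').negY x y) / 2 =
      y + (algebraMap F F̄ E'.a₁ * x + algebraMap F F̄ E'.a₃) / 2 := by
    simp only [WeierstrassCurve.Affine.negY, WeierstrassCurve.map_a₁, WeierstrassCurve.map_a₃]
    field_simp
    ring
  rw [hvalue]
  exact hv.add ((((hconst E'.a₁).mul hu).add (hconst E'.a₃)).div (hasValueAt_two hu) h2')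

/-- The rational function on `E` with value `sqrtDouble` at the image under `φ`. -/
def Isogeny.sqrtDouble (φ : Isogeny E E') (a b c : F) : E.FunctionField :=
  ((φ.x - algebraMap F _ a) * (φ.x - algebraMap F _ b) +
    (φ.x - algebraMap F _ a) * (φ.x - algebraMap F _ c) -
    (φ.x - algebraMap F _ b) * (φ.x - algebraMap F _ c)) / (2 * completedY E' φ.x φ.y)

lemma Isogeny.eventually_hasValueAt_sqrtDouble [E.IsElliptic] [E'.IsElliptic] (h2 : (2 : F) ≠ 0)
    (φ : Isogeny E E') (a b c : F) :
    ∀ᶠ Q : GeomPoint E in cofinite, ∀ x y h, φ.toHom Q = .some x y h →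
      y ≠ (geom E').negY x y ∧
      HasValueAt E (φ.sqrtDouble a b c) Q (IsogenyGraph.sqrtDouble (geom E')
        (algebraMap F F̄ a) (algebraMap F F̄ b) (algebraMap F F̄ c) x y) := by
  have h2' := two_ne_zero_algebraicClosure h2
  have hfin : {T : GeomPoint E' | T + T = 0}.Finite :=
    Set.finite_of_ncard_ne_zero (by rw [ncard_setOf_add_self_eq_zero h2']; norm_num)
  filter_upwards [φ.eventually_eq,
    φ.tendsto_cofinite.eventually hfin.eventually_cofinite_notMem]
    with Q ⟨x', y', h', hQ', hx, hy⟩ htors x y h hQ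
  rw [hQ] at hQ' htors
  obtain ⟨rfl, rfl⟩ := Point.some.inj hQ'
  have hne : y ≠ (geom E').negY x y := fun h0 => htors (some_add_self_eq_zero_iff.mpr h0)
  have hconst := hasValueAt_const hx
  have hden := (hasValueAt_two hx).mul (hasValueAt_completedY E' h2 hx hy)
  rw [mul_div_cancel₀ _ h2'] at hden
  have ha := hx.sub (hconst a)
  have hb := hx.sub (hconst b)
  have hc := hx.sub (hconst c)
  exact ⟨hne, (((ha.mul hb).add (ha.mul hc)).sub (hb.mul hc)).div hden (sub_ne_zero.mpr hne)⟩

lemma IsPullback.eventually_hasValueAt_sqrtDouble [E.IsElliptic] [E'.IsElliptic]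
    (h2 : (2 : F) ≠ 0) {τ : Isogeny E E} {ψ : Isogeny E E'} {a b c : F} {w : E.FunctionField}
    (hw : IsPullback τ w (ψ.sqrtDouble a b c)) :
    ∀ᶠ Q : GeomPoint E in cofinite, ∀ x y h, ψ.toHom Q = .some x y h →
      HasValueAt E w (τ.toHom Q) (IsogenyGraph.sqrtDouble (geom E')
        (algebraMap F F̄ a) (algebraMap F F̄ b) (algebraMap F F̄ c) x y) := by
  filter_upwards [hw, ψ.eventually_hasValueAt_sqrtDouble h2 a b c]
    with Q ⟨σ, hwσ, hσ⟩ hroot x y h hQ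
  rwa [hσ.unique (hroot x y h hQ).2] at hwσ

lemma exists_hom_add_self_eq [E.IsElliptic] {G : Type*} [AddCommGroup G] (f : GeomPoint E →+ G)
    (hf : ∀ T, T + T = 0 → f T = 0) : ∃ g : GeomPoint E →+ G, ∀ Q, g (Q + Q) = f Q := by
  let double : GeomPoint E →+ GeomPoint E := AddMonoidHom.id _ + AddMonoidHom.id _
  have hsurj : Function.Surjective double := exists_add_self_eq
  exact ⟨double.liftOfSurjective hsurj ⟨f, hf⟩,
    double.liftOfRightInverse_comp_apply _ _ ⟨f, hf⟩⟩

lemma isHomOver_of_eventually_double [E.IsElliptic] {g : GeomPoint E →+ GeomPoint E'}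
    {u v : E.FunctionField}
    (h : ∀ᶠ Q : GeomPoint E in cofinite, ∃ x y, ∃ h, g (Q + Q) = .some x y h ∧
      HasValueAt E u (Q + Q) x ∧ HasValueAt E v (Q + Q) y) : IsHomOver E E' g := by
  refine Or.inr ⟨⟨⟨g, u, v⟩, ?_⟩, rfl⟩
  refine ((eventually_cofinite.mp h).image fun Q => Q + Q).subset fun P hP => ?_
  obtain ⟨Q, rfl⟩ := exists_add_self_eq P
  exact ⟨Q, hP, rfl⟩

/-- The half `g` of `ψ` has `ψ = 2g`, so the halving formulas recover the coordinates of
`g(2Q) = ψ(Q)` from those of `ψ(2Q) = 2ψ(Q)` and the square roots `w₁`, `w₂`, `w₃`. -/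
lemma Isogeny.exists_isHomOver_half [E.IsElliptic] [E'.IsElliptic] (h2 : (2 : F) ≠ 0)
    (ψ : Isogeny E E') (hψ : ∀ T, T + T = 0 → ψ.toHom T = 0)
    {τ : Isogeny E E} (hτ : ∀ P, τ.toHom P = P + P) {a b c : F}
    (he : IsTwoTorsionRoots (geom E') (algebraMap F F̄ a) (algebraMap F F̄ b) (algebraMap F F̄ c))
    {w₁ w₂ w₃ : E.FunctionField} (hw₁ : IsPullback τ w₁ (ψ.sqrtDouble a b c))
    (hw₂ : IsPullback τ w₂ (ψ.sqrtDouble b a c)) (hw₃ : IsPullback τ w₃ (ψ.sqrtDouble c b a)) :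
    ∃ g : GeomPoint E →+ GeomPoint E', IsHomOver E E' g ∧ ∀ Q, g (Q + Q) = ψ.toHom Q := by
  have h2' := two_ne_zero_algebraicClosure h2
  obtain ⟨g, hg⟩ := exists_hom_add_self_eq ψ.toHom hψ
  refine ⟨g, ?_, hg⟩
  let u := ψ.x + (w₁ * w₂ + w₁ * w₃ + w₂ * w₃)
  refine isHomOver_of_eventually_double (u := u) (v := (w₁ + w₂) * (w₁ + w₃) * (w₂ + w₃) -
    (algebraMap F _ E'.a₁ * u + algebraMap F _ E'.a₃) / 2) ?_
  filter_upwards [ψ.eventually_eq, ψ.eventually_hasValueAt_sqrtDouble h2 a b c,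
    hw₁.eventually_hasValueAt_sqrtDouble h2, hw₂.eventually_hasValueAt_sqrtDouble h2,
    hw₃.eventually_hasValueAt_sqrtDouble h2, τ.tendsto_cofinite.eventually ψ.eventually_eq]
    with Q ⟨x, y, h, hQ, _, _⟩ hroot hv₁ hv₂ hv₃ ⟨x₂, y₂, h₂, hQ₂, hx₂, _⟩
  have hy := (hroot x y h hQ).1
  replace hv₁ := hv₁ x y h hQ
  replace hv₂ := hv₂ x y h hQ
  replace hv₃ := hv₃ x y h hQ
  rw [hτ] at hv₁ hv₂ hv₃ hx₂ hQ₂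
  rw [map_add, hQ, Point.add_self_of_Y_ne hy] at hQ₂
  obtain ⟨rfl, -⟩ := Point.some.inj hQ₂
  have hu : HasValueAt E u (Q + Q) x := by
    have hsum := hx₂.add (((hv₁.mul hv₂).add (hv₁.mul hv₃)).add (hv₂.mul hv₃))
    rwa [he.addX_self_add_sqrtDouble h2' h.1 hy] at hsum
  refine ⟨x, y, h, (hg Q).trans hQ, hu, ?_⟩
  have hconst := hasValueAt_const hu
  convert (((hv₁.add hv₂).mul (hv₁.add hv₃)).mul (hv₂.add hv₃)).sub
    ((((hconst E'.a₁).mul hu).add (hconst E'.a₃)).div (hasValueAt_two hu) h2') using 1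
  rw [eq_sub_iff_add_eq, ← mul_right_inj' h2', he.two_mul_prod_sqrtDouble h.1 hy]
  simp only [WeierstrassCurve.Affine.negY, WeierstrassCurve.map_a₁, WeierstrassCurve.map_a₃]
  field_simp
  ring

end Halving

lemma exists_isogeny_eq_add_self (h2 : (2 : F) ≠ 0) (E : WeierstrassCurve.Affine F) [E.IsElliptic] :
    ∃ τ : Isogeny E E, ∀ P, τ.toHom P = P + P := by
  rcases (isHomOver_id E).add (isHomOver_id E) with hzero | ⟨τ, hτ⟩
  · have hq := isNormForm_endDeg h2 E
    have htwo : (2 : ℤ) • (1 : EndOver E) = 0 := by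
      rw [two_zsmul]
      exact Subtype.ext hzero
    have hdeg := hq.map_zsmul 2 1
    rw [htwo, hq.map_zero, hq.map_one] at hdeg
    norm_num at hdeg
  · exact ⟨τ, DFunLike.congr_fun hτ⟩

section FrobeniusHalving

open WeierstrassCurve.Affine (Point)

variable {p : ℕ} [Fact p.Prime] {E : WeierstrassCurve.Affine (ZMod p)}

local notation "𝔽̄" => AlgebraicClosure (ZMod p)

lemma exists_algebraMap_eq_of_pow_eq_self {x : 𝔽̄} (hx : x ^ p = x) :
    ∃ a, algebraMap (ZMod p) 𝔽̄ a = x :=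
  have hbot : (⊥ : Subfield 𝔽̄) ≤ (algebraMap (ZMod p) 𝔽̄).fieldRange := bot_le
  hbot ((Subfield.mem_bot_iff_pow_eq_self 𝔽̄ p).mpr hx)

lemma half_sub_negY_pow (x y : 𝔽̄) :
    2 * ((y - (geom E).negY x y) / 2) ^ p =
      2 * ((y ^ p - (geom E).negY (x ^ p) (y ^ p)) / 2) := by
  simp only [WeierstrassCurve.Affine.negY, WeierstrassCurve.map_a₁, WeierstrassCurve.map_a₃,
    ← frobAlg_apply, map_div₀, map_sub, map_neg, map_mul, map_ofNat, AlgHom.commutes]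

/-- If `e` is rational, then `(x - e) (x ^ p - e)` is the square `(x - e) ^ (p + 1)`. -/
lemma IsTwoTorsionRoots.sq_eq_addX_frob_sub (h2 : (2 : ZMod p) ≠ 0) {a : ZMod p} {e₂ e₃ x y : 𝔽̄}
    (he : IsTwoTorsionRoots (geom E) (algebraMap _ _ a) e₂ e₃) (h : (geom E).Nonsingular x y)
    (hx : x ^ p - x ≠ 0) (hxa : x - algebraMap _ _ a ≠ 0) :
    (((y - (geom E).negY x y) / 2 + (((y - (geom E).negY x y) / 2) ^ p -
      (y - (geom E).negY x y) / 2) / (x ^ p - x) * (algebraMap _ _ a - x)) /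
        (x - algebraMap _ _ a) ^ ((p + 1) / 2)) ^ 2 =
      (geom E).addX x (x ^ p) ((geom E).slope x (x ^ p) y (y ^ p)) - algebraMap _ _ a := by
  have h2' := two_ne_zero_algebraicClosure h2
  obtain ⟨hfrob, -⟩ := frob_some h
  have hsub := he.addX_sub h2' h.1 hfrob.1 (sub_ne_zero.mp hx).symm (mul_div_cancel₀ _ h2')
    ((half_sub_negY_pow x y).trans (mul_div_cancel₀ _ h2'))
  have hxp : x ^ p - algebraMap (ZMod p) 𝔽̄ a = (x - algebraMap (ZMod p) 𝔽̄ a) ^ p := by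
    rw [← frobAlg_apply, ← frobAlg_apply, map_sub, AlgHom.commutes]
  have hodd : Odd p := (Fact.out : p.Prime).odd_of_ne_two fun hp => h2 <| by
    subst hp
    rfl
  have hpow : ((x - algebraMap (ZMod p) 𝔽̄ a) ^ ((p + 1) / 2)) ^ 2 =
      (x - algebraMap (ZMod p) 𝔽̄ a) * (x ^ p - algebraMap (ZMod p) 𝔽̄ a) := by
    rw [hxp, ← pow_mul, ← pow_succ', Nat.div_mul_cancel hodd.add_one.two_dvd]
  rw [div_pow, ← hsub, hpow, mul_div_cancel_right₀]
  exact mul_ne_zero hxa (hxp ▸ pow_ne_zero p hxa)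

lemma exists_hasValueAt_sq_eq_add_frob_sub (h2 : (2 : ZMod p) ≠ 0) {a : ZMod p} {e₂ e₃ : 𝔽̄}
    (he : IsTwoTorsionRoots (geom E) (algebraMap _ _ a) e₂ e₃) :
    ∃ r : E.FunctionField, ∀ᶠ P : GeomPoint E in cofinite, ∀ x y h,
      P + frob E P = .some x y h → ∃ ρ, HasValueAt E r P ρ ∧ ρ ^ 2 = x - algebraMap _ _ a := by
  let η := completedY E (ofX E X) (coordY E)
  have hpow : ofX E X ^ p - ofX E X ≠ 0 := by
    rw [← map_pow, ← map_sub]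
    exact (map_ne_zero_iff _ ofX_injective).mpr
      (FiniteField.X_pow_card_sub_X_ne_zero (ZMod p) (Fact.out : p.Prime).one_lt)
  have hsub : ofX E X - ofX E (C a) ≠ 0 := by
    rw [← map_sub]
    exact (map_ne_zero_iff _ ofX_injective).mpr (X_sub_C_ne_zero a)
  refine ⟨(η + (η ^ p - η) / (ofX E X ^ p - ofX E X) * (ofX E (C a) - ofX E X)) /
    (ofX E X - ofX E (C a)) ^ ((p + 1) / 2), ?_⟩
  filter_upwards [eventually_affine E, eventually_ne_zero hpow, eventually_ne_zero hsub]
    with P ⟨x, y, h, hP⟩ hpow hsub x₃ y₃ h₃ hsum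
  subst hP
  have hvx : HasValueAt E (ofX E X) (.some x y h) x := by simpa using hasValueAt_ofX h X
  have hva : HasValueAt E (ofX E (C a)) (.some x y h) (algebraMap _ _ a) := by
    simpa using hasValueAt_ofX h (C a)
  have hvη : HasValueAt E η _ _ := hasValueAt_completedY E h2 hvx (hasValueAt_coordY h)
  replace hpow := hpow _ ((hvx.pow p).sub hvx)
  replace hsub := hsub _ (hvx.sub hva)
  refine ⟨_, (hvη.add ((((hvη.pow p).sub hvη).div ((hvx.pow p).sub hvx) hpow).mul
    (hva.sub hvx))).div ((hvx.sub hva).pow _) (pow_ne_zero _ hsub), ?_⟩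
  obtain ⟨_, hfrob⟩ := frob_some h
  rw [hfrob, Point.add_of_X_ne (sub_ne_zero.mp hpow).symm] at hsum
  rw [he.sq_eq_addX_frob_sub h2 h hpow hsub, (Point.some.inj hsum).1]

variable [E.IsElliptic]

lemma exists_isPullback_sqrtDouble (h2 : (2 : ZMod p) ≠ 0) {τ ψ : Isogeny E E}
    (hτ : ∀ P, τ.toHom P = P + P) (hψ : ∀ P, ψ.toHom P = P + frob E P) {a b c : ZMod p}
    (he : IsTwoTorsionRoots (geom E) (algebraMap _ 𝔽̄ a) (algebraMap _ 𝔽̄ b)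
      (algebraMap _ 𝔽̄ c)) :
    ∃ w, IsPullback τ w (ψ.sqrtDouble a b c) := by
  obtain ⟨r, hr⟩ := exists_hasValueAt_sq_eq_add_frob_sub h2 he
  obtain ⟨s, hs⟩ := exists_isPullback τ r
  have hsq : s * s = ψ.sqrtDouble a b c * ψ.sqrtDouble a b c := by
    refine eq_of_eventually_hasValueAt ?_
    filter_upwards [ψ.eventually_eq, ψ.eventually_hasValueAt_sqrtDouble h2 a b c, hs,
      τ.tendsto_cofinite.eventually hr] with Q ⟨x, y, h, hQ, _, _⟩ hroot ⟨ρ, hrρ, hsρ⟩ hr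
    obtain ⟨hy, hv⟩ := hroot x y h hQ
    have hdouble : τ.toHom Q + frob E (τ.toHom Q) = .some x y h + .some x y h := by
      rw [← hQ, hψ, hτ, map_add, add_add_add_comm]
    rw [Point.add_self_of_Y_ne hy] at hdouble
    obtain ⟨ρ', hrρ', hρ'⟩ := hr _ _ _ hdouble
    obtain rfl := hrρ.unique hrρ'
    refine ⟨ρ * ρ, hsρ.mul hsρ, ?_⟩
    have hρsq := hρ'.trans (he.sqrtDouble_sq (two_ne_zero_algebraicClosure h2) h.1 hy).symm
    rw [sq, sq] at hρsq
    exact hρsq ▸ hv.mul hv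
  rcases mul_self_eq_mul_self_iff.mp hsq with rfl | rfl
  · exact ⟨r, hs⟩
  · exact ⟨-r, by simpa only [neg_neg] using hs.neg⟩

lemma exists_isTwoTorsionRoots_algebraMap (h2 : (2 : ZMod p) ≠ 0)
    (hrat : ∀ T : GeomPoint E, T + T = 0 → frob E T = T) :
    ∃ a b c : ZMod p, IsTwoTorsionRoots (geom E) (algebraMap _ _ a) (algebraMap _ _ b)
      (algebraMap _ _ c) := by
  have h2' := two_ne_zero_algebraicClosure h2
  have hroot {e₁ e₂ e₃ : 𝔽̄} (he : IsTwoTorsionRoots (geom E) e₁ e₂ e₃) :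
      ∃ a, algebraMap (ZMod p) 𝔽̄ a = e₁ := by
    have hfix := hrat _ (twoTorsionPoint_add_self h2' he)
    obtain ⟨_, hfrob⟩ := frob_some (he.nonsingular h2')
    exact exists_algebraMap_eq_of_pow_eq_self (Point.some.inj (hfrob.symm.trans hfix)).1
  obtain ⟨e₁, e₂, e₃, he, -⟩ := exists_isTwoTorsionRoots h2' (geom E)
  obtain ⟨a, rfl⟩ := hroot he
  obtain ⟨b, rfl⟩ := hroot he.swap₁₂
  obtain ⟨c, rfl⟩ := hroot he.swap₁₃
  exact ⟨a, b, c, he⟩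

theorem exists_isHomOver_half_one_add_frob (h2 : (2 : ZMod p) ≠ 0)
    (hrat : ∀ T : GeomPoint E, T + T = 0 → frob E T = T) :
    ∃ g : GeomPoint E →+ GeomPoint E, IsHomOver E E g ∧ ∀ Q, g (Q + Q) = Q + frob E Q := by
  obtain ⟨τ, hτ⟩ := exists_isogeny_eq_add_self h2 E
  rcases (isHomOver_id E).add (isHomOver_frob (E := E)) with hzero | ⟨ψ, hψ⟩
  · exact ⟨0, .inl rfl, fun Q => (DFunLike.congr_fun hzero Q).symm⟩
  replace hψ : ∀ P, ψ.toHom P = P + frob E P := DFunLike.congr_fun hψ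
  obtain ⟨a, b, c, he⟩ := exists_isTwoTorsionRoots_algebraMap h2 hrat
  obtain ⟨w₁, hw₁⟩ := exists_isPullback_sqrtDouble h2 hτ hψ he
  obtain ⟨w₂, hw₂⟩ := exists_isPullback_sqrtDouble h2 hτ hψ he.swap₁₂
  obtain ⟨w₃, hw₃⟩ := exists_isPullback_sqrtDouble h2 hτ hψ he.swap₁₃
  have hker (T : GeomPoint E) (hT : T + T = 0) : ψ.toHom T = 0 := by rw [hψ, hrat T hT, hT]
  obtain ⟨g, hg, hgψ⟩ := ψ.exists_isHomOver_half h2 hker hτ he hw₁ hw₂ hw₃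
  exact ⟨g, hg, fun Q => (hgψ Q).trans (hψ Q)⟩

end FrobeniusHalving

/-! ### Degrees of isogenies with a point of order two in the kernel -/

section Involution

variable {k : Type*} [Field k] {e r : k}

/-- The rational function `e + r / (X - e)`, as a numerator and a denominator. -/
def involution (e r : k) : Fin 2 → k[X] :=
  ![C e * (X - C e) + C r, X - C e]

lemma hasHeight_involution (hr : r ≠ 0) : HasHeight (involution e r) 1 where
  natDegree_le i := by
    fin_cases i
    · exact natDegree_add_le_of_degree_le ((natDegree_C_mul_le _ _).trans (by simp)) (by simp)
    · simp [involution]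
  coeff_ne := ⟨1, by simp [involution]⟩
  eval_ne z := by
    by_cases hz : z = e
    · exact ⟨0, by simpa [involution, hz] using hr⟩
    · exact ⟨1, by simpa [involution] using sub_ne_zero.mpr hz⟩

lemma eval_involution {x x' : k} (h : (x' - e) * (x - e) = r) :
    (fun i => (involution e r i).eval x) = fun i => (x - e) * (![x', 1] : Fin 2 → k) i := by
  ext i
  fin_cases i <;> simp [involution, ← h]
  ring

/-- At the fixed points `e ± s`, where `s ^ 2 = r`, invariance multiplies the numerator and the
denominator by `(± s) ^ m`, whereas the factor does not depend on the point. -/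
lemma HasHeight.even_of_proportional_involution [IsAlgClosed k] (h2 : (2 : k) ≠ 0)
    {v : Fin 2 → k[X]} {m : ℕ} (hr : r ≠ 0) (hv : HasHeight v m)
    (h : Proportional v fun j => MvPolynomial.aeval (involution e r) ((v j).homogenize m)) :
    Even m := by
  obtain ⟨c, -, hc⟩ := hv.exists_eq_mul_C_of_proportional (hv.comp (hasHeight_involution hr)) h
  have hpow (s : k) (hs : s ^ 2 = r) : s ^ m = c := by
    obtain ⟨i, hi⟩ := hv.eval_ne (e + s)
    have hfix : (e + s - e) * (e + s - e) = r := by rw [add_sub_cancel_left, ← sq, hs]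
    have heval := congrArg (eval (e + s)) (hc i)
    rw [eval_mvPolynomial_aeval, eval_involution hfix,
      eval_homogenize_const_mul (hv.natDegree_le i), add_sub_cancel_left, eval_mul, eval_C,
      mul_comm] at heval
    exact mul_left_cancel₀ hi heval
  obtain ⟨s, hs⟩ := IsAlgClosed.exists_pow_nat_eq r zero_lt_two
  have hs0 : s ≠ 0 := by
    rintro rfl
    exact hr (by rw [← hs, zero_pow two_ne_zero])
  by_contra hm
  have hneg := (hpow s hs).trans (hpow (-s) (by rw [neg_sq, hs])).symm
  rw [(Nat.not_even_iff_odd.mp hm).neg_pow, eq_neg_iff_add_eq_zero, ← two_mul] at hneg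
  exact mul_ne_zero h2 (pow_ne_zero _ hs0) hneg

end Involution

section Translation

open WeierstrassCurve.Affine (Point)

lemma addX_sub_mul_sub {k : Type*} [Field k] [DecidableEq k] {W : WeierstrassCurve.Affine k}
    {e t x y : k} (hT : W.Equation e t) (ht : t = W.negY e t) (h : W.Equation x y) (hx : x ≠ e) :
    (W.addX x e (W.slope x e y t) - e) * (x - e) =
      3 * e ^ 2 + 2 * W.a₂ * e + W.a₄ - W.a₁ * t := by
  have hxe : x - e ≠ 0 := sub_ne_zero.mpr hx
  rw [WeierstrassCurve.Affine.equation_iff] at hT h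
  rw [WeierstrassCurve.Affine.negY] at ht
  rw [WeierstrassCurve.Affine.slope_of_X_ne hx, WeierstrassCurve.Affine.addX]
  field_simp
  linear_combination h - hT - (y - t) * ht

variable {E E' : WeierstrassCurve.Affine F}

lemma hasXRep_add_right {e t : F̄} (hT : (geom E).Nonsingular e t)
    (ht : t = (geom E).negY e t) :
    HasXRep (fun P : GeomPoint E => P + .some e t hT) (involution e
      (3 * e ^ 2 + 2 * (geom E).a₂ * e + (geom E).a₄ - (geom E).a₁ * t)) := by
  filter_upwards [(Set.finite_singleton (Point.some e t hT)).eventually_cofinite_notMem]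
    with P hne x y h hP
  subst hP
  have hx : x ≠ e := by
    rintro rfl
    rcases WeierstrassCurve.Affine.Y_eq_of_X_eq h.1 hT.1 rfl with rfl | hy
    · exact hne rfl
    · rw [← ht] at hy
      subst hy
      exact hne rfl
  refine ⟨x - e, sub_ne_zero.mpr hx, fun i => ?_⟩
  rw [Point.add_of_X_ne hx, Point.xRep_some]
  exact congrFun (eval_involution (addX_sub_mul_sub hT.1 ht h.1 hx)) i

lemma HasXRep.even_of_two_torsion [E.IsElliptic] (h2 : (2 : F) ≠ 0)
    {f : GeomPoint E →+ GeomPoint E'} {v : Fin 2 → F̄[X]} {m : ℕ} (hf : HasXRep f v)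
    (hv : HasHeight v m) {T : GeomPoint E} (hT0 : T ≠ 0) (hT : T + T = 0) (hfT : f T = 0) :
    Even m := by
  rcases T with _ | ⟨e, t, hN⟩
  · exact absurd rfl hT0
  have ht := some_add_self_eq_zero_iff.mp hT
  have hr : 3 * e ^ 2 + 2 * (geom E).a₂ * e + (geom E).a₄ - (geom E).a₁ * t ≠ 0 :=
    sub_ne_zero.mpr (((WeierstrassCurve.Affine.nonsingular_iff _ _).mp hN).2.resolve_right
      (not_not.mpr ht)).symm
  have hinv : f ∘ (fun P => P + .some e t hN) = f := by
    ext P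
    rw [Function.comp_apply, map_add, hfT, add_zero]
  have hcomp := hf.comp hv (hasXRep_add_right hN ht) (add_left_injective _).tendsto_cofinite
  rw [hinv] at hcomp
  exact hv.even_of_proportional_involution (two_ne_zero_algebraicClosure h2) hr
    (hf.proportional hcomp)

end Translation

section FunctionFieldDegree

variable (E : WeierstrassCurve.Affine F)

/-- A rational function of the coordinate `x`, as a rational function on `E`. -/
def ofRatFunc : RatFunc F →ₐ[F] E.FunctionField :=
  RatFunc.liftAlgHom
    { ofX E with
      commutes' := fun r => by
        rw [IsScalarTower.algebraMap_apply F E.CoordinateRing E.FunctionField]; rfl }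
    fun p hp => by
      rw [Submonoid.mem_comap, mem_nonZeroDivisors_iff_ne_zero]
      exact (map_ne_zero_iff _ ofX_injective).mpr (nonZeroDivisors.ne_zero hp)

/-- `E.FunctionField` as an extension of the rational functions in `x`. It is not an instance: the
embedding of `RatFunc F` depends on the choice of the coordinate. -/
abbrev ratFuncAlgebra : Algebra (RatFunc F) E.FunctionField :=
  (ofRatFunc E).toRingHom.toAlgebra

variable {E}

lemma ofRatFunc_algebraMap (p : F[X]) : ofRatFunc E (algebraMap F[X] (RatFunc F) p) = ofX E p := by
  rw [ofRatFunc, RatFunc.liftAlgHom_apply]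
  simp

lemma ofRatFunc_mul_ofX_denom (f : RatFunc F) :
    ofRatFunc E f * ofX E f.denom = ofX E f.num := by
  rw [← ofRatFunc_algebraMap, ← ofRatFunc_algebraMap, ← map_mul,
    (eq_div_iff (RatFunc.algebraMap_ne_zero f.denom_ne_zero)).mp f.num_div_denom.symm]

variable (E)

lemma linearIndependent_one_coordY :
    letI := ratFuncAlgebra E
    LinearIndependent (RatFunc F) ![1, coordY E] := by
  let _ := ratFuncAlgebra E
  rw [LinearIndependent.pair_iff]
  intro f g h
  replace h : ofRatFunc E f * 1 + ofRatFunc E g * coordY E = 0 := h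
  have hnum := eq_zero_of_ofX_add_ofX_mul_coordY_eq_zero (E := E)
    (p := f.num * g.denom) (q := g.num * f.denom) (by
      rw [map_mul, map_mul, ← ofRatFunc_mul_ofX_denom, ← ofRatFunc_mul_ofX_denom]
      linear_combination ofX E f.denom * ofX E g.denom * h)
  simpa [f.denom_ne_zero, g.denom_ne_zero] using hnum

lemma span_one_coordY :
    letI := ratFuncAlgebra E
    Submodule.span (RatFunc F) (Set.range ![1, coordY E]) = ⊤ := by
  let _ := ratFuncAlgebra E
  rw [Matrix.range_cons, Matrix.range_cons, Matrix.range_empty, Set.union_empty,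
    Set.singleton_union, eq_top_iff]
  rintro u -
  obtain ⟨p, q, N, hN, h⟩ := exists_mul_ofX_eq u
  have hN' := (map_ne_zero_iff _ (ofX_injective (E := E))).mpr hN
  refine Submodule.mem_span_pair.mpr ⟨algebraMap F[X] (RatFunc F) p / algebraMap F[X] _ N,
    algebraMap F[X] (RatFunc F) q / algebraMap F[X] _ N, ?_⟩
  rw [Algebra.smul_def, Algebra.smul_def]
  change ofRatFunc E _ * 1 + ofRatFunc E _ * coordY E = u
  rw [map_div₀, map_div₀, ofRatFunc_algebraMap, ofRatFunc_algebraMap, ofRatFunc_algebraMap,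
    mul_one, div_mul_eq_mul_div, ← add_div, ← h, mul_div_cancel_right₀ _ hN']

lemma finrank_ratFunc_functionField :
    letI := ratFuncAlgebra E
    Module.finrank (RatFunc F) E.FunctionField = 2 := by
  let _ := ratFuncAlgebra E
  rw [Module.finrank_eq_card_basis
    (Module.Basis.mk (linearIndependent_one_coordY E) (span_one_coordY E).ge), Fintype.card_fin]

variable {E}

lemma finrank_adjoin_ofRatFunc (f : RatFunc F) :
    Module.finrank (IntermediateField.adjoin F {ofRatFunc E f}) E.FunctionField =
      max f.num.natDegree f.denom.natDegree * 2 := by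
  let _ := ratFuncAlgebra E
  have : IsScalarTower F (RatFunc F) E.FunctionField := .of_algebraMap_eq fun x =>
    ((ofRatFunc E).commutes x).symm
  let A := IntermediateField.adjoin F {f}
  have hmap : A.map (ofRatFunc E) = IntermediateField.adjoin F {ofRatFunc E f} := by
    rw [IntermediateField.adjoin_map, Set.image_singleton]
  rw [← RatFunc.finrank_eq_max_natDegree, ← finrank_ratFunc_functionField E, ← hmap,
    Module.finrank_mul_finrank]
  exact (Algebra.finrank_eq_of_equiv_equiv (A.equivMap (ofRatFunc E)).toRingEquiv
    (RingEquiv.refl _) rfl).symm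

end FunctionFieldDegree

section IsogenyDegree

variable {E E' : WeierstrassCurve.Affine F} [E.IsElliptic]

lemma Isogeny.equation (φ : Isogeny E E') :
    (E'.map (algebraMap F E.FunctionField)).toAffine.Equation φ.x φ.y := by
  rw [WeierstrassCurve.Affine.equation_iff]
  refine eq_of_eventually_hasValueAt ?_
  filter_upwards [φ.eventually_eq] with P ⟨a, b, h, _, hx, hy⟩
  have hconst := hasValueAt_const hx
  have heq := (WeierstrassCurve.Affine.equation_iff _ _).mp h.1
  refine ⟨_, ((hy.pow 2).add (((hconst _).mul hx).mul hy)).add ((hconst _).mul hy), ?_⟩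
  exact heq ▸ (((hx.pow 3).add ((hconst _).mul (hx.pow 2))).add ((hconst _).mul hx)).add (hconst _)

lemma Isogeny.exists_monic_aeval_y_eq_zero (φ : Isogeny E E') :
    ∃ q : (IntermediateField.adjoin F {φ.x})[X], q.Monic ∧ q.natDegree = 2 ∧ aeval φ.y q = 0 := by
  let A := IntermediateField.adjoin F {φ.x}
  let x : A := IntermediateField.AdjoinSimple.gen F φ.x
  let W : WeierstrassCurve.Affine A := E'.map (algebraMap F A)
  refine ⟨W.polynomial.map (evalRingHom x), W.monic_polynomial.map _, ?_, ?_⟩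
  · rw [W.monic_polynomial.natDegree_map, W.natDegree_polynomial]
  · have hW : W.map (algebraMap A E.FunctionField) = E'.map (algebraMap F E.FunctionField) :=
      WeierstrassCurve.map_map ..
    have hhom : (algebraMap A E.FunctionField).comp (evalRingHom x) =
        (evalRingHom φ.x).comp (mapRingHom (algebraMap A E.FunctionField)) := by
      ext <;> simp [x]
    rw [aeval_def, eval₂_map, hhom, ← eval₂_map, eval₂_evalRingHom,
      ← WeierstrassCurve.Affine.map_polynomial, hW]
    exact φ.equation

lemma Isogeny.finrank_adjoin_x_dvd (φ : Isogeny E E') :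
    Module.finrank (IntermediateField.adjoin F {φ.x}) E.FunctionField ∣ 2 * φ.degree := by
  let A := IntermediateField.adjoin F {φ.x}
  obtain ⟨q, hq, hdeg, hroot⟩ := φ.exists_monic_aeval_y_eq_zero
  have hint : IsIntegral A φ.y := ⟨q, hq, hroot⟩
  have hle : (minpoly A φ.y).natDegree ≤ 2 :=
    hdeg ▸ natDegree_le_natDegree (minpoly.min A φ.y hq hroot)
  have hdvd : (minpoly A φ.y).natDegree ∣ 2 := by
    have hpos := minpoly.natDegree_pos hint
    interval_cases (minpoly A φ.y).natDegree <;> decide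
  have hdegree : φ.degree = Module.finrank (IntermediateField.adjoin A {φ.y}) E.FunctionField := by
    rw [Isogeny.degree, ← IntermediateField.adjoin_simple_adjoin_simple]
    rfl
  rw [hdegree, ← Module.finrank_mul_finrank A (IntermediateField.adjoin A {φ.y}) E.FunctionField,
    IntermediateField.adjoin.finrank hint]
  exact mul_dvd_mul_right hdvd _

theorem Isogeny.two_dvd_degree (h2 : (2 : F) ≠ 0) (φ : Isogeny E E') {T : GeomPoint E}
    (hT0 : T ≠ 0) (hT : T + T = 0) (hφT : φ.toHom T = 0) : 2 ∣ φ.degree := by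
  obtain ⟨n, d, -, hd, h⟩ := φ.exists_x_mul_ofX_eq h2
  have hd' := (map_ne_zero_iff _ (ofX_injective (E := E))).mpr hd
  obtain ⟨f, hf⟩ : ∃ f, ofRatFunc E f = φ.x :=
    ⟨algebraMap F[X] _ n / algebraMap F[X] _ d, by
      rw [map_div₀, ofRatFunc_algebraMap, ofRatFunc_algebraMap, ← h, mul_div_cancel_right₀ _ hd']⟩
  have hheight : Even (max f.num.natDegree f.denom.natDegree) :=
    HasXRep.even_of_two_torsion h2
      (φ.hasXRep f.denom_ne_zero (by rw [← hf, ofRatFunc_mul_ofX_denom]))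
      (.map_of_isCoprime f.isCoprime_num_denom) hT0 hT hφT
  have hdvd := φ.finrank_adjoin_x_dvd
  rw [← hf, finrank_adjoin_ofRatFunc] at hdvd
  exact (even_iff_two_dvd.mp hheight).trans (Nat.dvd_of_mul_dvd_mul_right zero_lt_two
    (hdvd.trans (mul_comm _ _).dvd))

end IsogenyDegree

/-! ### Isogenies without points of order two in the kernel -/

section Horizontal

lemma image_setOf_add_self_eq_zero (h2 : (2 : F) ≠ 0) {E E' : WeierstrassCurve.Affine F}
    [E.IsElliptic] [E'.IsElliptic] {f : GeomPoint E →+ GeomPoint E'}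
    (hker : ∀ T, T + T = 0 → f T = 0 → T = 0) :
    f '' {T | T + T = 0} = {T | T + T = 0} := by
  have h2' := two_ne_zero_algebraicClosure h2
  have hcard := ncard_setOf_add_self_eq_zero (W := geom E') h2'
  have hinj : Set.InjOn f {T | T + T = 0} := fun A hA B hB hAB => by
    rw [Set.mem_ofPred_eq] at hA hB
    refine sub_eq_zero.mp (hker _ ?_ (by rw [map_sub, hAB, sub_self]))
    rw [sub_add_sub_comm, hA, hB, sub_zero]
  have hmaps : Set.MapsTo f {T | T + T = 0} {T | T + T = 0} := fun A hA => by
    rw [Set.mem_ofPred_eq] at hA ⊢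
    rw [← map_add, hA, map_zero]
  refine Set.eq_of_subset_of_ncard_le hmaps.image_subset ?_
    (Set.finite_of_ncard_ne_zero (by rw [hcard]; norm_num))
  rw [hinj.ncard_image, hcard, ncard_setOf_add_self_eq_zero h2']

variable {p : ℕ} [Fact p.Prime] {E E' : WeierstrassCurve.Affine (ZMod p)} [E.IsElliptic]

lemma exists_two_zsmul_eq_one_add_frobEnd_iff (h2 : (2 : ZMod p) ≠ 0) :
    (∃ f : EndOver E, (2 : ℤ) • f = 1 + frobEnd E) ↔
      ∀ T : GeomPoint E, T + T = 0 → frob E T = T := by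
  have hiff (f : EndOver E) :
      (2 : ℤ) • f = 1 + frobEnd E ↔ ∀ Q, f.1 (Q + Q) = Q + frob E Q := by
    simp only [map_add, two_zsmul, Subtype.ext_iff, DFunLike.ext_iff]
    rfl
  simp only [hiff]
  constructor
  · rintro ⟨f, hf⟩ T hT
    have hzero := hf T
    rw [hT, map_zero] at hzero
    exact add_left_cancel (hzero.symm.trans hT.symm)
  · intro hrat
    obtain ⟨g, hg, hhalf⟩ := exists_isHomOver_half_one_add_frob h2 hrat
    exact ⟨⟨g, hg⟩, hhalf⟩

variable [E'.IsElliptic]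

lemma IsHomOver.forall_frob_eq_self_iff (h2 : (2 : ZMod p) ≠ 0)
    {f : GeomPoint E →+ GeomPoint E'} (hf : IsHomOver E E' f)
    (hker : ∀ T, T + T = 0 → f T = 0 → T = 0) :
    (∀ T : GeomPoint E, T + T = 0 → frob E T = T) ↔
      ∀ T : GeomPoint E', T + T = 0 → frob E' T = T := by
  constructor
  · intro hrat T hT
    obtain ⟨A, hA, rfl⟩ : T ∈ f '' {A | A + A = 0} := by
      rw [image_setOf_add_self_eq_zero h2 hker]
      exact hT
    rw [← hf.frob_comm, hrat A hA]
  · intro hrat T hT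
    refine sub_eq_zero.mp (hker _ ?_ ?_)
    · rw [sub_add_sub_comm, ← map_add, hT, map_zero, sub_zero]
    · rw [map_sub, hf.frob_comm, hrat (f T) (by rw [← map_add, hT, map_zero]), sub_self]

theorem Isogeny.isHorizontal_of_forall_two_torsion (hp : 3 < p) (hE : IsSupersingular p E)
    (hE' : IsSupersingular p E') (φ : Isogeny E E')
    (hker : ∀ T, T + T = 0 → φ.toHom T = 0 → T = 0) : φ.IsHorizontal := by
  have h2 := two_ne_zero_of_lt hp
  refine (isQuadOrder_frobEnd hp hE).nonempty_ringEquiv (isQuadOrder_frobEnd hp hE') ?_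
  rw [exists_two_zsmul_eq_one_add_frobEnd_iff h2, exists_two_zsmul_eq_one_add_frobEnd_iff h2]
  exact IsHomOver.forall_frob_eq_self_iff h2 (.inr ⟨φ, rfl⟩) hker

end Horizontal

end

end IsogenyGraph

theorem mainTheorem5 (p : ℕ) [Fact p.Prime] (hp : 3 < p)
    (E E' : WeierstrassCurve (ZMod p)) [E.IsElliptic] [E'.IsElliptic]
    (hE : IsogenyGraph.IsSupersingular p E) (hE' : IsogenyGraph.IsSupersingular p E')
    (φ : IsogenyGraph.Isogeny E E') (hφ : ¬ φ.IsHorizontal) :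
    2 ∣ φ.degree := by
  by_contra hdeg
  refine hφ (φ.isHorizontal_of_forall_two_torsion hp hE hE' fun T hT hφT => ?_)
  by_contra hT0
  exact hdeg (φ.two_dvd_degree (IsogenyGraph.two_ne_zero_of_lt hp) hT0 hT hφT)
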